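/- **Setting.** A (quantum) gate is a trace-preserving completely positive linear map on the matrices over one or two qubits. A two-qubit gate $\mathcal E$ is *separable* if $\mathcal E(\rho)=\sum_j (A_j\otimes B_j)\,\rho\,(A_j^\dagger\otimes B_j^\dagger)$ for finitely many one-qubit operators $A_j,B_j$. A circuit over a set $\mathcal G$ of one- and two-qubit gates consists of $q$ qubits, a finite sequence of gates of $\mathcal G$, each applied to one qubit or to an ordered pair of distinct qubits, and a prespecified subset $S$ of the qubits. Started in a computational basis state $|x\rangle$, $x\in\{0,1\}^q$, and concluded by a measurement of the qubits in $S$ in the computational basis, it yields a probability distribution $p_x(y)$ over outcomes $y\in\{0,1\}^S$. The $L_1$ distance of two distributions is $D(r,s)=\frac12\sum_y|r(y)-s(y)|$. Classical algorithms are programs that operate on binary trees (a WHILE language with a bounded number of steps charged for each instruction) and may toss fair coins; their step counts agree with those of multitape Turing machines up to polynomial factors. A bound on the number of steps holds for every sequence of coin tosses. Numbers $n$ and $\lceil 1/\epsilon\rceil$ are given in unary. A real number $r$ is *computable with exponent $d$* if some algorithm, given an integer $N\ge1$, finds in $O(N^d)$ steps an integer $a$ with $|r-a/N|\le 1/N$.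 A gate is computable with exponent $d$ if the real and imaginary parts of all its matrix entries $\mathcal E(|i\rangle\langle j|)_{kl}$ are. **Theorem.** For every $d$ there is $k\in\mathbb N$ such that the following holds for every finite set $\mathcal G$ of one- and two-qubit gates which are computable with exponent $d$ and whose two-qubit members are all separable. 1. There are a randomized classical algorithm and a constant $K$ such that for every circuit $C$ over $\mathcal G$, with $p$ gates and with $u$ qubits on which no gate acts, every basis state $x$ and every $0<\epsilon\le 1$, the algorithm, given a description of $C$, $x$ and $\lceil 1/\epsilon\rceil$, halts within $$K\,\Big(\frac{p+u+1}{\epsilon}\Big)^k$$ steps and outputs a sample $y$ from a distribution $\tilde p_x(y)$ with $D(p_x,\tilde p_x)<\epsilon$. 2. Let $\{C_n\}$ be a uniform family of circuits over $\mathcal G$, that is, some algorithm outputs, given $n$, a description of $C_n$ within $t(n)$ steps. Let $p(n)$ be the number of gates of $C_n$ and $u(n)$ the number of its qubits on which no gate acts. Then there are a randomized classical algorithm and a constant $K$ such that for all $n$, all basis states $x$ and all $0<\epsilon\le 1$ the algorithm, given $n$, $x$ and $\lceil 1/\epsilon\rceil$, halts within $$K\,\Big(t(n)+\Big(\frac{p(n)+u(n)+1}{\epsilon}\Big)^k\Big)$$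 steps and outputs a sample $y$ from a distribution $\tilde p_x(y)$ with $D(p_x,\tilde p_x)<\epsilon$. In particular, if every qubit is acted on by some gate, the number of steps, apart from the generation of the circuit, is $O(\mathrm{poly}(p(n)/\epsilon))$ with a polynomial whose degree does not depend on the circuit family. -/

import Mathlib

open scoped Kronecker

namespace SepSim

/-! ### Quantum gates -/

/-- A trace-preserving quantum operation on the system whose computational basis is indexed
by `n`: a linear map on `n × n` matrices that has an operator-sum representation (that is, a
completely positive map) and preserves the trace. -/
structure Gate (n : Type) [Fintype n] [DecidableEq n] where
  /-- the action of the gate on matrices -/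
  map : Matrix n n ℂ →ₗ[ℂ] Matrix n n ℂ
  operator_sum : ∃ (r : ℕ) (K : Fin r → Matrix n n ℂ), ∀ ρ, map ρ = ∑ j, K j * ρ * (K j).conjTranspose
  trace_preserving : ∀ ρ, (map ρ).trace = ρ.trace

/-- A two-qubit gate is separable if it has an operator-sum representation
`ρ ↦ ∑ j, (A j ⊗ B j) ρ (A j† ⊗ B j†)` with product operators. -/
def Gate.IsSeparable (E : Gate (Bool × Bool)) : Prop :=
  ∃ (r : ℕ) (A B : Fin r → Matrix Bool Bool ℂ), ∀ ρ,
    E.map ρ = ∑ j, (A j ⊗ₖ B j) * ρ * ((A j).conjTranspose ⊗ₖ (B j).conjTranspose)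

/-- A finite set of named one-qubit and two-qubit gates. -/
structure GateSet where
  /-- number of one-qubit gates -/
  numOne : ℕ
  /-- number of two-qubit gates -/
  numTwo : ℕ
  /-- the one-qubit gates -/
  one : Fin numOne → Gate Bool
  /-- the two-qubit gates -/
  two : Fin numTwo → Gate (Bool × Bool)

/-! ### Quantum circuits -/

/-- An operator on `q` qubits, as a matrix over the computational basis `{0,1}^q`. -/
abbrev QMatrix (q : ℕ) : Type := Matrix (Fin q → Bool) (Fin q → Bool) ℂ

/-- The one-qubit gate `E` on qubit `i`, tensored with the identity on the other qubits: it acts on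
the block of `ρ` obtained by fixing the row and column indices of the other qubits. -/
def applyOne {q : ℕ} (E : Gate Bool) (i : Fin q) (ρ : QMatrix q) : QMatrix q :=
  fun z w =>
    E.map (Matrix.of fun s t => ρ (Function.update z i s) (Function.update w i t)) (z i) (w i)

/-- The two-qubit gate `E` on the pair of qubits `(i, j)`, tensored with the identity on the other
qubits. -/
def applyTwo {q : ℕ} (E : Gate (Bool × Bool)) (i j : Fin q) (ρ : QMatrix q) : QMatrix q :=
  fun z w =>
    E.map (Matrix.of fun s t =>
        ρ (Function.update (Function.update z i s.1) j s.2)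
          (Function.update (Function.update w i t.1) j t.2))
      (z i, z j) (w i, w j)

/-- One elementary operation of a circuit: a gate of the gate set together with the qubit, or the
ordered pair of distinct qubits, that it acts on. -/
inductive Op (𝒢 : GateSet) (q : ℕ) : Type where
  | one (g : Fin 𝒢.numOne) (i : Fin q) : Op 𝒢 q
  | two (g : Fin 𝒢.numTwo) (i j : Fin q) (hij : i ≠ j) : Op 𝒢 q

/-- The qubits on which an operation acts. -/
def Op.qubits {𝒢 : GateSet} {q : ℕ} : Op 𝒢 q → Finset (Fin q)
  | .one _ i => {i}
  | .two _ i j _ => {i, j}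

/-- The effect of an operation on the state of the quantum computer. -/
def Op.apply {𝒢 : GateSet} {q : ℕ} : Op 𝒢 q → QMatrix q → QMatrix q
  | .one g i => applyOne (𝒢.one g) i
  | .two g i j _ => applyTwo (𝒢.two g) i j

/-- A circuit over the gate set `𝒢`: its number of qubits, the sequence of its gates (the head of
the list is applied first), and the set of qubits that are measured at the end. -/
structure Circuit (𝒢 : GateSet) where
  /-- number of qubits -/
  qubits : ℕ
  /-- the gates -/
  ops : List (Op 𝒢 qubits)
  /-- the measured qubits -/
  measured : Finset (Fin qubits)

namespace Circuit

variable {𝒢 : GateSet}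

/-- The number of gates of the circuit. -/
def size (c : Circuit 𝒢) : ℕ := c.ops.length

/-- The number of qubits of the circuit on which none of its gates acts. -/
def idle (c : Circuit 𝒢) : ℕ :=
  (Finset.univ.filter fun i : Fin c.qubits => ∀ o ∈ c.ops, i ∉ o.qubits).card

/-- The state of the quantum computer, started in `|x⟩⟨x|`, after all gates of the circuit. -/
noncomputable def finalState (c : Circuit 𝒢) (x : Fin c.qubits → Bool) : QMatrix c.qubits :=
  c.ops.foldl (fun ρ o => o.apply ρ) (Matrix.single x x 1)

/-- The measurement outcomes: one bit for each measured qubit. -/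
abbrev Outcome (c : Circuit 𝒢) : Type := {i : Fin c.qubits // i ∈ c.measured} → Bool

/-- The probability of the outcome `y` of the computational-basis measurement of the measured
qubits in the final state: the sum of the diagonal entries of the final state at the basis states
that agree with `y`. -/
noncomputable def outputProb (c : Circuit 𝒢) (x : Fin c.qubits → Bool) (y : c.Outcome) : ℝ :=
  ∑ z : Fin c.qubits → Bool, if (fun i => z i.1) = y then (c.finalState x z z).re else 0

end Circuit

/-- The `L₁` distance `(∑ y, |r y - s y|) / 2`. -/
noncomputable def l1Dist {Y : Type} [Fintype Y] (r s : Y → ℝ) : ℝ := (∑ y, |r y - s y|) / 2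

/-! ### Classical randomized programs

The classical computer runs imperative programs whose variables hold binary trees (the language
`WHILE`, with an additional instruction for tossing a fair coin). Its step count agrees with that of
multitape Turing machines up to polynomial factors. -/

/-- The data of the classical computer: binary trees. -/
inductive Val : Type where
  | nil : Val
  | cons (a b : Val) : Val

namespace Val

/-- The left component. -/
def hd : Val → Val
  | nil => nil
  | cons a _ => a

/-- The right component. -/
def tl : Val → Val
  | nil => nil
  | cons _ b => b

/-- Bits as data. -/
def ofBool : Bool → Val
  | false => nil
  | true => cons nil nil

/-- Lists as data. -/
def ofList : List Val → Val
  | [] => nil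
  | a :: l => cons a (ofList l)

/-- Natural numbers as data, in unary. -/
def ofNat : ℕ → Val
  | 0 => nil
  | n + 1 => cons nil (ofNat n)

/-- Integers as data: sign and absolute value. -/
def ofInt (a : ℤ) : Val := cons (ofBool (decide (a < 0))) (ofNat a.natAbs)

/-- Bit strings as data. -/
def ofBits (l : List Bool) : Val := ofList (l.map ofBool)

end Val

/-- The contents of the variables, which are numbered. -/
abbrev Store : Type := ℕ → Val

/-- Expressions. -/
inductive Expr : Type where
  | var (v : ℕ) : Expr
  | nil : Expr
  | cons (e f : Expr) : Expr
  | hd (e : Expr) : Expr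
  | tl (e : Expr) : Expr

/-- The value of an expression. -/
def Expr.eval (s : Store) : Expr → Val
  | .var v => s v
  | .nil => .nil
  | .cons e f => .cons (e.eval s) (f.eval s)
  | .hd e => (e.eval s).hd
  | .tl e => (e.eval s).tl

/-- The number of steps that the evaluation of an expression takes: one for each node. -/
def Expr.cost : Expr → ℕ
  | .var _ => 1
  | .nil => 1
  | .cons e f => e.cost + f.cost + 1
  | .hd e => e.cost + 1
  | .tl e => e.cost + 1

/-- Programs. -/
inductive Prog : Type where
  /-- put the value of `e` into the variable `v` -/
  | assign (v : ℕ) (e : Expr) : Prog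
  /-- put a fair random bit into the variable `v` -/
  | toss (v : ℕ) : Prog
  /-- run `P`, then `Q` -/
  | seq (P Q : Prog) : Prog
  /-- run `P` if the value of `e` is not `nil`, and `Q` if it is `nil` -/
  | cond (e : Expr) (P Q : Prog) : Prog
  /-- repeat `P` as long as the value of `e` is not `nil` -/
  | loop (e : Expr) (P : Prog) : Prog

/-- `Exec P s ω s' ω' t`: started with the variables `s` and the infinite sequence `ω` of coin
tosses still to come, `P` halts after exactly `t` steps with variables `s'` and remaining coin
tosses `ω'`. -/
inductive Exec : Prog → Store → (ℕ → Bool) → Store → (ℕ → Bool) → ℕ → Prop where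
  | assign (v : ℕ) (e : Expr) (s : Store) (ω : ℕ → Bool) :
      Exec (.assign v e) s ω (Function.update s v (e.eval s)) ω (e.cost + 1)
  | toss (v : ℕ) (s : Store) (ω : ℕ → Bool) :
      Exec (.toss v) s ω (Function.update s v (Val.ofBool (ω 0))) (fun i => ω (i + 1)) 1
  | seq {P Q : Prog} {s s₁ s₂ : Store} {ω ω₁ ω₂ : ℕ → Bool} {t₁ t₂ : ℕ}
      (h₁ : Exec P s ω s₁ ω₁ t₁) (h₂ : Exec Q s₁ ω₁ s₂ ω₂ t₂) :
      Exec (.seq P Q) s ω s₂ ω₂ (t₁ + t₂)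
  | cond_true {e : Expr} {P Q : Prog} {s s' : Store} {ω ω' : ℕ → Bool} {t : ℕ}
      (he : e.eval s ≠ Val.nil) (h : Exec P s ω s' ω' t) :
      Exec (.cond e P Q) s ω s' ω' (e.cost + 1 + t)
  | cond_false {e : Expr} {P Q : Prog} {s s' : Store} {ω ω' : ℕ → Bool} {t : ℕ}
      (he : e.eval s = Val.nil) (h : Exec Q s ω s' ω' t) :
      Exec (.cond e P Q) s ω s' ω' (e.cost + 1 + t)
  | loop_true {e : Expr} {P : Prog} {s s₁ s₂ : Store} {ω ω₁ ω₂ : ℕ → Bool} {t₁ t₂ : ℕ}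
      (he : e.eval s ≠ Val.nil) (h₁ : Exec P s ω s₁ ω₁ t₁)
      (h₂ : Exec (.loop e P) s₁ ω₁ s₂ ω₂ t₂) :
      Exec (.loop e P) s ω s₂ ω₂ (e.cost + 1 + t₁ + t₂)
  | loop_false {e : Expr} {P : Prog} {s : Store} {ω : ℕ → Bool}
      (he : e.eval s = Val.nil) :
      Exec (.loop e P) s ω s ω (e.cost + 1)

/-- On input `a` (in variable `0`, all other variables being `nil`) and with coin tosses `ω`, the
program `P` halts within `T` steps with output `b` (in variable `0`). -/
def Prog.HaltsWithin (P : Prog) (a : Val) (ω : ℕ → Bool) (b : Val) (T : ℕ) : Prop :=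
  ∃ (s : Store) (ω' : ℕ → Bool) (t : ℕ),
    Exec P (Function.update (fun _ => Val.nil) 0 a) ω s ω' t ∧ s 0 = b ∧ t ≤ T

/-- `P` computes the output `b` from the input `a` within `T` steps, whatever the coin tosses. -/
def Prog.ComputesWithin (P : Prog) (a b : Val) (T : ℕ) : Prop :=
  ∀ ω : ℕ → Bool, P.HaltsWithin a ω b T

/-- On input `a`, the program `P` halts within `T` steps whatever the coin tosses, its output is
always the encoding of an element of `Y`, and the distribution of that element is `μ`. A run of at
most `T` steps reads at most `T` coin tosses, so that the probability of an output is the fraction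
of the `2 ^ T` sequences of `T` coin tosses which lead to it. -/
def Prog.SamplesWithin {Y : Type} [DecidableEq Y] (P : Prog) (a : Val) (enc : Y → Val)
    (μ : Y → ℝ) (T : ℕ) : Prop :=
  ∃ out : (Fin T → Bool) → Y,
    (∀ r : Fin T → Bool,
      P.HaltsWithin a (fun i => if h : i < T then r ⟨i, h⟩ else false) (enc (out r)) T) ∧
    ∀ y, μ y = ((Finset.univ.filter fun r => out r = y).card : ℝ) / 2 ^ T

/-! ### Encodings of circuits and outcomes -/

/-- An operation as data: its kind, the number of its gate and the numbers of its qubits. -/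
def Op.encode {𝒢 : GateSet} {q : ℕ} : Op 𝒢 q → Val
  | .one g i => .ofList [.ofBool false, .ofNat g, .ofNat i]
  | .two g i j _ => .ofList [.ofBool true, .ofNat g, .ofNat i, .ofNat j]

/-- A circuit as data: the list of its operations, and one bit for each qubit that tells whether the
qubit is measured. -/
def Circuit.encode {𝒢 : GateSet} (c : Circuit 𝒢) : Val :=
  .cons (.ofList (c.ops.map Op.encode))
    (.ofBits (List.ofFn fun i => decide (i ∈ c.measured)))

/-- An outcome as data: the string of its bits, in the order of the measured qubits. -/
def Circuit.encodeOutcome {𝒢 : GateSet} (c : Circuit 𝒢) (y : c.Outcome) : Val :=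
  .ofBits ((List.finRange c.qubits).filterMap fun i =>
    if h : i ∈ c.measured then some (y ⟨i, h⟩) else none)

/-! ### The hypotheses and the conclusion -/

/-- The real number `r` can be computed to within `1 / N` in `O(N ^ d)` steps: a program that is
given `N` finds in that time an integer `a` with `|r - a / N| ≤ 1 / N`. -/
def ApproximableInTime (d : ℕ) (r : ℝ) : Prop :=
  ∃ (P : Prog) (K : ℕ), ∀ N : ℕ, 0 < N →
    ∃ a : ℤ, |r - a / N| ≤ 1 / N ∧ P.ComputesWithin (.ofNat N) (.ofInt a) (K * N ^ d)

/-- The real and imaginary parts of all entries of the matrix of the gate, as a linear map on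
matrices, can be computed to within `1 / N` in `O(N ^ d)` steps. -/
def Gate.ApproximableInTime {n : Type} [Fintype n] [DecidableEq n] (d : ℕ) (E : Gate n) : Prop :=
  ∀ i j k l : n,
    SepSim.ApproximableInTime d (E.map (Matrix.single i j 1) k l).re ∧
      SepSim.ApproximableInTime d (E.map (Matrix.single i j 1) k l).im

/-- All gates of the gate set can be computed to within `1 / N` in `O(N ^ d)` steps. -/
def GateSet.ApproximableInTime (d : ℕ) (𝒢 : GateSet) : Prop :=
  (∀ g, (𝒢.one g).ApproximableInTime d) ∧ ∀ g, (𝒢.two g).ApproximableInTime d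

/-- A family of circuits together with a program that, given `n` (in unary), outputs the
description of the `n`-th circuit within `t n` steps. -/
structure UniformFamily (𝒢 : GateSet) where
  /-- the circuits -/
  circuit : ℕ → Circuit 𝒢
  /-- the program that generates the circuits -/
  generator : Prog
  /-- a bound for the running time of the generator -/
  t : ℕ → ℕ
  generates : ∀ n, generator.ComputesWithin (.ofNat n) (circuit n).encode (t n)

/-- The program `P`, given `desc` (which stands for the circuit `c`), the initial basis state `x`
and the number `⌈1 / ε⌉` (in unary), halts within `B` steps, and its output is distributed within
`L₁` distance less than `ε` of the output distribution of the circuit. -/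
def Simulates {𝒢 : GateSet} (P : Prog) (desc : Val) (c : Circuit 𝒢) (x : Fin c.qubits → Bool)
    (ε : ℝ) (B : ℝ) : Prop :=
  ∃ (T : ℕ) (μ : c.Outcome → ℝ), (T : ℝ) ≤ B ∧
    P.SamplesWithin (.ofList [desc, .ofBits (List.ofFn x), .ofNat ⌈1 / ε⌉₊]) c.encodeOutcome μ T ∧
    l1Dist (c.outputProb x) μ < ε

end SepSim

namespace SepSim

/-! ### Basic facts about programs -/

/-! A separable gate sends a product of two one-qubit states to a mixture of such products, so the
state of the computer remains a mixture of product states. The simulation carries one random product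
state, a list of Bloch vectors with one entry per qubit. A gate replaces the vectors that it touches
by random ones whose mean reproduces its output, and measuring a product state amounts to tossing
independent biased coins.

Two devices turn this into an algorithm. Bloch vectors are rounded to the integer points `net M` of
a ball of radius `M`. The decomposition of a gate's output into products is not given, only
approximate matrix entries are; it is found by `greedy`, which `M` times appends the pair of net
points whose tensor product has the smallest inner product with the deviation accumulated so far.
The target is a convex combination of products that lie close to products of net points, so some
pair does almost as well as the target itself (`SepTensor.le_of_net`). The cross term in the squared
deviation is therefore nearly nonpositive, and the square grows only linearly in the number of steps
(`potential_step`, `greedy_potential`). Hence the uniform mixture of the `M` pairs approximates the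
target to within `O(1/√M)` (`greedy_spec`).

Quantum operations do not increase the trace norm, which is handled here through differences of
positive matrices (`TraceBound.apply`). The errors of the gates therefore add up (`traceBound_op`,
`traceBound_chain`), and the output distributions of a circuit with `p` gates differ by at most
`160000 p / √M`. With `M` a power of two of order `(p/ε)²` this is below `ε`, and uniform choices
are realised exactly by fair coins.

The running time is controlled by closure properties of polynomial-time functions (`PT`). Only the
tables of matrix entries depend on the gate set; they have size `O(M)` and are computed in time `O(M
^ d)`, so the exponent depends on `d` alone (`exists_sampleProg`). For uniform families the
generator runs before the sampler. -/

/-- The number of nodes of a tree. -/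
def Val.size : Val → ℕ
  | .nil => 1
  | .cons a b => a.size + b.size + 1

theorem Val.size_pos (a : Val) : 0 < a.size := by cases a <;> simp [Val.size]

/-- All variables of the expression are less than this number. -/
def Expr.bound : Expr → ℕ
  | .var v => v + 1
  | .nil => 0
  | .cons e f => max e.bound f.bound
  | .hd e => e.bound
  | .tl e => e.bound

/-- All variables of the program are less than this number. -/
def Prog.bound : Prog → ℕ
  | .assign v e => max (v + 1) e.bound
  | .toss v => v + 1
  | .seq P Q => max P.bound Q.bound
  | .cond e P Q => max e.bound (max P.bound Q.bound)
  | .loop e P => max e.bound P.bound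

/-- Lets a program be called as a subroutine: the caller keeps its data in variables from `P.bound`
on. -/
theorem Exec.frame {P : Prog} {s s' : Store} {ω ω' : ℕ → Bool} {t : ℕ} (h : Exec P s ω s' ω' t) :
    ∀ v, P.bound ≤ v → s' v = s v := by
  induction h with
  | assign v e s ω =>
    intro w hw
    simp only [Prog.bound] at hw
    rw [Function.update_of_ne]; omega
  | toss v s ω =>
    intro w hw
    simp only [Prog.bound] at hw
    rw [Function.update_of_ne]; omega
  | seq h₁ h₂ ih₁ ih₂ =>
    intro w hw
    simp only [Prog.bound] at hw
    rw [ih₂ w (by omega), ih₁ w (by omega)]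
  | cond_true he h ih =>
    intro w hw
    simp only [Prog.bound] at hw
    exact ih w (by omega)
  | cond_false he h ih =>
    intro w hw
    simp only [Prog.bound] at hw
    exact ih w (by omega)
  | loop_true he h₁ h₂ ih₁ ih₂ =>
    intro w hw
    rw [ih₂ w hw, ih₁ w]
    simp only [Prog.bound] at hw; omega
  | loop_false he => intro w hw; rfl

theorem Expr.eval_congr {e : Expr} {s s₁ : Store} {B : ℕ} (hB : e.bound ≤ B)
    (h : ∀ v < B, s v = s₁ v) : e.eval s = e.eval s₁ := by
  induction e with
  | var v => exact h v (by simp only [Expr.bound] at hB; omega)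
  | nil => rfl
  | cons e f ihe ihf =>
    simp only [Expr.bound] at hB
    simp only [Expr.eval, ihe (by omega), ihf (by omega)]
  | hd e ih => simp only [Expr.eval, ih hB]
  | tl e ih => simp only [Expr.eval, ih hB]

/-- Transplants a run from the initial store of `HaltsWithin` to a store with arbitrary contents
above the bound. -/
theorem Exec.congr {P : Prog} {s s' : Store} {ω ω' : ℕ → Bool} {t : ℕ} (h : Exec P s ω s' ω' t)
    {B : ℕ} (hB : P.bound ≤ B) : ∀ s₁ : Store, (∀ v < B, s v = s₁ v) →
      ∃ s₁', Exec P s₁ ω s₁' ω' t ∧ ∀ v < B, s' v = s₁' v := by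
  induction h with
  | assign v e s ω =>
    intro s₁ hs
    simp only [Prog.bound] at hB
    refine ⟨_, .assign v e s₁ ω, fun w hw => ?_⟩
    rw [Expr.eval_congr (e := e) (B := B) (by omega) hs]
    by_cases hwv : w = v
    · subst hwv; simp
    · rw [Function.update_of_ne hwv, Function.update_of_ne hwv, hs w hw]
  | toss v s ω =>
    intro s₁ hs
    refine ⟨_, .toss v s₁ ω, fun w hw => ?_⟩
    by_cases hwv : w = v
    · subst hwv; simp
    · rw [Function.update_of_ne hwv, Function.update_of_ne hwv, hs w hw]
  | seq h₁ h₂ ih₁ ih₂ =>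
    intro s₁ hs
    simp only [Prog.bound] at hB
    obtain ⟨u, hu, hu'⟩ := ih₁ (by omega) s₁ hs
    obtain ⟨w, hw, hw'⟩ := ih₂ (by omega) u hu'
    exact ⟨w, .seq hu hw, hw'⟩
  | cond_true he h ih =>
    intro s₁ hs
    simp only [Prog.bound] at hB
    obtain ⟨u, hu, hu'⟩ := ih (by omega) s₁ hs
    exact ⟨u, .cond_true (by rwa [← Expr.eval_congr (B := B) (by omega) hs]) hu, hu'⟩
  | cond_false he h ih =>
    intro s₁ hs
    simp only [Prog.bound] at hB
    obtain ⟨u, hu, hu'⟩ := ih (by omega) s₁ hs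
    exact ⟨u, .cond_false (by rwa [← Expr.eval_congr (B := B) (by omega) hs]) hu, hu'⟩
  | loop_true he h₁ h₂ ih₁ ih₂ =>
    intro s₁ hs
    have hB' := hB
    simp only [Prog.bound] at hB'
    obtain ⟨u, hu, hu'⟩ := ih₁ (by omega) s₁ hs
    obtain ⟨w, hw, hw'⟩ := ih₂ hB u hu'
    exact ⟨w, .loop_true (by rwa [← Expr.eval_congr (B := B) (by omega) hs]) hu hw, hw'⟩
  | loop_false he =>
    intro s₁ hs
    simp only [Prog.bound] at hB
    exact ⟨s₁, .loop_false (by rwa [← Expr.eval_congr (B := B) (by omega) hs]), hs⟩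

/-- The program with each coin toss replaced by the outcome `false`. -/
def Prog.derand : Prog → Prog
  | .assign v e => .assign v e
  | .toss v => .assign v .nil
  | .seq P Q => .seq P.derand Q.derand
  | .cond e P Q => .cond e P.derand Q.derand
  | .loop e P => .loop e P.derand

theorem Prog.bound_derand (P : Prog) : P.derand.bound = P.bound := by
  induction P with
  | assign v e => rfl
  | toss v => simp [Prog.derand, Prog.bound, Expr.bound]
  | seq P Q ihP ihQ => simp [Prog.derand, Prog.bound, ihP, ihQ]
  | cond e P Q ihP ihQ => simp [Prog.derand, Prog.bound, ihP, ihQ]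
  | loop e P ih => simp [Prog.derand, Prog.bound, ih]

/-- A program that computes a definite output does so in particular when all tosses come out
`false`, and that run needs no coins. The factor 2 arises because a toss costs 1 and the assignment
replacing it costs 2. -/
theorem Exec.derand {P : Prog} {s s' : Store} {ω ω' : ℕ → Bool} {t : ℕ} (h : Exec P s ω s' ω' t) :
    ω = (fun _ => false) → ω' = (fun _ => false) ∧
      ∀ ω₁, ∃ t₁ ≤ 2 * t, Exec P.derand s ω₁ s' ω₁ t₁ := by
  induction h with
  | assign v e s ω => exact fun h => ⟨h, fun ω₁ => ⟨_, by omega, .assign v e s ω₁⟩⟩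
  | toss v s ω =>
    rintro rfl
    exact ⟨rfl, fun ω₁ => ⟨_, by simp [Expr.cost], .assign v .nil s ω₁⟩⟩
  | seq h₁ h₂ ih₁ ih₂ =>
    intro h
    obtain ⟨h', k₁⟩ := ih₁ h
    obtain ⟨h'', k₂⟩ := ih₂ h'
    refine ⟨h'', fun ω₁ => ?_⟩
    obtain ⟨t, ht, e⟩ := k₁ ω₁
    obtain ⟨t', ht', e'⟩ := k₂ ω₁
    exact ⟨_, by omega, .seq e e'⟩
  | cond_true he h ih =>
    intro h
    obtain ⟨h', k⟩ := ih h
    refine ⟨h', fun ω₁ => ?_⟩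
    obtain ⟨t, ht, e⟩ := k ω₁
    exact ⟨_, by omega, .cond_true he e⟩
  | cond_false he h ih =>
    intro h
    obtain ⟨h', k⟩ := ih h
    refine ⟨h', fun ω₁ => ?_⟩
    obtain ⟨t, ht, e⟩ := k ω₁
    exact ⟨_, by omega, .cond_false he e⟩
  | loop_true he h₁ h₂ ih₁ ih₂ =>
    intro h
    obtain ⟨h', k₁⟩ := ih₁ h
    obtain ⟨h'', k₂⟩ := ih₂ h'
    refine ⟨h'', fun ω₁ => ?_⟩
    obtain ⟨t, ht, e⟩ := k₁ ω₁
    obtain ⟨t', ht', e'⟩ := k₂ ω₁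
    exact ⟨_, by omega, .loop_true he e e'⟩
  | loop_false he => exact fun h => ⟨h, fun ω₁ => ⟨_, by omega, .loop_false he⟩⟩

/-- Put `nil` into the variables `1, …, n`. -/
def clear : ℕ → Prog
  -- There is no empty instruction; this one leaves the store unchanged.
  | 0 => .assign 0 (.var 0)
  | n + 1 => .seq (clear n) (.assign (n + 1) .nil)

theorem exec_clear (n : ℕ) (s : Store) (ω : ℕ → Bool) :
    ∃ s', Exec (clear n) s ω s' ω (2 * (n + 1)) ∧ s' 0 = s 0 ∧
      (∀ v, 0 < v → v ≤ n → s' v = .nil) ∧ ∀ v, n < v → s' v = s v := by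
  induction n with
  | zero =>
    refine ⟨_, .assign 0 (.var 0) s ω, ?_, fun v h h' => by omega, fun v hv => ?_⟩
    · simp [Expr.eval]
    · rw [Function.update_of_ne (by omega)]
  | succ n ih =>
    obtain ⟨s', e, h0, h1, h2⟩ := ih
    refine ⟨_, .seq e (.assign (n + 1) .nil s' ω), ?_, fun v h h' => ?_, fun v hv => ?_⟩
    · rw [Function.update_of_ne (by omega), h0]
    · by_cases hv : v = n + 1
      · subst hv; simp [Expr.eval]
      · rw [Function.update_of_ne hv, h1 v h (by omega)]
    · rw [Function.update_of_ne (by omega), h2 v (by omega)]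

/-- The derandomized program, preceded by the initialization of its variables. -/
def Prog.clean (P : Prog) : Prog := .seq (clear P.bound) P.derand

/-- Makes the programs of the hypotheses usable as subroutines: no assumption on the other
variables, and no coin toss is consumed, so that the tosses stay available for sampling. -/
theorem Prog.ComputesWithin.clean {P : Prog} {a b : Val} {T : ℕ} (h : P.ComputesWithin a b T)
    (s : Store) (ω : ℕ → Bool) (hs : s 0 = a) :
    ∃ s' t, Exec P.clean s ω s' ω t ∧ s' 0 = b ∧ t ≤ 2 * T + 2 * (P.bound + 1) := by
  obtain ⟨s₀, ω', t, e, hb, ht⟩ := h fun _ => false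
  obtain ⟨-, k⟩ := e.derand rfl
  obtain ⟨t₁, ht₁, e₁⟩ := k ω
  obtain ⟨s₁, ec, h0, h1, -⟩ := exec_clear P.bound s ω
  obtain ⟨s₂, e₂, h₂⟩ := e₁.congr (B := P.bound + 1) (by rw [Prog.bound_derand]; omega) s₁ (by
    intro v hv
    by_cases h : v = 0
    · subst h; simp [h0, hs]
    · rw [Function.update_of_ne h, h1 v (by omega) (by omega)])
  exact ⟨s₂, _, .seq ec e₂, by rw [← h₂ 0 (by omega), hb], by omega⟩

/-! ### Encodable types and computable functions -/

/-- Types whose elements can be represented by trees. -/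
class Enc (α : Type) where
  /-- the representation -/
  enc : α → Val

open Enc

instance : Enc Val := ⟨id⟩
instance : Enc Unit := ⟨fun _ => .nil⟩
instance : Enc Bool := ⟨Val.ofBool⟩
instance : Enc ℕ := ⟨Val.ofNat⟩
instance : Enc ℤ := ⟨Val.ofInt⟩
instance {α β : Type} [Enc α] [Enc β] : Enc (α × β) := ⟨fun p => .cons (enc p.1) (enc p.2)⟩
instance {α : Type} [Enc α] : Enc (List α) := ⟨fun l => .ofList (l.map enc)⟩
instance {α : Type} [Enc α] {n : ℕ} : Enc (Fin n → α) := ⟨fun v => enc (List.ofFn v)⟩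
instance {α : Type} [Enc α] {p : α → Prop} : Enc {a // p a} := ⟨fun a => enc a.1⟩

theorem enc_pair {α β : Type} [Enc α] [Enc β] (a : α) (b : β) :
    enc (a, b) = .cons (enc a) (enc b) := rfl
theorem enc_cons {α : Type} [Enc α] (a : α) (l : List α) : enc (a :: l) = .cons (enc a) (enc l) := rfl

/-- The size of the representation. -/
def sz {α : Type} [Enc α] (a : α) : ℕ := (enc a).size

theorem sz_pos {α : Type} [Enc α] (a : α) : 0 < sz a := Val.size_pos _
theorem sz_pair {α β : Type} [Enc α] [Enc β] (a : α) (b : β) : sz (a, b) = sz a + sz b + 1 := rfl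
theorem sz_cons {α : Type} [Enc α] (a : α) (l : List α) : sz (a :: l) = sz a + sz l + 1 := rfl
theorem sz_nil {α : Type} [Enc α] : sz ([] : List α) = 1 := rfl

/-- The program computes `f`, whatever the contents of the variables other than `0`, without
tossing coins, and within time `T`. -/
def CompIn {α β : Type} [Enc α] [Enc β] (P : Prog) (f : α → β) (T : α → ℕ) : Prop :=
  ∀ (a : α) (s : Store) (ω : ℕ → Bool), s 0 = enc a →
    ∃ s' t, Exec P s ω s' ω t ∧ s' 0 = enc (f a) ∧ t ≤ T a

section
variable {α β γ σ : Type} [Enc α] [Enc β] [Enc γ] [Enc σ]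

theorem CompIn.comp {P Q : Prog} {f : α → β} {g : β → γ} {T : α → ℕ} {U : β → ℕ}
    (hg : CompIn Q g U) (hf : CompIn P f T) :
    CompIn (.seq P Q) (fun a => g (f a)) (fun a => T a + U (f a)) := fun a s ω hs => by
  obtain ⟨s₁, t₁, e₁, h₁, ht₁⟩ := hf a s ω hs
  obtain ⟨s₂, t₂, e₂, h₂, ht₂⟩ := hg (f a) s₁ ω h₁
  exact ⟨s₂, _, .seq e₁ e₂, h₂, by dsimp only; omega⟩

/-- Run `P` and `Q` on the same input and pair the outputs. -/
def Prog.pair (P Q : Prog) : Prog :=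
  -- Neither program touches `B` or `B + 1`, so the saved input and the first output survive. The `+
  -- 1` keeps `B` away from variable `0` even if both bounds vanish.
  let B := max P.bound Q.bound + 1
  .seq (.assign B (.var 0)) <| .seq P <| .seq (.assign (B + 1) (.var 0)) <|
    .seq (.assign 0 (.var B)) <| .seq Q (.assign 0 (.cons (.var (B + 1)) (.var 0)))

theorem CompIn.pair {P Q : Prog} {f : α → β} {g : α → γ} {T U : α → ℕ}
    (hf : CompIn P f T) (hg : CompIn Q g U) :
    CompIn (P.pair Q) (fun a => (f a, g a)) (fun a => T a + U a + 10) := fun a s ω hs => by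
  set B := max P.bound Q.bound + 1 with hB
  obtain ⟨s₁, t₁, e₁, h₁, ht₁⟩ := hf a (Function.update s B ((Expr.var 0).eval s)) ω
    (by rw [Function.update_of_ne (by omega), hs])
  set s₂ := Function.update s₁ (B + 1) ((Expr.var 0).eval s₁) with hs₂
  obtain ⟨s₃, t₃, e₃, h₃, ht₃⟩ := hg a (Function.update s₂ 0 ((Expr.var B).eval s₂)) ω (by
    rw [Function.update_self]
    simp only [Expr.eval, hs₂]
    rw [Function.update_of_ne (by omega), e₁.frame B (by omega), Function.update_self, ← hs]
    simp [Expr.eval])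
  refine ⟨_, _, .seq (.assign _ _ _ _) (.seq e₁ (.seq (.assign _ _ _ _) (.seq (.assign _ _ _ _)
    (.seq e₃ (.assign _ _ _ _))))), ?_, ?_⟩
  · simp only [Expr.eval, Function.update_self, enc_pair, h₃]
    rw [e₃.frame (B + 1) (by omega), Function.update_of_ne (by omega), hs₂, Function.update_self]
    simp [Expr.eval, h₁]
  · simp only [Expr.cost]; omega

/-- Run `P` to obtain a list, and run `Q` if it is empty and `R` otherwise. -/
def Prog.branch (P Q R : Prog) : Prog :=
  let B := max P.bound (max Q.bound R.bound) + 1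
  .seq (.assign B (.var 0)) <| .seq P <| .cond (.var 0)
    (.seq (.assign 0 (.cons (.var B) (.cons (.hd (.var 0)) (.tl (.var 0))))) R)
    (.seq (.assign 0 (.var B)) Q)

theorem CompIn.listCases {P Q R : Prog} {l : α → List β} {f : α → γ} {g : α × β × List β → γ}
    {T U : α → ℕ} {W : α × β × List β → ℕ} (hl : CompIn P l T) (hf : CompIn Q f U)
    (hg : CompIn R g W) :
    CompIn (P.branch Q R) (fun a => match l a with | [] => f a | b :: t => g (a, b, t))
      (fun a => T a + 12 + match l a with | [] => U a | b :: t => W (a, b, t)) := fun a s ω hs => by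
  set B := max P.bound (max Q.bound R.bound) + 1 with hB
  obtain ⟨s₁, t₁, e₁, h₁, ht₁⟩ := hl a (Function.update s B ((Expr.var 0).eval s)) ω
    (by rw [Function.update_of_ne (by omega), hs])
  have hsB : s₁ B = enc a := by
    rw [e₁.frame B (by omega), Function.update_self, ← hs]; simp [Expr.eval]
  cases hla : l a with
  | nil =>
    obtain ⟨s₂, t₂, e₂, h₂, ht₂⟩ := hf a (Function.update s₁ 0 ((Expr.var B).eval s₁)) ω
      (by simp [Expr.eval, hsB])
    refine ⟨_, _, .seq (.assign _ _ _ _) (.seq e₁ (.cond_false ?_ (.seq (.assign _ _ _ _) e₂))),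
      ?_, ?_⟩
    · simp only [Expr.eval, h₁, hla]; rfl
    · simp only [hla]; exact h₂
    · simp only [hla, Expr.cost]; omega
  | cons b t =>
    obtain ⟨s₂, t₂, e₂, h₂, ht₂⟩ := hg (a, b, t) (Function.update s₁ 0
      ((Expr.cons (.var B) (.cons (.hd (.var 0)) (.tl (.var 0)))).eval s₁)) ω
      (by simp [Expr.eval, hsB, h₁, hla, enc_pair, enc_cons, Val.hd, Val.tl])
    refine ⟨_, _, .seq (.assign _ _ _ _) (.seq e₁ (.cond_true ?_ (.seq (.assign _ _ _ _) e₂))),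
      ?_, ?_⟩
    · simp only [Expr.eval, h₁, hla, enc_cons]; simp
    · simp only [hla]; exact h₂
    · simp only [hla, Expr.cost]; omega

theorem CompIn.ite {P Q R : Prog} {c : α → Bool} {f g : α → γ}
    {T U W : α → ℕ} (hc : CompIn P c T) (hf : CompIn Q f U) (hg : CompIn R g W) :
    ∃ P', CompIn P' (fun a => bif c a then f a else g a) (fun a => T a + 12 + U a + W a) := by
  let B := max P.bound (max Q.bound R.bound) + 1
  have hB : B = max P.bound (max Q.bound R.bound) + 1 := rfl
  refine ⟨.seq (.assign B (.var 0)) <| .seq P <| .cond (.var 0)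
    (.seq (.assign 0 (.var B)) Q) (.seq (.assign 0 (.var B)) R), fun a s ω hs => ?_⟩
  obtain ⟨s₁, t₁, e₁, h₁, ht₁⟩ := hc a (Function.update s B ((Expr.var 0).eval s)) ω
    (by rw [Function.update_of_ne (by omega), hs])
  have hsB : s₁ B = enc a := by
    rw [e₁.frame B (by omega), Function.update_self, ← hs]; simp [Expr.eval]
  have hs₂ : Function.update s₁ 0 ((Expr.var B).eval s₁) 0 = enc a := by simp [Expr.eval, hsB]
  cases hca : c a with
  | false =>
    obtain ⟨s₂, t₂, e₂, h₂, ht₂⟩ := hg a _ ω hs₂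
    refine ⟨_, _, .seq (.assign _ _ _ _) (.seq e₁ (.cond_false ?_ (.seq (.assign _ _ _ _) e₂))),
      ?_, ?_⟩
    · simp only [Expr.eval, h₁, hca]; rfl
    · simp only [hca, cond]; exact h₂
    · simp only [Expr.cost]; omega
  | true =>
    obtain ⟨s₂, t₂, e₂, h₂, ht₂⟩ := hf a _ ω hs₂
    refine ⟨_, _, .seq (.assign _ _ _ _) (.seq e₁ (.cond_true ?_ (.seq (.assign _ _ _ _) e₂))),
      ?_, ?_⟩
    · simp only [Expr.eval, h₁, hca]; simp [enc, Val.ofBool]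
    · simp only [hca, cond]; exact h₂
    · simp only [Expr.cost]; omega

/-- Invariant: `B`, `B + 1`, `B + 2` hold the parameter, the remaining list and the current state.
The bound `U` is required only at states reached from prefixes of the list, since on arbitrary
states the cost of a step is unbounded. -/
theorem exec_foldl_loop {R : Prog} {step : α × σ × β → σ} {T : α × σ × β → ℕ}
    (hR : CompIn R step T) (B : ℕ) (hB : R.bound < B) (a : α) (U : ℕ) (l : List β) :
    ∀ (x : σ) (s : Store) (ω : ℕ → Bool), s B = enc a → s (B + 1) = enc l → s (B + 2) = enc x →
      (∀ l₁ b l₂, l = l₁ ++ b :: l₂ → T (a, l₁.foldl (fun y b => step (a, y, b)) x, b) ≤ U) →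
      ∃ s' t, Exec (.loop (.var (B + 1)) (.seq (.assign 0 (.cons (.var B) (.cons (.var (B + 2))
          (.hd (.var (B + 1)))))) (.seq R (.seq (.assign (B + 2) (.var 0))
          (.assign (B + 1) (.tl (.var (B + 1)))))))) s ω s' ω t ∧
        s' (B + 2) = enc (l.foldl (fun y b => step (a, y, b)) x) ∧ t ≤ 2 + l.length * (U + 20) := by
  induction l with
  | nil =>
    intro x s ω h0 h1 h2 _
    exact ⟨s, _, .loop_false (by simp only [Expr.eval, h1]; rfl), h2, by simp [Expr.cost]⟩
  | cons b l ih =>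
    intro x s ω h0 h1 h2 hU
    obtain ⟨s₁, t₁, e₁, hs₁, ht₁⟩ := hR (a, x, b) (Function.update s 0 ((Expr.cons (.var B)
      (.cons (.var (B + 2)) (.hd (.var (B + 1))))).eval s)) ω
      (by simp [Expr.eval, h0, h1, h2, enc_pair, enc_cons, Val.hd])
    have hf : ∀ v, B ≤ v → s₁ v = s v := fun v hv => by
      rw [e₁.frame v (by omega), Function.update_of_ne (by omega)]
    set s₂ := Function.update s₁ (B + 2) ((Expr.var 0).eval s₁) with hs₂
    set s₃ := Function.update s₂ (B + 1) ((Expr.tl (.var (B + 1))).eval s₂) with hs₃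
    obtain ⟨s₄, t₄, e₄, h₄, ht₄⟩ := ih (step (a, x, b)) s₃ ω
      (by simp only [hs₃, hs₂]
          rw [Function.update_of_ne (by omega), Function.update_of_ne (by omega), hf B le_rfl, h0])
      (by simp only [hs₃, hs₂, Function.update_self, Expr.eval]
          rw [Function.update_of_ne (by omega), hf (B + 1) (by omega), h1]; rfl)
      (by simp only [hs₃, hs₂, Expr.eval]
          rw [Function.update_of_ne (by omega), Function.update_self, hs₁])
      (fun l₁ c l₂ h => hU (b :: l₁) c l₂ (by simp [h]))
    refine ⟨s₄, _, .loop_true ?_ (.seq (.assign _ _ _ _) (.seq e₁ (.seq (.assign _ _ _ _)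
      (.assign _ _ _ _)))) e₄, h₄, ?_⟩
    · simp only [Expr.eval, h1, enc_cons]; simp
    · have := hU [] b l rfl
      simp only [List.foldl_nil] at this
      simp only [Expr.cost, List.length_cons, add_mul]
      omega

theorem CompIn.foldl {P Q R : Prog} {l : α → List β} {init : α → σ} {step : α × σ × β → σ}
    {T U : α → ℕ} {W : α × σ × β → ℕ} (hl : CompIn P l T) (hi : CompIn Q init U)
    (hs : CompIn R step W) (X : α → ℕ)
    (hX : ∀ a l₁ b l₂, l a = l₁ ++ b :: l₂ →
      W (a, l₁.foldl (fun y b => step (a, y, b)) (init a), b) ≤ X a) :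
    ∃ P', CompIn P' (fun a => (l a).foldl (fun y b => step (a, y, b)) (init a))
      (fun a => T a + U a + (l a).length * (X a + 20) + 20) := by
  let B := max P.bound (max Q.bound R.bound) + 1
  have hB : B = max P.bound (max Q.bound R.bound) + 1 := rfl
  refine ⟨.seq (.assign B (.var 0)) <| .seq P <| .seq (.assign (B + 1) (.var 0)) <|
    .seq (.assign 0 (.var B)) <| .seq Q <| .seq (.assign (B + 2) (.var 0)) <|
    .seq (.loop (.var (B + 1)) (.seq (.assign 0 (.cons (.var B) (.cons (.var (B + 2))
          (.hd (.var (B + 1)))))) (.seq R (.seq (.assign (B + 2) (.var 0))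
          (.assign (B + 1) (.tl (.var (B + 1))))))))
    (.assign 0 (.var (B + 2))), fun a s ω ha => ?_⟩
  obtain ⟨s₁, t₁, e₁, h₁, ht₁⟩ := hl a (Function.update s B ((Expr.var 0).eval s)) ω
    (by rw [Function.update_of_ne (by omega), ha])
  have hsB : s₁ B = enc a := by
    rw [e₁.frame B (by omega), Function.update_self, ← ha]; simp [Expr.eval]
  set s₂ := Function.update s₁ (B + 1) ((Expr.var 0).eval s₁) with hs₂
  have hs₂B : s₂ B = enc a := by rw [hs₂, Function.update_of_ne (by omega), hsB]
  obtain ⟨s₃, t₃, e₃, h₃, ht₃⟩ := hi a (Function.update s₂ 0 ((Expr.var B).eval s₂)) ω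
    (by simp [Expr.eval, hs₂B])
  have hf : ∀ v, B ≤ v → s₃ v = s₂ v := fun v hv => by
    rw [e₃.frame v (by omega), Function.update_of_ne (by omega)]
  set s₄ := Function.update s₃ (B + 2) ((Expr.var 0).eval s₃) with hs₄
  obtain ⟨s₅, t₅, e₅, h₅, ht₅⟩ := exec_foldl_loop hs B (by omega) a (X a) (l a) (init a) s₄ ω
    (by rw [hs₄, Function.update_of_ne (by omega), hf B le_rfl, hs₂B])
    (by rw [hs₄, Function.update_of_ne (by omega), hf (B + 1) (by omega), hs₂,
          Function.update_self, ← h₁]; rfl)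
    (by rw [hs₄, Function.update_self, ← h₃]; rfl)
    (hX a)
  refine ⟨_, _, .seq (.assign _ _ _ _) (.seq e₁ (.seq (.assign _ _ _ _) (.seq (.assign _ _ _ _)
    (.seq e₃ (.seq (.assign _ _ _ _) (.seq e₅ (.assign _ _ _ _))))))), ?_, ?_⟩
  · simp [Expr.eval, h₅]
  · simp only [Expr.cost]; omega

end

end SepSim
-- A calculus of polynomial-time functions on trees.
namespace SepSim
open Enc

/-! ### Polynomial bounds -/

/-- `T` is bounded by a polynomial in `m`. -/
def Poly {α : Type} (m T : α → ℕ) : Prop := ∃ k, ∀ a, T a ≤ (m a + 2) ^ k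

section
variable {α β : Type} {m m' T U : α → ℕ}

theorem Poly.of_le (h : Poly m T) (hU : ∀ a, U a ≤ T a) : Poly m U :=
  h.imp fun _ hk a => (hU a).trans (hk a)

theorem Poly.self (m : α → ℕ) : Poly m m := ⟨1, fun a => by rw [pow_one]; omega⟩

/-- The base `m + 2` in `Poly` is at least 2, so that `c ≤ 2 ^ c` absorbs constants into the
exponent, and likewise the factor 2 in sums. -/
theorem Poly.const (m : α → ℕ) (c : ℕ) : Poly m fun _ => c :=
  ⟨c, fun a => (Nat.lt_two_pow_self (n := c)).le.trans (Nat.pow_le_pow_left (by omega) c)⟩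

theorem Poly.mul (hT : Poly m T) (hU : Poly m U) : Poly m fun a => T a * U a := by
  obtain ⟨k, hk⟩ := hT
  obtain ⟨l, hl⟩ := hU
  exact ⟨k + l, fun a => by rw [pow_add]; exact Nat.mul_le_mul (hk a) (hl a)⟩

theorem Poly.add (hT : Poly m T) (hU : Poly m U) : Poly m fun a => T a + U a := by
  obtain ⟨k, hk⟩ := hT
  obtain ⟨l, hl⟩ := hU
  refine ⟨k + l + 1, fun a => ?_⟩
  have h1 : (m a + 2) ^ k ≤ (m a + 2) ^ (k + l) := Nat.pow_le_pow_right (by omega) (by omega)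
  have h2 : (m a + 2) ^ l ≤ (m a + 2) ^ (k + l) := Nat.pow_le_pow_right (by omega) (by omega)
  have h3 : (m a + 2) ^ (k + l) * 2 ≤ (m a + 2) ^ (k + l) * (m a + 2) :=
    Nat.mul_le_mul_left _ (by omega)
  rw [pow_succ]
  have := hk a
  have := hl a
  dsimp only
  omega

theorem Poly.trans (hT : Poly m T) (hm : Poly m' m) : Poly m' T := by
  obtain ⟨k, hk⟩ := hT
  obtain ⟨l, hl⟩ := hm.add (Poly.const m' 2)
  exact ⟨l * k, fun a => (hk a).trans (by rw [pow_mul]; exact Nat.pow_le_pow_left (hl a) k)⟩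

theorem Poly.comp (hT : Poly m T) (f : β → α) : Poly (fun b => m (f b)) fun b => T (f b) :=
  hT.imp fun _ hk b => hk (f b)

theorem Poly.pow (hT : Poly m T) (n : ℕ) : Poly m fun a => T a ^ n := by
  induction n with
  | zero => exact Poly.const m 1
  | succ n ih => simp only [pow_succ]; exact ih.mul hT

end

/-! ### Functions computable in polynomial time -/

/-- The function is computable in polynomial time, and the size of its values is polynomially
bounded. -/
def PT {α β : Type} [Enc α] [Enc β] (f : α → β) : Prop :=
  ∃ (P : Prog) (T : α → ℕ), CompIn P f T ∧ Poly sz T ∧ Poly sz fun a => sz (f a)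

section
variable {α β γ σ : Type} [Enc α] [Enc β] [Enc γ] [Enc σ]

theorem PT.size {f : α → β} (hf : PT f) : Poly sz fun a => sz (f a) := by
  obtain ⟨P, T, h, hT, hs⟩ := hf
  exact hs

/-- This is where the size clause of `PT` is needed. It does not follow from the time bound:
assigning `cons x x` to `x` about doubles a tree at constant cost. -/
theorem PT.comp {g : β → γ} {f : α → β} (hg : PT g) (hf : PT f) : PT fun a => g (f a) := by
  obtain ⟨P, T, h, hT, hs⟩ := hf
  obtain ⟨Q, U, h', hU, hs'⟩ := hg
  exact ⟨_, _, h'.comp h, hT.add ((hU.comp f).trans hs), (hs'.comp f).trans hs⟩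

theorem PT.pair {f : α → β} {g : α → γ} (hf : PT f) (hg : PT g) : PT fun a => (f a, g a) := by
  obtain ⟨P, T, h, hT, hs⟩ := hf
  obtain ⟨Q, U, h', hU, hs'⟩ := hg
  exact ⟨_, _, h.pair h', (hT.add hU).add (Poly.const _ 10), (hs.add hs').add (Poly.const _ 1)⟩

theorem PT.of_enc_eq {f : α → β} (h : ∀ a, enc (f a) = enc a) : PT f :=
  ⟨.assign 0 (.var 0), fun _ => 2, fun a s ω hs => ⟨_, _, .assign _ _ _ _,
    by simp [Expr.eval, hs, h], le_rfl⟩, Poly.const _ 2, (Poly.self sz).of_le fun a => by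
      unfold sz; rw [h]⟩

theorem PT.id : PT fun a : α => a := PT.of_enc_eq fun _ => rfl

/-- A program sees only encodings, so functions with equally encoded values share their programs.
This is how lists, numbers, tuples and circuit data are converted into each other at no cost. -/
theorem PT.congr_enc {f : α → β} (hf : PT f) {g : α → γ} (h : ∀ a, enc (g a) = enc (f a)) :
    PT g := by
  obtain ⟨P, T, h', hT, hs⟩ := hf
  refine ⟨P, T, fun a s ω ha => ?_, hT, hs.of_le fun a => by unfold sz; rw [h]⟩
  rw [h]
  exact h' a s ω ha

theorem Val.size_hd_le (a : Val) : a.hd.size ≤ a.size := by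
  cases a <;> simp only [Val.hd, Val.size] <;> omega

theorem Val.size_tl_le (a : Val) : a.tl.size ≤ a.size := by
  cases a <;> simp only [Val.tl, Val.size] <;> omega

theorem PT.of_hd {f : α → β} (h : ∀ a, Enc.enc (f a) = (Enc.enc a).hd) : PT f :=
  ⟨.assign 0 (.hd (.var 0)), fun _ => 3, fun a s ω hs => ⟨_, _, .assign _ _ _ _,
    by simp [Expr.eval, hs, h], le_rfl⟩, Poly.const _ 3, (Poly.self sz).of_le fun a => by
      unfold sz; rw [h]; exact Val.size_hd_le _⟩

theorem PT.of_tl {f : α → β} (h : ∀ a, Enc.enc (f a) = (Enc.enc a).tl) : PT f :=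
  ⟨.assign 0 (.tl (.var 0)), fun _ => 3, fun a s ω hs => ⟨_, _, .assign _ _ _ _,
    by simp [Expr.eval, hs, h], le_rfl⟩, Poly.const _ 3, (Poly.self sz).of_le fun a => by
      unfold sz; rw [h]; exact Val.size_tl_le _⟩

theorem PT.fst : PT fun p : α × β => p.1 := PT.of_hd fun _ => rfl
theorem PT.snd : PT fun p : α × β => p.2 := PT.of_tl fun _ => rfl
theorem PT.tail : PT fun l : List α => l.tail := PT.of_tl fun l => by cases l <;> rfl

/-- An expression for a tree. -/
def Val.expr : Val → Expr
  | .nil => .nil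
  | .cons a b => .cons a.expr b.expr

theorem Val.eval_expr (a : Val) (s : Store) : a.expr.eval s = a := by
  induction a with
  | nil => rfl
  | cons a b iha ihb => simp [Val.expr, Expr.eval, iha, ihb]

theorem PT.const (b : β) : PT fun _ : α => b :=
  ⟨.assign 0 (Enc.enc b).expr, fun _ => (Enc.enc b).expr.cost + 1, fun a s ω _ => ⟨_, _,
    .assign _ _ _ _, by simp [Val.eval_expr], le_rfl⟩, Poly.const _ _, Poly.const _ _⟩

theorem PT.comp_fst {f : α → γ} (hf : PT f) : PT fun p : α × β => f p.1 := hf.comp PT.fst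
theorem PT.comp_snd {f : β → γ} (hf : PT f) : PT fun p : α × β => f p.2 := hf.comp PT.snd

theorem PT.cons {f : α → β} {g : α → List β} (hf : PT f) (hg : PT g) : PT fun a => f a :: g a :=
  (hf.pair hg).congr_enc fun _ => rfl

theorem PT.listCases {l : α → List β} {f : α → γ} {g : α → β → List β → γ} (hl : PT l) (hf : PT f)
    (hg : PT fun q : α × β × List β => g q.1 q.2.1 q.2.2) :
    PT fun a => match l a with | [] => f a | b :: t => g a b t := by
  obtain ⟨P, T, h, hT, hs⟩ := hl
  obtain ⟨Q, U, h', hU, hs'⟩ := hf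
  obtain ⟨R, W, h'', hW, hs''⟩ := hg
  -- The head and tail are parts of `l a`, whose size is polynomial in that of `a`.
  have key : ∀ V : α × β × List β → ℕ, Poly sz V → Poly sz fun a : α =>
      match l a with | [] => 0 | b :: t => V (a, b, t) := by
    rintro V ⟨k, hk⟩
    refine (((Poly.self sz).add (hs.add (Poly.const sz 3))).pow k).of_le fun a => ?_
    cases hla : l a with
    | nil => exact Nat.zero_le _
    | cons b t =>
      refine (hk _).trans (Nat.pow_le_pow_left ?_ k)
      simp only [sz_pair, sz_cons]; omega
  refine ⟨_, _, h.listCases h' h'', (hT.add ((Poly.const sz 12).add (hU.add (key W hW)))).of_le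
    fun a => ?_, (hs'.add (key _ hs'')).of_le fun a => ?_⟩
  · cases hla : l a with
    | nil => simp; omega
    | cons b t => simp; omega
  · cases hla : l a with
    | nil => simp [hla]
    | cons b t => simp [hla]

theorem PT.cond {c : α → Bool} {f g : α → γ} (hc : PT c) (hf : PT f) (hg : PT g) :
    PT fun a => bif c a then f a else g a := by
  obtain ⟨P, T, h, hT, hs⟩ := hc
  obtain ⟨Q, U, h', hU, hs'⟩ := hf
  obtain ⟨R, W, h'', hW, hs''⟩ := hg
  obtain ⟨P', hP'⟩ := h.ite h' h''
  refine ⟨P', _, hP', ((hT.add (Poly.const sz 12)).add hU).add hW, (hs'.add hs'').of_le fun a => ?_⟩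
  cases h : c a <;> simp [h]

theorem PT.ite {c : α → Prop} [DecidablePred c] {f g : α → γ} (hc : PT fun a => decide (c a))
    (hf : PT f) (hg : PT g) : PT fun a => if c a then f a else g a := by
  have := hc.cond hf hg
  refine this.congr_enc fun a => ?_
  by_cases h : c a <;> simp [h]

theorem sz_le_of_mem {b : β} {l : List β} (h : b ∈ l) : sz b ≤ sz l := by
  induction l with
  | nil => simp at h
  | cons c l ih =>
    rw [sz_cons]
    rcases List.mem_cons.1 h with rfl | h
    · omega
    · have := ih h; omega

theorem length_le_sz (l : List β) : l.length ≤ sz l := by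
  induction l with
  | nil => simp
  | cons c l ih => rw [sz_cons, List.length_cons]; omega

theorem sz_append (l l' : List β) : sz (l ++ l') + 1 = sz l + sz l' := by
  induction l with
  | nil => rw [sz_nil, List.nil_append]; omega
  | cons c l ih => rw [List.cons_append, sz_cons, sz_cons]; omega

theorem sz_le_of_forall {l : List β} {B : ℕ} (h : ∀ b ∈ l, sz b ≤ B) :
    sz l ≤ l.length * (B + 1) + 1 := by
  induction l with
  | nil => rw [sz_nil]; omega
  | cons c l ih =>
    rw [sz_cons, List.length_cons, add_mul]
    have h1 := h c (by simp)
    have h2 := ih fun b hb => h b (by simp [hb])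
    omega

/-- A polynomial step may square the size of the state at each iteration; hence the separate bound
`S` on the sizes of all intermediate states. -/
theorem PT.foldl {l : α → List β} {init : α → σ} {step : α → σ → β → σ} (hl : PT l) (hi : PT init)
    (hs : PT fun q : α × σ × β => step q.1 q.2.1 q.2.2) (S : α → ℕ) (hS : Poly sz S)
    (hSle : ∀ a l₁ l₂, l a = l₁ ++ l₂ → sz (l₁.foldl (step a) (init a)) ≤ S a) :
    PT fun a => (l a).foldl (step a) (init a) := by
  obtain ⟨P, T, h, hT, hsz⟩ := hl
  obtain ⟨Q, U, h', hU, hsz'⟩ := hi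
  obtain ⟨R, W, h'', ⟨k, hk⟩, hsz''⟩ := hs
  obtain ⟨P', hP'⟩ := h.foldl h' h'' (fun a => (sz a + S a + sz (l a) + 4) ^ k)
    (by
      intro a l₁ b l₂ hla
      refine (hk _).trans (Nat.pow_le_pow_left ?_ k)
      have h1 : sz (l₁.foldl (fun y b => step a y b) (init a)) ≤ S a := hSle a l₁ (b :: l₂) hla
      have h2 : sz b ≤ sz (l a) := sz_le_of_mem (by rw [hla]; simp)
      simp only [sz_pair]
      omega)
  refine ⟨P', _, hP', ?_, hS.of_le fun a => hSle a (l a) [] (by simp)⟩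
  have hlen : Poly sz fun a => (l a).length := hsz.of_le fun a => length_le_sz _
  exact ((hT.add hU).add (hlen.mul (((((Poly.self sz).add hS).add hsz).add (Poly.const sz 4)).pow k |>.add
    (Poly.const sz 20)))).add (Poly.const sz 20)

/-- A fold whose state grows in each step by a polynomially bounded amount. -/
theorem PT.foldl_of_growth {l : α → List β} {init : α → σ} {step : α → σ → β → σ} (hl : PT l)
    (hi : PT init) (hs : PT fun q : α × σ × β => step q.1 q.2.1 q.2.2) (S : α → ℕ) (hS : Poly sz S)
    (hSle : ∀ a y, ∀ b ∈ l a, sz (step a y b) ≤ sz y + S a) :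
    PT fun a => (l a).foldl (step a) (init a) := by
  refine hl.foldl hi hs (fun a => sz (init a) + sz (l a) * S a) (hi.size.add (hl.size.mul hS)) ?_
  intro a l₁ l₂ h
  have key : ∀ (l₁ : List β) (y : σ), (∀ b ∈ l₁, b ∈ l a) →
      sz (l₁.foldl (step a) y) ≤ sz y + l₁.length * S a := by
    intro l₁
    induction l₁ with
    | nil => intro y _; simp
    | cons b l₁ ih =>
      intro y hy
      have h1 := ih (step a y b) fun c hc => hy c (by simp [hc])
      have h2 := hSle a y b (hy b (by simp))
      rw [List.foldl_cons, List.length_cons, add_mul]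
      omega
  refine (key l₁ (init a) fun b hb => by rw [h]; simp [hb]).trans ?_
  have : l₁.length ≤ sz (l a) := (length_le_sz _).trans' (by rw [h]; simp)
  have := Nat.mul_le_mul_right (S a) this
  omega

/-! ### Lists -/

theorem PT.reverse {l : α → List β} (hl : PT l) : PT fun a => (l a).reverse := by
  have h : PT fun a => (l a).foldl (fun acc b => b :: acc) [] :=
    PT.foldl_of_growth (step := fun _ acc b => b :: acc) hl (PT.const [])
      ((PT.snd.comp_snd).cons PT.fst.comp_snd) _ (hl.size.add (Poly.const sz 1))
      fun a y b hb => by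
        have := sz_le_of_mem hb
        rw [sz_cons]; omega
  refine h.congr_enc fun a => ?_
  simp

/-- A bound for the values of a polynomial time function at the elements of a list. -/
theorem PT.size_bound {l : α → List β} {f : α → β → γ} (hl : PT l)
    (hf : PT fun q : α × β => f q.1 q.2) :
    ∃ S : α → ℕ, Poly sz S ∧ ∀ a, ∀ b ∈ l a, sz (f a b) ≤ S a := by
  obtain ⟨k, hk⟩ := hf.size
  refine ⟨fun a => (sz a + sz (l a) + 3) ^ k,
    (((Poly.self sz).add hl.size).add (Poly.const sz 3)).pow k, fun a b hb => ?_⟩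
  refine (hk (a, b)).trans (Nat.pow_le_pow_left ?_ k)
  have := sz_le_of_mem hb
  rw [sz_pair]; omega

theorem PT.map {l : α → List β} {f : α → β → γ} (hl : PT l) (hf : PT fun q : α × β => f q.1 q.2) :
    PT fun a => (l a).map (f a) := by
  obtain ⟨S, hS, hSle⟩ := hl.size_bound hf
  have h : PT fun a => (l a).foldl (fun acc b => f a b :: acc) [] :=
    PT.foldl_of_growth (step := fun a acc b => f a b :: acc) hl (PT.const [])
      ((hf.comp (PT.fst.pair PT.snd.comp_snd)).cons PT.fst.comp_snd) _ (hS.add (Poly.const sz 1))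
      fun a y b hb => by
        have := hSle a b hb
        rw [sz_cons]; omega
  refine h.reverse.congr_enc fun a => ?_
  have : ∀ (l : List β) (acc : List γ),
      l.foldl (fun acc b => f a b :: acc) acc = (l.map (f a)).reverse ++ acc := by
    intro l
    induction l with
    | nil => simp
    | cons b l ih => intro acc; simp [ih]
  rw [this]; simp

theorem PT.append {l l' : α → List β} (hl : PT l) (hl' : PT l') : PT fun a => l a ++ l' a := by
  have h : PT fun a => (l a).reverse.foldl (fun acc b => b :: acc) (l' a) :=
    PT.foldl_of_growth (step := fun _ acc b => b :: acc) hl.reverse hl'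
      ((PT.snd.comp_snd).cons PT.fst.comp_snd) _ (hl.size.add (Poly.const sz 1))
      fun a y b hb => by
        have := sz_le_of_mem (List.mem_reverse.1 hb)
        rw [sz_cons]; omega
  refine h.congr_enc fun a => ?_
  simp

theorem PT.flatMap {l : α → List β} {f : α → β → List γ} (hl : PT l)
    (hf : PT fun q : α × β => f q.1 q.2) : PT fun a => (l a).flatMap (f a) := by
  obtain ⟨S, hS, hSle⟩ := hl.size_bound hf
  have h : PT fun a => (l a).foldl (fun acc b => acc ++ f a b) [] :=
    PT.foldl_of_growth (step := fun a acc b => acc ++ f a b) hl (PT.const [])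
      (PT.fst.comp_snd.append (hf.comp (PT.fst.pair PT.snd.comp_snd))) _ hS
      fun a y b hb => by
        have := hSle a b hb
        have := sz_append y (f a b)
        omega
  refine h.congr_enc fun a => ?_
  have : ∀ (l : List β) (acc : List γ),
      l.foldl (fun acc b => acc ++ f a b) acc = acc ++ l.flatMap (f a) := by
    intro l
    induction l with
    | nil => simp
    | cons b l ih => intro acc; simp [ih]
  rw [this]; simp

theorem PT.headD {l : α → List β} {d : α → β} (hl : PT l) (hd : PT d) :
    PT fun a => (l a).headD (d a) := by
  have := hl.listCases (g := fun _ b _ => b) hd PT.fst.comp_snd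
  refine this.congr_enc fun a => ?_
  cases l a <;> rfl

theorem PT.isEmpty {l : α → List β} (hl : PT l) : PT fun a => (l a).isEmpty := by
  have := hl.listCases (f := fun _ => true) (g := fun _ _ _ => false) (PT.const _) (PT.const _)
  refine this.congr_enc fun a => ?_
  cases l a <;> rfl

/-! ### Natural numbers -/

theorem enc_length {β : Type} (l : List β) : Enc.enc l.length = Enc.enc (l.map fun _ => ()) := by
  induction l with
  | nil => rfl
  | cons b l ih => rw [List.map_cons, enc_cons, ← ih]; rfl

/-- Unary numerals are lists of units, so arithmetic reduces to operations on lists. -/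
theorem enc_nat (n : ℕ) : Enc.enc n = Enc.enc (List.replicate n ()) := by
  simpa using enc_length (List.replicate n ())

theorem sz_nat (n : ℕ) : sz n = 2 * n + 1 := by
  have : ∀ n, (Val.ofNat n).size = 2 * n + 1 := by
    intro n
    induction n with
    | zero => rfl
    | succ n ih => simp only [Val.ofNat, Val.size, ih]; omega
  exact this n

theorem PT.length {l : α → List β} (hl : PT l) : PT fun a => (l a).length :=
  (hl.map (f := fun _ _ => ()) (PT.const ())).congr_enc fun _ => enc_length _

theorem PT.replicate_unit {n : α → ℕ} (hn : PT n) : PT fun a => List.replicate (n a) () :=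
  hn.congr_enc fun _ => (enc_nat _).symm

theorem PT.replicate {n : α → ℕ} {f : α → β} (hn : PT n) (hf : PT f) :
    PT fun a => List.replicate (n a) (f a) := by
  have := hn.replicate_unit.map (f := fun a _ => f a) hf.comp_fst
  refine this.congr_enc fun a => ?_
  simp

theorem foldl_replicate_unit {σ : Type} (n : ℕ) (g : σ → σ) (y : σ) :
    (List.replicate n ()).foldl (fun y _ => g y) y = g^[n] y := by
  induction n generalizing y with
  | zero => rfl
  | succ n ih => rw [List.replicate_succ, List.foldl_cons, ih]; rfl

theorem PT.iterate {n : α → ℕ} {init : α → σ} {step : α → σ → σ} (hn : PT n) (hi : PT init)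
    (hs : PT fun q : α × σ => step q.1 q.2) (S : α → ℕ) (hS : Poly sz S)
    (hSle : ∀ a, ∀ k ≤ n a, sz ((step a)^[k] (init a)) ≤ S a) :
    PT fun a => (step a)^[n a] (init a) := by
  have := hn.replicate_unit.foldl (step := fun a y _ => step a y) hi
    (hs.comp (PT.fst.pair PT.fst.comp_snd)) S hS (by
      intro a l₁ l₂ h
      have h1 : l₁ = List.replicate l₁.length () := List.eq_replicate_iff.2 ⟨rfl, fun _ _ => rfl⟩
      rw [h1, foldl_replicate_unit]
      refine hSle a _ ?_
      have := congrArg List.length h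
      simp at this; omega)
  refine this.congr_enc fun a => ?_
  rw [foldl_replicate_unit]

theorem PT.iterate_of_growth {n : α → ℕ} {init : α → σ} {step : α → σ → σ} (hn : PT n)
    (hi : PT init) (hs : PT fun q : α × σ => step q.1 q.2) (S : α → ℕ) (hS : Poly sz S)
    (hSle : ∀ a y, sz (step a y) ≤ sz y + S a) :
    PT fun a => (step a)^[n a] (init a) := by
  have := hn.replicate_unit.foldl_of_growth (step := fun a y _ => step a y) hi
    (hs.comp (PT.fst.pair PT.fst.comp_snd)) S hS (fun a y _ _ => hSle a y)
  refine this.congr_enc fun a => ?_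
  rw [foldl_replicate_unit]

theorem PT.pred {n : α → ℕ} (hn : PT n) : PT fun a => n a - 1 :=
  (PT.tail.comp hn.replicate_unit).congr_enc fun a => by
    rw [enc_nat, List.tail_replicate]

theorem PT.add {m n : α → ℕ} (hm : PT m) (hn : PT n) : PT fun a => m a + n a := by
  refine (hm.replicate_unit.append hn.replicate_unit).congr_enc fun a => ?_
  rw [enc_nat, List.replicate_add]

theorem PT.mul {m n : α → ℕ} (hm : PT m) (hn : PT n) : PT fun a => m a * n a := by
  have := (hm.replicate_unit.flatMap (f := fun a _ => List.replicate (n a) ())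
    hn.replicate_unit.comp_fst).length
  refine this.congr_enc fun a => ?_
  simp [List.length_flatMap]

theorem PT.sub {m n : α → ℕ} (hm : PT m) (hn : PT n) : PT fun a => m a - n a := by
  have := hn.iterate_of_growth (step := fun _ k => k - 1) hm PT.snd.pred (fun _ => 0)
    (Poly.const _ 0) (fun a y => by rw [sz_nat, sz_nat]; omega)
  refine this.congr_enc fun a => ?_
  have h : ∀ n m : ℕ, (fun k => k - 1)^[n] m = m - n := by
    intro n
    induction n with
    | zero => simp
    | succ n ih => intro m; rw [Function.iterate_succ_apply, ih]; omega
  rw [h]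

theorem PT.nat_le {m n : α → ℕ} (hm : PT m) (hn : PT n) : PT fun a => decide (m a ≤ n a) := by
  refine (hm.sub hn).replicate_unit.isEmpty.congr_enc fun a => ?_
  congr 1
  rw [Bool.eq_iff_iff]
  simp [Nat.sub_eq_zero_iff_le]

theorem PT.not {c : α → Bool} (hc : PT c) : PT fun a => !c a :=
  (hc.cond (PT.const false) (PT.const true)).congr_enc fun a => by cases c a <;> rfl

theorem PT.nat_lt {m n : α → ℕ} (hm : PT m) (hn : PT n) : PT fun a => decide (m a < n a) :=
  (hn.nat_le hm).not.congr_enc fun a => by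
    congr 1
    rw [Bool.eq_iff_iff]
    simp

theorem PT.drop {n : α → ℕ} {l : α → List β} (hn : PT n) (hl : PT l) :
    PT fun a => (l a).drop (n a) := by
  have := hn.iterate_of_growth (step := fun _ (k : List β) => k.tail) hl (PT.tail.comp PT.snd)
    (fun _ => 0) (Poly.const _ 0) (fun a y => by cases y <;> simp [sz_cons]; omega)
  refine this.congr_enc fun a => ?_
  rw [List.tail_iterate]

theorem PT.take {n : α → ℕ} {l : α → List β} (hn : PT n) (hl : PT l) :
    PT fun a => (l a).take (n a) := by
  refine (PT.drop (hl.length.sub hn) hl.reverse).reverse.congr_enc fun a => ?_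
  rw [← List.reverse_take, List.reverse_reverse]

theorem PT.getD {n : α → ℕ} {l : α → List β} {d : α → β} (hl : PT l) (hn : PT n) (hd : PT d) :
    PT fun a => (l a).getD (n a) (d a) := by
  refine ((hn.drop hl).headD hd).congr_enc fun a => ?_
  rw [List.headD_eq_head?_getD, List.head?_drop, List.getD_eq_getElem?_getD]

theorem PT.set {n : α → ℕ} {l : α → List β} {d : α → β} (hl : PT l) (hn : PT n) (hd : PT d) :
    PT fun a => (l a).set (n a) (d a) := by
  refine ((hn.drop hl).listCases (g := fun a _ t => (l a).take (n a) ++ d a :: t) hl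
    ((hn.take hl).comp_fst.append (hd.comp_fst.cons PT.snd.comp_snd))).congr_enc fun a => ?_
  rw [List.set_eq_take_append_cons_drop]
  by_cases h : n a < (l a).length
  · rw [if_pos h, List.drop_eq_getElem_cons h]
  · rw [if_neg h, List.drop_of_length_le (not_lt.1 h)]

end

end SepSim
-- Ranges, halves of lists, integers and tuples.
namespace SepSim
open Enc
section
variable {α β γ σ : Type} [Enc α] [Enc β] [Enc γ] [Enc σ]

theorem PT.range {n : α → ℕ} (hn : PT n) : PT fun a => List.range (n a) := by
  have h : ∀ k : ℕ, (fun l : List ℕ => l.length :: l)^[k] [] = (List.range k).reverse := by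
    intro k
    induction k with
    | zero => rfl
    | succ k ih =>
      rw [Function.iterate_succ_apply', ih, List.range_succ, List.reverse_append]
      simp
  have := hn.iterate (init := fun _ => []) (step := fun _ (l : List ℕ) => l.length :: l) (PT.const _)
    (PT.snd.length.cons PT.snd) (fun a => sz (n a) * (2 * sz (n a) + 2) + 1)
    ((hn.size.mul (((Poly.const sz 2).mul hn.size).add (Poly.const sz 2))).add (Poly.const sz 1))
    (by
      intro a k hk
      rw [h]
      refine (sz_le_of_forall (B := 2 * n a + 1) fun b hb => ?_).trans ?_
      · rw [List.mem_reverse, List.mem_range] at hb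
        rw [sz_nat]; omega
      · rw [List.length_reverse, List.length_range, sz_nat]
        refine Nat.add_le_add_right (Nat.mul_le_mul ?_ ?_) 1 <;> omega)
  refine this.reverse.congr_enc fun a => ?_
  rw [h, List.reverse_reverse]

/-- The entries of a list with even index (for `true`) or with odd index (for `false`). -/
def half {β : Type} : Bool → List β → List β
  | _, [] => []
  | true, b :: l => b :: half false l
  | false, _ :: l => half true l

theorem PT.half {c : α → Bool} {l : α → List β} (hc : PT c) (hl : PT l) :
    PT fun a => half (c a) (l a) := by
  have h := hl.foldl_of_growth (init := fun a => (c a, ([] : List β)))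
    (step := fun _ (y : Bool × List β) b => (!y.1, bif y.1 then b :: y.2 else y.2))
    (hc.pair (PT.const _)) ((PT.fst.comp (PT.fst.comp PT.snd)).not.pair
      ((PT.fst.comp (PT.fst.comp PT.snd)).cond ((PT.snd.comp PT.snd).cons (PT.snd.comp (PT.fst.comp PT.snd)))
      (PT.snd.comp (PT.fst.comp PT.snd)))) _ (hl.size.add (Poly.const sz 5))
    (by
      rintro a ⟨y, acc⟩ b hb
      have := sz_le_of_mem hb
      have h1 : sz (!y) ≤ 3 := by cases y <;> decide
      cases y <;> simp only [sz_pair, sz_cons, Bool.cond_true, Bool.cond_false] at * <;> omega)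
  refine (PT.snd.comp h).reverse.congr_enc fun a => ?_
  have key : ∀ (l : List β) (c : Bool) (acc : List β),
      (l.foldl (fun (y : Bool × List β) b => (!y.1, bif y.1 then b :: y.2 else y.2)) (c, acc)).2 =
        (SepSim.half c l).reverse ++ acc := by
    intro l
    induction l with
    | nil => intro c acc; cases c <;> rfl
    | cons b l ih => intro c acc; rw [List.foldl_cons, ih]; cases c <;> simp [SepSim.half]
  rw [key]; simp

/-! ### Integers -/

theorem sz_int_le (z : ℤ) : sz z ≤ 2 * z.natAbs + 5 := by
  have h : sz z = sz (decide (z < 0)) + sz z.natAbs + 1 := rfl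
  have h1 : ∀ b : Bool, sz b ≤ 3 := by decide
  have := h1 (decide (z < 0))
  rw [h, sz_nat]; omega

theorem le_sz_int (z : ℤ) : 2 * z.natAbs ≤ sz z := by
  have h : sz z = sz (decide (z < 0)) + sz z.natAbs + 1 := rfl
  rw [h, sz_nat]; omega

theorem PT.natAbs {x : α → ℤ} (hx : PT x) : PT fun a => (x a).natAbs :=
  (PT.of_tl (f := fun x : ℤ => x.natAbs) fun _ => rfl).comp hx

theorem PT.isNeg {x : α → ℤ} (hx : PT x) : PT fun a => decide (x a < 0) :=
  (PT.of_hd (f := fun x : ℤ => decide (x < 0)) fun _ => rfl).comp hx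

theorem PT.toNat {x : α → ℤ} (hx : PT x) : PT fun a => (x a).toNat := by
  refine (hx.isNeg.cond (PT.const 0) hx.natAbs).congr_enc fun a => ?_
  congr 1
  by_cases h : x a < 0 <;> simp [h] <;> omega

theorem PT.toNat_neg {x : α → ℤ} (hx : PT x) : PT fun a => (-x a).toNat := by
  refine (hx.isNeg.cond hx.natAbs (PT.const 0)).congr_enc fun a => ?_
  congr 1
  by_cases h : x a < 0 <;> simp [h] <;> omega

/-- Integer arithmetic is done on positive and negative parts, with this as the only operation that
produces the sign-and-magnitude encoding. -/
theorem PT.int_sub_nat {m n : α → ℕ} (hm : PT m) (hn : PT n) : PT fun a => (m a : ℤ) - n a := by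
  refine ((hm.nat_lt hn).pair ((hm.sub hn).add (hn.sub hm))).congr_enc fun a => ?_
  show Enc.enc (decide (((m a : ℤ) - n a) < 0), ((m a : ℤ) - n a).natAbs) = _
  congr 2
  · rw [Bool.eq_iff_iff]; simp
  · omega

theorem PT.natCast {m : α → ℕ} (hm : PT m) : PT fun a => (m a : ℤ) :=
  (hm.int_sub_nat (PT.const 0)).congr_enc fun a => by simp

theorem PT.int_add {x y : α → ℤ} (hx : PT x) (hy : PT y) : PT fun a => x a + y a :=
  ((hx.toNat.add hy.toNat).int_sub_nat (hx.toNat_neg.add hy.toNat_neg)).congr_enc fun a => by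
    congr 1; push_cast; omega

theorem PT.int_neg {x : α → ℤ} (hx : PT x) : PT fun a => -x a :=
  (hx.toNat_neg.int_sub_nat hx.toNat).congr_enc fun a => by congr 1; omega

theorem PT.int_sub {x y : α → ℤ} (hx : PT x) (hy : PT y) : PT fun a => x a - y a :=
  (hx.int_add hy.int_neg).congr_enc fun a => by rw [sub_eq_add_neg]

theorem PT.int_mul {x y : α → ℤ} (hx : PT x) (hy : PT y) : PT fun a => x a * y a :=
  (((hx.toNat.mul hy.toNat).add (hx.toNat_neg.mul hy.toNat_neg)).int_sub_nat
    ((hx.toNat.mul hy.toNat_neg).add (hx.toNat_neg.mul hy.toNat))).congr_enc fun a => by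
    congr 1
    push_cast
    have h : ∀ z : ℤ, z = max z 0 - max (-z) 0 := fun z => by omega
    conv_lhs => rw [h (x a), h (y a)]
    simp only [Int.ofNat_toNat]
    ring

theorem PT.int_le {x y : α → ℤ} (hx : PT x) (hy : PT y) : PT fun a => decide (x a ≤ y a) :=
  ((hx.toNat.add hy.toNat_neg).nat_le (hy.toNat.add hx.toNat_neg)).congr_enc fun a => by
    congr 1; rw [Bool.eq_iff_iff]; simp; omega

theorem PT.int_lt {x y : α → ℤ} (hx : PT x) (hy : PT y) : PT fun a => decide (x a < y a) :=
  (hy.int_le hx).not.congr_enc fun a => by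
    congr 1; rw [Bool.eq_iff_iff]; simp

theorem PT.int_sum {l : α → List β} {f : α → β → ℤ} (hl : PT l)
    (hf : PT fun q : α × β => f q.1 q.2) : PT fun a => ((l a).map (f a)).sum := by
  obtain ⟨S, hS, hSle⟩ := hl.size_bound hf
  have := hl.foldl_of_growth (init := fun _ => (0 : ℤ)) (step := fun a y b => y + f a b) (PT.const _)
    (PT.fst.comp_snd.int_add (hf.comp (PT.fst.pair PT.snd.comp_snd))) _ (hS.add (Poly.const sz 5))
    (by
      intro a y b hb
      have h1 := hSle a b hb
      have h2 := sz_int_le (y + f a b)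
      have h3 := le_sz_int y
      have h4 := le_sz_int (f a b)
      have h5 := Int.natAbs_add_le y (f a b)
      omega)
  refine this.congr_enc fun a => ?_
  congr 1
  rw [List.sum_eq_foldl, List.foldl_map]

/-- An element of the list `d :: l` with the smallest score. -/
def argmin {β : Type} (score : β → ℤ) (d : β) (l : List β) : β :=
  l.foldl (fun y b => if score b < score y then b else y) d

theorem PT.argmin {l : α → List β} {d : α → β} {f : α → β → ℤ} (hl : PT l) (hd : PT d)
    (hf : PT fun q : α × β => f q.1 q.2) : PT fun a => argmin (f a) (d a) (l a) := by
  refine hl.foldl_of_growth (step := fun a y b => if f a b < f a y then b else y) hd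
    (PT.ite ((hf.comp (PT.fst.pair PT.snd.comp_snd)).int_lt (hf.comp (PT.fst.pair PT.fst.comp_snd)))
      PT.snd.comp_snd PT.fst.comp_snd) _ hl.size fun a y b hb => ?_
  have := sz_le_of_mem hb
  split_ifs <;> omega

/-! ### Tuples -/

theorem PT.tuple_head {n : ℕ} : PT fun v : Fin (n + 1) → β => v 0 :=
  PT.of_hd fun v => by
    show _ = (Enc.enc (List.ofFn v)).hd
    rw [List.ofFn_succ]; rfl

theorem PT.tuple_tail {n : ℕ} : PT fun v : Fin (n + 1) → β => fun i : Fin n => v i.succ :=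
  PT.of_tl fun v => by
    show _ = (Enc.enc (List.ofFn v)).tl
    rw [List.ofFn_succ]; rfl

theorem PT.proj {n : ℕ} (i : Fin n) : PT fun v : Fin n → β => v i := by
  induction n with
  | zero => exact i.elim0
  | succ n ih =>
    refine Fin.cases ?_ (fun j => ?_) i
    · exact PT.tuple_head
    · exact (ih j).comp PT.tuple_tail

theorem PT.apply {n : ℕ} {f : α → Fin n → β} (hf : PT f) (i : Fin n) : PT fun a => f a i :=
  (PT.proj i).comp hf

theorem PT.tuple {n : ℕ} {f : α → Fin n → β} (hf : ∀ i, PT fun a => f a i) : PT f := by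
  induction n with
  | zero => exact (PT.const ([] : List β)).congr_enc fun a => rfl
  | succ n ih =>
    refine ((hf 0).pair (ih fun i => hf i.succ)).congr_enc fun a => ?_
    show Enc.enc (List.ofFn (f a)) = _
    rw [List.ofFn_succ]; rfl

theorem PT.fin_sum {n : ℕ} {f : Fin n → α → ℤ} (hf : ∀ i, PT (f i)) : PT fun a => ∑ i, f i a := by
  induction n with
  | zero => exact (PT.const (0 : ℤ)).congr_enc fun a => by simp
  | succ n ih =>
    refine ((hf 0).int_add (ih fun i => hf i.succ)).congr_enc fun a => ?_
    rw [Fin.sum_univ_succ]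

end
end SepSim
-- The algorithm and its running time.
namespace SepSim
open Enc

instance {α : Type} [Enc α] : Enc (Bool → α) := ⟨fun f => enc (f false, f true)⟩

section
variable {α β γ σ : Type} [Enc α] [Enc β] [Enc γ] [Enc σ]

theorem PT.bool_apply {f : α → Bool → β} (hf : PT f) (b : Bool) : PT fun a => f a b := by
  cases b
  · exact (PT.of_hd (f := fun g : Bool → β => g false) fun _ => rfl).comp hf
  · exact (PT.of_tl (f := fun g : Bool → β => g true) fun _ => rfl).comp hf

theorem PT.bool_sum {f : Bool → α → ℤ} (hf : ∀ b, PT (f b)) : PT fun a => ∑ b, f b a :=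
  ((hf true).int_add (hf false)).congr_enc fun a => by rw [Fintype.sum_bool]

end

/-! ### The simulation algorithm -/

/-- The Bloch vector of the state of a qubit, multiplied by its component `0`. -/
abbrev Vec : Type := Fin 4 → ℤ

/-- The matrix of a two-qubit gate with respect to the products of Pauli matrices. -/
abbrev Tensor : Type := Fin 4 → Fin 4 → Fin 4 → Fin 4 → ℤ

/-- The Bloch vectors `v` with integral coordinates, `v 0 = M`. -/
def net (M : ℕ) : List Vec :=
  let I : List ℤ := (List.range (2 * M + 1)).map fun (n : ℕ) => (n : ℤ) - M
  I.flatMap fun x => I.flatMap fun y => I.flatMap fun z =>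
    if x * x + y * y + z * z ≤ (M : ℤ) * M then [![(M : ℤ), x, y, z]] else []

/-- The Bloch vector of a computational basis state. -/
def pole (M : ℕ) (b : Bool) : Vec := ![(M : ℤ), 0, 0, bif b then -M else M]

/-- All pairs of Bloch vectors. -/
def netPairs (M : ℕ) : List (Vec × Vec) := (net M).flatMap fun a => (net M).map fun b => (a, b)

/-- The inner product. -/
def dot (v w : Vec) : ℤ := ∑ i, v i * w i

/-- The inner product of the image of `v ⊗ w` under the gate with `a ⊗ b`. -/
def bil (G : Tensor) (v w a b : Vec) : ℤ :=
  ∑ μ, ∑ ν, ∑ α, ∑ β, G μ ν α β * v α * w β * a μ * b ν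

/-- The inner product of `s` with the deviation of the sum of `l` from the target. -/
def score (M : ℕ) (G : Tensor) (v w : Vec) (l : List (Vec × Vec)) (s : Vec × Vec) : ℤ :=
  (l.map fun r => 4 * (M : ℤ) * (dot r.1 s.1 * dot r.2 s.2) - bil G v w s.1 s.2).sum

/-- The element of the net that reduces the deviation most. -/
def greedyStep (M : ℕ) (G : Tensor) (v w : Vec) (l : List (Vec × Vec)) : Vec × Vec :=
  argmin (score M G v w l) (pole M false, pole M false) (netPairs M)

/-- A list of pairs of states whose uniform mixture approximates the image of `v ⊗ w` under the
gate. -/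
def greedy (M : ℕ) (G : Tensor) (v w : Vec) : List (Vec × Vec) :=
  (fun l => greedyStep M G v w l :: l)^[M] []

/-- Replace the list by one of its halves, depending on the next coin toss. -/
def selectStep {β : Type} (y : List β × List Bool) : List β × List Bool :=
  -- A list with at most one entry is left alone and consumes no toss, so that superfluous
  -- iterations do no harm.
  bif y.1.tail.isEmpty then y else (half (y.2.headD false) y.1, y.2.tail)

/-- Choose a random entry of a list, and return the remaining coin tosses, too. -/
def select {β : Type} (d : β) (l : List β) (c : List Bool) : β × List Bool :=
  -- More iterations than needed: a list of length `2 ^ m` is a singleton after `m` of them.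
  let r := selectStep^[l.length] (l, c)
  (r.1.headD d, r.2)

/-- An operation of a circuit, without reference to the gate set. -/
structure RawOp where
  /-- whether the operation is a two-qubit gate -/
  kind : Bool
  /-- the number of the gate -/
  gate : ℕ
  /-- the first qubit -/
  fst : ℕ
  /-- the second qubit -/
  snd : ℕ

instance : Enc RawOp := ⟨fun o => .cons (enc o.kind) (.cons (enc o.gate) (.cons (enc o.fst)
  (bif o.kind then .cons (enc o.snd) .nil else .nil)))⟩

/-- The list of pairs from which the simulation of an operation chooses. -/
def choices (M : ℕ) (tabs : List Tensor × List Tensor) (a : List Vec) (o : RawOp) :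
    List (Vec × Vec) :=
  -- A one-qubit gate is treated as a two-qubit gate that acts trivially on a dummy second qubit in
  -- the state `pole M false`; `place` discards the second component.
  greedy M (bif o.kind then tabs.2.getD o.gate 0 else tabs.1.getD o.gate 0)
    (a.getD o.fst 0) (bif o.kind then a.getD o.snd 0 else pole M false)

/-- Change the state of the qubits on which an operation acts. -/
def RawOp.place (o : RawOp) (a : List Vec) (s : Vec × Vec) : List Vec :=
  bif o.kind then (a.set o.fst s.1).set o.snd s.2 else a.set o.fst s.1

/-- The simulation of an operation. -/
def stepOp (M : ℕ) (tabs : List Tensor × List Tensor) (st : List Vec × List Bool) (o : RawOp) :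
    List Vec × List Bool :=
  let r := select (pole M false, pole M false) (choices M tabs st.1 o) st.2
  (o.place st.1 r.1, r.2)

/-- The possible outcomes of a measurement of a qubit. -/
def bitChoices (v : Vec) : List Bool :=
  -- On the net `v 0 = M` and `|v 3| ≤ M`, so there are `2 M` entries, and a uniform choice gives
  -- exactly the probabilities `(M ± v 3) / (2 M)`.
  List.replicate (v 0 + v 3).toNat false ++ List.replicate (v 0 - v 3).toNat true

/-- The simulation of the measurement of a qubit. -/
def stepBit (st : List Bool × List Bool) (v : Vec) : List Bool × List Bool :=
  let r := select false (bitChoices v) st.2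
  (st.1 ++ [r.1], r.2)

/-- The simulation of all operations and of the measurement of all qubits. -/
def sampleBits (M : ℕ) (tabs : List Tensor × List Tensor) (ops : List RawOp) (x c : List Bool) :
    List Bool :=
  let st := ops.foldl (stepOp M tabs) (x.map (pole M), c)
  (st.1.foldl stepBit ([], st.2)).1

/-- The bits that belong to measured qubits. -/
def restrictBits (flags bits : List Bool) : List Bool :=
  (List.range flags.length).flatMap fun i => bif flags.getD i false then [bits.getD i false] else []

/-! ### The simulation runs in polynomial time -/

section
variable {α β γ σ : Type} [Enc α] [Enc β] [Enc γ] [Enc σ]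

theorem PT.vec4 {a b c d : α → ℤ} (ha : PT a) (hb : PT b) (hc : PT c) (hd : PT d) :
    PT fun p => (![a p, b p, c p, d p] : Vec) :=
  PT.tuple fun i => by fin_cases i <;> assumption

/-- Enumerating the at most `(2 M + 1) ^ 3` points is polynomial because numbers are written in
unary. -/
theorem PT.net {M : α → ℕ} (hM : PT M) : PT fun a => net (M a) := by
  have hI : PT fun a => (List.range (2 * M a + 1)).map fun (n : ℕ) => (n : ℤ) - M a :=
    (((PT.const 2).mul hM).add (PT.const 1)).range.map (f := fun a (n : ℕ) => (n : ℤ) - M a)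
      (PT.snd.int_sub_nat hM.comp_fst)
  refine hI.flatMap (f := fun a x => _) (hI.comp_fst.flatMap (f := fun q y => _)
    (hI.comp_fst.comp_fst.flatMap
    (f := fun q z => if q.1.2 * q.1.2 + q.2 * q.2 + z * z ≤ (M q.1.1 : ℤ) * M q.1.1
      then [![(M q.1.1 : ℤ), q.1.2, q.2, z]] else [])
    ?_))
  have hx : PT fun q : ((α × ℤ) × ℤ) × ℤ => q.1.1.2 := PT.snd.comp (PT.fst.comp PT.fst)
  have hy : PT fun q : ((α × ℤ) × ℤ) × ℤ => q.1.2 := PT.snd.comp PT.fst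
  have hz : PT fun q : ((α × ℤ) × ℤ) × ℤ => q.2 := PT.snd
  have hm : PT fun q : ((α × ℤ) × ℤ) × ℤ => (M q.1.1.1 : ℤ) := hM.natCast.comp_fst.comp_fst.comp_fst
  exact PT.ite ((((hx.int_mul hx).int_add (hy.int_mul hy)).int_add (hz.int_mul hz)).int_le
    (hm.int_mul hm)) ((PT.vec4 hm hx hy hz).cons (PT.const [])) (PT.const [])

theorem PT.pole {M : α → ℕ} {b : α → Bool} (hM : PT M) (hb : PT b) :
    PT fun a => pole (M a) (b a) :=
  PT.vec4 hM.natCast (PT.const 0) (PT.const 0) (hb.cond hM.natCast.int_neg hM.natCast)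

theorem PT.netPairs {M : α → ℕ} (hM : PT M) : PT fun a => netPairs (M a) :=
  hM.net.flatMap (f := fun a v => (SepSim.net (M a)).map fun b => (v, b))
    (hM.net.comp_fst.map (f := fun q b => (q.2, b)) (PT.snd.comp_fst.pair PT.snd))

theorem PT.dot {v w : α → Vec} (hv : PT v) (hw : PT w) : PT fun a => dot (v a) (w a) :=
  PT.fin_sum fun i => (hv.apply i).int_mul (hw.apply i)

theorem PT.bil {G : α → Tensor} {v w a b : α → Vec} (hG : PT G) (hv : PT v) (hw : PT w)
    (ha : PT a) (hb : PT b) : PT fun p => bil (G p) (v p) (w p) (a p) (b p) :=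
  PT.fin_sum fun μ => PT.fin_sum fun ν => PT.fin_sum fun x => PT.fin_sum fun y =>
    ((((((hG.apply μ).apply ν).apply x).apply y).int_mul (hv.apply x)).int_mul
      (hw.apply y) |>.int_mul (ha.apply μ)).int_mul (hb.apply ν)

theorem PT.score {M : α → ℕ} {G : α → Tensor} {v w : α → Vec} {l : α → List (Vec × Vec)}
    {s : α → Vec × Vec} (hM : PT M) (hG : PT G) (hv : PT v) (hw : PT w) (hl : PT l) (hs : PT s) :
    PT fun a => score (M a) (G a) (v a) (w a) (l a) (s a) := by
  have h1 : PT fun q : α × Vec × Vec => (s q.1).1 := (PT.fst.comp hs).comp_fst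
  have h2 : PT fun q : α × Vec × Vec => (s q.1).2 := (PT.snd.comp hs).comp_fst
  have h3 : PT fun q : α × Vec × Vec => 4 * (M q.1 : ℤ) :=
    (PT.const (4 : ℤ)).int_mul hM.natCast.comp_fst
  have h4 : PT fun q : α × Vec × Vec => SepSim.dot q.2.1 (s q.1).1 := (PT.fst.comp PT.snd).dot h1
  have h5 : PT fun q : α × Vec × Vec => SepSim.dot q.2.2 (s q.1).2 := (PT.snd.comp PT.snd).dot h2
  have h6 : PT fun q : α × Vec × Vec => SepSim.bil (G q.1) (v q.1) (w q.1) (s q.1).1 (s q.1).2 :=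
    PT.bil hG.comp_fst hv.comp_fst hw.comp_fst h1 h2
  exact hl.int_sum ((h3.int_mul (h4.int_mul h5)).int_sub h6)

theorem PT.greedyStep {M : α → ℕ} {G : α → Tensor} {v w : α → Vec} {l : α → List (Vec × Vec)}
    (hM : PT M) (hG : PT G) (hv : PT v) (hw : PT w) (hl : PT l) :
    PT fun a => greedyStep (M a) (G a) (v a) (w a) (l a) :=
  hM.netPairs.argmin (f := fun a => SepSim.score (M a) (G a) (v a) (w a) (l a))
    ((hM.pole (PT.const false)).pair (hM.pole (PT.const false)))
    (PT.score hM.comp_fst hG.comp_fst hv.comp_fst hw.comp_fst hl.comp_fst PT.snd)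

theorem argmin_mem {β : Type} (f : β → ℤ) (d : β) (l : List β) : argmin f d l ∈ d :: l := by
  have : ∀ (l : List β) (d : β), argmin f d l ∈ d :: l := by
    intro l
    induction l with
    | nil => intro d; simp [argmin]
    | cons b l ih =>
      intro d
      have h : argmin f d (b :: l) = argmin f (if f b < f d then b else d) l := rfl
      rw [h]
      rcases List.mem_cons.1 (ih (if f b < f d then b else d)) with h | h
      · rw [h]
        split_ifs <;> simp
      · exact List.mem_cons_of_mem _ (List.mem_cons_of_mem _ h)
  exact this l d

/-- Whatever the tensor and the states are, every new pair comes from one list that depends on `M`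
only. The state of the simulation therefore grows additively. -/
theorem sz_greedyStep_le (M : ℕ) (G : Tensor) (v w : Vec) (l : List (Vec × Vec)) :
    sz (greedyStep M G v w l) ≤ sz ((pole M false, pole M false) :: netPairs M) :=
  sz_le_of_mem (argmin_mem _ _ _)

theorem PT.sz_net_bound {M : α → ℕ} (hM : PT M) :
    Poly sz fun a : α => sz ((SepSim.pole (M a) false, SepSim.pole (M a) false) ::
      SepSim.netPairs (M a)) :=
  (PT.cons ((hM.pole (PT.const false)).pair (hM.pole (PT.const false))) hM.netPairs).size

theorem PT.greedy {M : α → ℕ} {G : α → Tensor} {v w : α → Vec}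
    (hM : PT M) (hG : PT G) (hv : PT v) (hw : PT w) :
    PT fun a => greedy (M a) (G a) (v a) (w a) := by
  refine hM.iterate_of_growth (init := fun _ => [])
    (step := fun a l => SepSim.greedyStep (M a) (G a) (v a) (w a) l :: l) (PT.const [])
    ((PT.greedyStep hM.comp_fst hG.comp_fst hv.comp_fst hw.comp_fst PT.snd).cons PT.snd)
    _ (hM.sz_net_bound.add (Poly.const sz 1)) fun a l => ?_
  have := sz_greedyStep_le (M a) (G a) (v a) (w a) l
  rw [sz_cons]; omega

theorem sz_half_le (c : Bool) (l : List β) : sz (half c l) ≤ sz l := by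
  induction l generalizing c with
  | nil => cases c <;> exact le_rfl
  | cons b l ih =>
    have h1 := ih true
    have h2 := ih false
    cases c <;> simp only [half, sz_cons] <;> omega

theorem sz_tail_le (l : List β) : sz l.tail ≤ sz l := by
  cases l with
  | nil => exact le_rfl
  | cons b l => rw [List.tail_cons, sz_cons]; omega

theorem PT.select {d : α → β} {l : α → List β} {c : α → List Bool} (hd : PT d) (hl : PT l)
    (hc : PT c) : PT fun a => select (d a) (l a) (c a) := by
  have hs : PT (selectStep : List β × List Bool → _) :=
    (PT.isEmpty (PT.tail.comp PT.fst)).cond PT.id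
      (((PT.headD PT.snd (PT.const false)).half PT.fst).pair (PT.tail.comp PT.snd))
  have h := hl.length.iterate_of_growth (step := fun _ => selectStep) (hl.pair hc) hs.comp_snd
    (fun _ => 0) (Poly.const sz 0) (by
      rintro a ⟨y, c⟩
      have h1 := sz_half_le (c.headD false) y
      have h2 := sz_tail_le c
      simp only [selectStep]
      cases y.tail.isEmpty <;> simp only [Bool.cond_true, Bool.cond_false, sz_pair] <;> omega)
  exact ((PT.fst.comp h).headD hd).pair (PT.snd.comp h)

theorem half_subset {β : Type} (c : Bool) (l : List β) : half c l ⊆ l := by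
  induction l generalizing c with
  | nil => cases c <;> simp [half]
  | cons b l ih =>
    have h1 := ih true
    have h2 := ih false
    cases c <;> simp only [half]
    · exact List.Subset.trans h1 (List.subset_cons_self _ _)
    · exact List.cons_subset_cons _ h2

theorem selectStep_iterate_subset {β : Type} (n : ℕ) (y : List β × List Bool) :
    (selectStep^[n] y).1 ⊆ y.1 := by
  induction n generalizing y with
  | zero => simp
  | succ n ih =>
    rw [Function.iterate_succ_apply]
    refine List.Subset.trans (ih _) ?_
    simp only [selectStep]
    cases y.1.tail.isEmpty
    · exact half_subset _ _
    · simp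

theorem select_mem {β : Type} (d : β) (l : List β) (c : List Bool) :
    (select d l c).1 ∈ d :: l := by
  have h := selectStep_iterate_subset l.length (l, c)
  simp only [select]
  cases hr : (selectStep^[l.length] (l, c)).1 with
  | nil => simp
  | cons b t => rw [hr] at h; exact List.mem_cons_of_mem _ (h (by simp))

theorem selectStep_iterate_sz {β : Type} (n : ℕ) (y : List β × List Bool) :
    sz (selectStep^[n] y).2 ≤ sz y.2 := by
  induction n generalizing y with
  | zero => simp
  | succ n ih =>
    rw [Function.iterate_succ_apply]
    refine (ih _).trans ?_
    have := sz_tail_le y.2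
    simp only [selectStep]
    cases y.1.tail.isEmpty <;> simp only [Bool.cond_true, Bool.cond_false] <;> omega

theorem PT.rawKind {o : α → RawOp} (ho : PT o) : PT fun a => (o a).kind :=
  (PT.of_hd (f := fun o : RawOp => o.kind) fun _ => rfl).comp ho

theorem PT.rawTail : PT fun o : RawOp => (Enc.enc o).tl := PT.of_tl fun _ => rfl
theorem PT.valHd : PT Val.hd := PT.of_hd fun _ => rfl
theorem PT.valTl : PT Val.tl := PT.of_tl fun _ => rfl

theorem PT.rawGate {o : α → RawOp} (ho : PT o) : PT fun a => (o a).gate :=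
  ((PT.valHd.comp PT.rawTail).congr_enc (g := fun o : RawOp => o.gate) fun _ => rfl).comp ho

theorem PT.rawFst {o : α → RawOp} (ho : PT o) : PT fun a => (o a).fst :=
  ((PT.valHd.comp (PT.valTl.comp PT.rawTail)).congr_enc (g := fun o : RawOp => o.fst)
    fun _ => rfl).comp ho

/-- The encoding of a one-qubit operation stores no second qubit, and reading past its end yields
`nil`, the numeral `0`. -/
theorem PT.rawSnd {o : α → RawOp} (ho : PT o) : PT fun a => bif (o a).kind then (o a).snd else 0 :=
  ((PT.valHd.comp (PT.valTl.comp (PT.valTl.comp PT.rawTail))).congr_enc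
    (g := fun o : RawOp => bif o.kind then o.snd else 0) fun o => by
      obtain ⟨k, g, i, j⟩ := o
      cases k <;> rfl).comp ho

theorem PT.choices {M : α → ℕ} {tabs : α → List Tensor × List Tensor} {a : α → List Vec}
    {o : α → RawOp} (hM : PT M) (ht : PT tabs) (ha : PT a) (ho : PT o) :
    PT fun p => choices (M p) (tabs p) (a p) (o p) := by
  refine (hM.greedy (ho.rawKind.cond (PT.getD (PT.snd.comp ht) ho.rawGate (PT.const 0))
    (PT.getD (PT.fst.comp ht) ho.rawGate (PT.const 0))) (PT.getD ha ho.rawFst (PT.const 0))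
    (ho.rawKind.cond (PT.getD ha ho.rawSnd (PT.const 0)) (hM.pole (PT.const false)))).congr_enc
    fun p => ?_
  unfold SepSim.choices
  cases (o p).kind <;> rfl

theorem PT.place {o : α → RawOp} {a : α → List Vec} {s : α → Vec × Vec} (ho : PT o) (ha : PT a)
    (hs : PT s) : PT fun p => (o p).place (a p) (s p) := by
  refine (ho.rawKind.cond ((ha.set ho.rawFst (PT.fst.comp hs)).set ho.rawSnd (PT.snd.comp hs))
    (ha.set ho.rawFst (PT.fst.comp hs))).congr_enc fun p => ?_
  unfold RawOp.place
  cases (o p).kind <;> rfl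

theorem sz_set_le (l : List β) (n : ℕ) (b : β) : sz (l.set n b) ≤ sz l + sz b := by
  induction l generalizing n with
  | nil => simp
  | cons c l ih =>
    cases n with
    | zero => rw [List.set_cons_zero, sz_cons, sz_cons]; omega
    | succ n => have := ih n; rw [List.set_cons_succ, sz_cons, sz_cons]; omega

theorem PT.stepOp {M : α → ℕ} {tabs : α → List Tensor × List Tensor} {st : α → List Vec × List Bool}
    {o : α → RawOp} (hM : PT M) (ht : PT tabs) (hst : PT st) (ho : PT o) :
    PT fun p => stepOp (M p) (tabs p) (st p) (o p) := by
  have hr := PT.select ((hM.pole (PT.const false)).pair (hM.pole (PT.const false)))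
    (PT.choices hM ht (PT.fst.comp hst) ho) (PT.snd.comp hst)
  exact (PT.place ho (PT.fst.comp hst) (PT.fst.comp hr)).pair (PT.snd.comp hr)

theorem mem_greedy {M : ℕ} {G : Tensor} {v w : Vec} {s : Vec × Vec} (h : s ∈ greedy M G v w) :
    s ∈ (pole M false, pole M false) :: netPairs M := by
  have : ∀ k, ∀ s ∈ (fun l => greedyStep M G v w l :: l)^[k] [],
      s ∈ (pole M false, pole M false) :: netPairs M := by
    intro k
    induction k with
    | zero => simp
    | succ k ih =>
      intro s hs
      rw [Function.iterate_succ_apply'] at hs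
      rcases List.mem_cons.1 hs with rfl | hs
      · exact argmin_mem _ _ _
      · exact ih s hs
  exact this M s h

theorem sz_stepOp_le (M : ℕ) (tabs : List Tensor × List Tensor) (st : List Vec × List Bool)
    (o : RawOp) : sz (stepOp M tabs st o) ≤
      sz st + sz ((pole M false, pole M false) :: netPairs M) := by
  obtain ⟨a, c⟩ := st
  set r := select (pole M false, pole M false) (choices M tabs a o) c with hr
  have h1 : sz r.1 ≤ sz ((pole M false, pole M false) :: netPairs M) := by
    refine sz_le_of_mem ?_
    rcases List.mem_cons.1 (select_mem (pole M false, pole M false) (choices M tabs a o) c) with h | h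
    · rw [hr, h]; simp
    · exact mem_greedy h
  have h2 : sz r.2 ≤ sz c := selectStep_iterate_sz _ _
  have h3 : sz r.1 = sz r.1.1 + sz r.1.2 + 1 := rfl
  have h4 : sz (o.place a r.1) ≤ sz a + sz r.1.1 + sz r.1.2 := by
    have k1 := sz_set_le a o.fst r.1.1
    have k2 := sz_set_le (a.set o.fst r.1.1) o.snd r.1.2
    unfold RawOp.place
    cases o.kind <;> simp only [Bool.cond_true, Bool.cond_false] <;> omega
  show sz (o.place a r.1, r.2) ≤ _
  rw [sz_pair, sz_pair]; omega

theorem PT.bitChoices {v : α → Vec} (hv : PT v) : PT fun a => bitChoices (v a) :=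
  (PT.replicate ((hv.apply 0).int_add (hv.apply 3)).toNat (PT.const false)).append
    (PT.replicate ((hv.apply 0).int_sub (hv.apply 3)).toNat (PT.const true))

theorem PT.stepBit {st : α → List Bool × List Bool} {v : α → Vec} (hst : PT st) (hv : PT v) :
    PT fun a => stepBit (st a) (v a) := by
  have hr := PT.select (PT.const false) hv.bitChoices (PT.snd.comp hst)
  exact ((PT.fst.comp hst).append ((PT.fst.comp hr).cons (PT.const []))).pair (PT.snd.comp hr)

theorem sz_stepBit_le (st : List Bool × List Bool) (v : Vec) : sz (stepBit st v) ≤ sz st + 4 := by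
  obtain ⟨a, c⟩ := st
  set r := select false (bitChoices v) c with hr
  have h2 : sz r.2 ≤ sz c := selectStep_iterate_sz _ _
  have h3 : ∀ b : Bool, sz b ≤ 3 := by decide
  have h4 := h3 r.1
  show sz (a ++ [r.1], r.2) ≤ _
  have h5 := sz_append a [r.1]
  rw [sz_cons, sz_nil] at h5
  rw [sz_pair, sz_pair]; omega

theorem PT.sampleBits {M : α → ℕ} {tabs : α → List Tensor × List Tensor} {ops : α → List RawOp}
    {x c : α → List Bool} (hM : PT M) (ht : PT tabs) (ho : PT ops) (hx : PT x) (hc : PT c) :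
    PT fun a => sampleBits (M a) (tabs a) (ops a) (x a) (c a) := by
  have h0 : PT fun a => (x a).map (SepSim.pole (M a)) := hx.map (hM.comp_fst.pole PT.snd)
  have h1 := ho.foldl_of_growth (step := fun a => SepSim.stepOp (M a) (tabs a)) (h0.pair hc)
    (PT.stepOp hM.comp_fst ht.comp_fst PT.fst.comp_snd PT.snd.comp_snd) _ hM.sz_net_bound
    fun a st o _ => sz_stepOp_le _ _ _ _
  exact PT.fst.comp ((PT.fst.comp h1).foldl_of_growth (step := fun _ => SepSim.stepBit)
    ((PT.const []).pair (PT.snd.comp h1)) (PT.stepBit PT.fst.comp_snd PT.snd.comp_snd) _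
    (Poly.const sz 4) fun a st v _ => sz_stepBit_le _ _)

theorem PT.restrictBits {flags bits : α → List Bool} (hf : PT flags) (hb : PT bits) :
    PT fun a => restrictBits (flags a) (bits a) :=
  hf.length.range.flatMap (f := fun a i => bif (flags a).getD i false then [(bits a).getD i false]
    else []) ((hf.comp_fst.getD PT.snd (PT.const false)).cond
    ((hb.comp_fst.getD PT.snd (PT.const false)).cons (PT.const [])) (PT.const []))

end

/-! ### The matrices of the gates with respect to the Pauli matrices -/

/-- The Pauli matrices. -/
def pauliInt (μ : Fin 4) (s t : Bool) : GaussianInt :=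
  match μ with
  | 0 => if s = t then 1 else 0
  | 1 => if s = t then 0 else 1
  | 2 => if s = t then 0 else if s then ⟨0, 1⟩ else ⟨0, -1⟩
  | 3 => if s = t then if s then -1 else 1 else 0

/-- Approximations to the real and imaginary parts of the entries of the matrix of a one-qubit
gate. -/
abbrev RawOne : Type := Bool → Bool → Bool → Bool → ℤ × ℤ

/-- Approximations to the real and imaginary parts of the entries of the matrix of a two-qubit
gate. -/
abbrev RawTwo : Type := Bool → Bool → Bool → Bool → RawOne

/-- The tensor of a two-qubit gate, in terms of the entries of its matrix. -/
def tensorTwo (τ : RawTwo) : Tensor := fun μ ν α β =>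
  ∑ i₁, ∑ i₂, ∑ j₁, ∑ j₂, ∑ k₁, ∑ k₂, ∑ l₁, ∑ l₂,
    -- The indices `l`, `k` are reversed because `tr (σ E) = ∑ σ l k * E k l`; only the real part of
    -- this trace is formed.
    let c := pauliInt μ l₁ k₁ * pauliInt ν l₂ k₂ * pauliInt α i₁ j₁ * pauliInt β i₂ j₂
    (c.re * (τ i₁ i₂ j₁ j₂ k₁ k₂ l₁ l₂).1 - c.im * (τ i₁ i₂ j₁ j₂ k₁ k₂ l₁ l₂).2)

/-- The tensor of a one-qubit gate on the first of two qubits, in terms of the entries of its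
matrix. -/
def tensorOne (τ : RawOne) : Tensor := fun μ ν α β =>
  -- The factor is `tr (σ_ν σ_β)`, the contribution of the untouched second qubit.
  (if ν = β then 2 else 0) * ∑ i, ∑ j, ∑ k, ∑ l,
    let c := pauliInt μ l k * pauliInt α i j
    (c.re * (τ i j k l).1 - c.im * (τ i j k l).2)

section
variable {α : Type} [Enc α]

theorem PT.tensorTwo {τ : α → RawTwo} (h : PT τ) : PT fun a => tensorTwo (τ a) := by
  refine PT.tuple fun μ => PT.tuple fun ν => PT.tuple fun x => PT.tuple fun y =>
    PT.bool_sum fun i₁ => PT.bool_sum fun i₂ => PT.bool_sum fun j₁ => PT.bool_sum fun j₂ =>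
    PT.bool_sum fun k₁ => PT.bool_sum fun k₂ => PT.bool_sum fun l₁ => PT.bool_sum fun l₂ => ?_
  have := (((((((h.bool_apply i₁).bool_apply i₂).bool_apply j₁).bool_apply j₂).bool_apply
    k₁).bool_apply k₂).bool_apply l₁).bool_apply l₂
  exact ((PT.const _).int_mul (PT.fst.comp this)).int_sub ((PT.const _).int_mul (PT.snd.comp this))

theorem PT.tensorOne {τ : α → RawOne} (h : PT τ) : PT fun a => tensorOne (τ a) := by
  refine PT.tuple fun μ => PT.tuple fun ν => PT.tuple fun x => PT.tuple fun y =>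
    (PT.const _).int_mul <|
    PT.bool_sum fun i => PT.bool_sum fun j => PT.bool_sum fun k => PT.bool_sum fun l => ?_
  have := (((h.bool_apply i).bool_apply j).bool_apply k).bool_apply l
  exact ((PT.const _).int_mul (PT.fst.comp this)).int_sub ((PT.const _).int_mul (PT.snd.comp this))

end

/-! ### The precision -/

/-- A power of two that is at least `n`. -/
def powAbove (n : ℕ) : ℕ := (fun m => if m < n then 2 * m else m)^[n] 1

theorem powAbove_spec (n : ℕ) : (∃ m, powAbove n = 2 ^ m) ∧ n ≤ powAbove n := by
  -- If the value is still below `n` after `k` steps, every step has doubled it. For `k = n` this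
  -- would give `2 ^ n < n`.
  have h : ∀ k, ∃ m, (fun m => if m < n then 2 * m else m)^[k] 1 = 2 ^ m ∧ (2 ^ m < n → m = k) := by
    intro k
    induction k with
    | zero => exact ⟨0, by simp⟩
    | succ k ih =>
      obtain ⟨m, hm, hk⟩ := ih
      rw [Function.iterate_succ_apply', hm]
      by_cases h : 2 ^ m < n
      · exact ⟨m + 1, by simp only [h, if_true]; ring, fun _ => by rw [hk h]⟩
      · exact ⟨m, by simp [h], fun h' => absurd h' h⟩
  obtain ⟨m, hm, hk⟩ := h n
  refine ⟨⟨m, hm⟩, ?_⟩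
  by_contra hlt
  rw [powAbove, hm] at hlt
  have := hk (by omega)
  subst this
  have := Nat.lt_two_pow_self (n := m)
  omega

theorem powAbove_pos (n : ℕ) : 0 < powAbove n := by
  obtain ⟨⟨m, hm⟩, -⟩ := powAbove_spec n
  rw [hm]; positivity

theorem PT.powAbove {α : Type} [Enc α] {n : α → ℕ} (hn : PT n) : PT fun a => powAbove (n a) := by
  refine hn.iterate (init := fun _ => 1) (step := fun a m => if m < n a then 2 * m else m)
    (PT.const 1) (PT.ite (PT.snd.nat_lt hn.comp_fst) ((PT.const 2).mul PT.snd) PT.snd)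
    (fun a => 2 * (2 * n a + 1) + 1) ?_ ?_
  · refine (((Poly.const sz 4).mul hn.size).add (Poly.const sz 4)).of_le fun a => ?_
    rw [sz_nat]; omega
  · intro a k _
    have h : ∀ k, (fun m => if m < n a then 2 * m else m)^[k] 1 ≤ 2 * n a + 1 := by
      intro k
      induction k with
      | zero => simp
      | succ k ih =>
        rw [Function.iterate_succ_apply']
        split_ifs <;> omega
    rw [sz_nat]
    have := h k
    omega

end SepSim
-- Trace-norm estimates for circuits and product states.
namespace SepSim
open Matrix
open scoped ComplexOrder

/-! ### Differences of positive matrices -/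

/-- The matrix is the difference of two positive matrices whose traces have sum at most `c`. -/
def TraceBound {n : Type} [Fintype n] (ρ : Matrix n n ℂ) (c : ℝ) : Prop :=
  ∃ P Q : Matrix n n ℂ, P.PosSemidef ∧ Q.PosSemidef ∧ ρ = P - Q ∧ P.trace.re + Q.trace.re ≤ c

section
variable {n : Type} [Fintype n] {ρ ρ' : Matrix n n ℂ} {c c' : ℝ}

theorem TraceBound.mono (h : TraceBound ρ c) (hc : c ≤ c') : TraceBound ρ c' := by
  obtain ⟨P, Q, hP, hQ, e, ht⟩ := h
  exact ⟨P, Q, hP, hQ, e, ht.trans hc⟩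

theorem TraceBound.congr (h : TraceBound ρ c) (e : ρ = ρ') : TraceBound ρ' c := e ▸ h

theorem TraceBound.zero : TraceBound (0 : Matrix n n ℂ) 0 :=
  ⟨0, 0, .zero, .zero, by simp, by simp⟩

theorem TraceBound.add (h : TraceBound ρ c) (h' : TraceBound ρ' c') :
    TraceBound (ρ + ρ') (c + c') := by
  obtain ⟨P, Q, hP, hQ, e, ht⟩ := h
  obtain ⟨P', Q', hP', hQ', e', ht'⟩ := h'
  refine ⟨P + P', Q + Q', hP.add hP', hQ.add hQ', by rw [e, e']; abel, ?_⟩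
  simp only [trace_add, Complex.add_re]; linarith

theorem TraceBound.smul (h : TraceBound ρ c) (r : ℝ) : TraceBound (r • ρ) (|r| * c) := by
  obtain ⟨P, Q, hP, hQ, e, ht⟩ := h
  have key : ∀ {X : Matrix n n ℂ}, X.PosSemidef → ∀ {r : ℝ}, 0 ≤ r → (r • X).PosSemidef :=
    fun hX r hr => hX.smul hr
  have htr : ∀ (X : Matrix n n ℂ) (r : ℝ), (r • X).trace.re = r * X.trace.re := fun X r => by
    rw [trace_smul, Complex.smul_re, smul_eq_mul]
  rcases le_total 0 r with hr | hr
  · refine ⟨r • P, r • Q, key hP hr, key hQ hr, by rw [e, smul_sub], ?_⟩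
    rw [htr, htr, abs_of_nonneg hr, ← mul_add]
    exact mul_le_mul_of_nonneg_left ht hr
  · have hr' : 0 ≤ -r := by linarith
    refine ⟨(-r) • Q, (-r) • P, key hQ hr', key hP hr', ?_, ?_⟩
    · rw [e, smul_sub, neg_smul, neg_smul]; abel
    · rw [htr, htr, abs_of_nonpos hr, ← mul_add, add_comm]
      exact mul_le_mul_of_nonneg_left ht hr'

theorem TraceBound.sum {ι : Type} (s : Finset ι) {f : ι → Matrix n n ℂ} {c : ι → ℝ}
    (h : ∀ i ∈ s, TraceBound (f i) (c i)) : TraceBound (∑ i ∈ s, f i) (∑ i ∈ s, c i) := by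
  classical
  induction s using Finset.induction_on with
  | empty => simpa using TraceBound.zero
  | insert i s hi ih =>
    rw [Finset.sum_insert hi, Finset.sum_insert hi]
    exact (h i (by simp)).add (ih fun j hj => h j (by simp [hj]))

theorem re_diag_nonneg {n : Type} {P : Matrix n n ℂ} (hP : P.PosSemidef) (i : n) :
    0 ≤ (P i i).re := (Complex.le_def.1 (hP.diag_nonneg (i := i))).1

/-- Measuring and then discarding information does not increase the distance: diagonal entries of
positive matrices are nonnegative, so grouping them by `f` costs at most the two traces. -/
theorem TraceBound.sum_abs_le {Y : Type} [Fintype Y] [DecidableEq Y] (h : TraceBound ρ c)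
    (f : n → Y) : ∑ y, |∑ z, if f z = y then (ρ z z).re else 0| ≤ c := by
  obtain ⟨P, Q, hP, hQ, e, ht⟩ := h
  calc ∑ y, |∑ z, if f z = y then (ρ z z).re else 0|
      ≤ ∑ y, ∑ z, if f z = y then (P z z).re + (Q z z).re else 0 := by
        refine Finset.sum_le_sum fun y _ => (Finset.abs_sum_le_sum_abs _ _).trans
          (Finset.sum_le_sum fun z _ => ?_)
        split_ifs
        · have h1 := re_diag_nonneg hP z
          have h2 := re_diag_nonneg hQ z
          rw [e, Matrix.sub_apply, Complex.sub_re, abs_le]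
          constructor <;> linarith
        · simp
    _ = P.trace.re + Q.trace.re := by
        rw [Finset.sum_comm]
        simp [trace, Finset.sum_add_distrib]
    _ ≤ c := ht

end

/-! ### Gates acting on a part of the system -/

/-- A gate applied to the part of a system that `get` reads and `upd` replaces. -/
def applyLens {n Z : Type} [Fintype n] [DecidableEq n] (E : Gate n) (get : Z → n) (upd : Z → n → Z)
    (ρ : Matrix Z Z ℂ) : Matrix Z Z ℂ :=
  fun z w => E.map (Matrix.of fun s t => ρ (upd z s) (upd w t)) (get z) (get w)

section
variable {n Z : Type} [Fintype n] [DecidableEq n] (E : Gate n)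
  {get : Z → n} {upd : Z → n → Z}

/-- Complete positivity. Each Kraus operator `K j` lifts to a rectangular matrix `L j` which
conjugates the pullback of `ρ` along `(z, s) ↦ upd z s`, and pullbacks and conjugates of positive
matrices are positive. -/
theorem applyLens_posSemidef [Fintype Z] [DecidableEq Z] {ρ : Matrix Z Z ℂ} (hρ : ρ.PosSemidef) :
    (applyLens E get upd ρ).PosSemidef := by
  obtain ⟨r, K, hK⟩ := E.operator_sum
  let φ : Z × n → Z := fun p => upd p.1 p.2
  let L : Fin r → Matrix Z (Z × n) ℂ := fun j =>
    Matrix.of fun z p => if p.1 = z then K j (get z) p.2 else 0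
  have h : applyLens E get upd ρ = ∑ j, L j * ρ.submatrix φ φ * (L j).conjTranspose := by
    ext z w
    rw [Matrix.sum_apply]
    simp only [applyLens, hK, Matrix.sum_apply]
    refine Finset.sum_congr rfl fun j _ => ?_
    simp only [Matrix.mul_apply, conjTranspose_apply, Fintype.sum_prod_type, L, of_apply,
      submatrix_apply, φ]
    simp only [ite_mul, zero_mul, Finset.sum_ite_irrel, Finset.sum_const_zero, Finset.sum_ite_eq',
      Finset.mem_univ, if_true, apply_ite star, star_zero, mul_ite, mul_zero]
  rw [h]
  exact posSemidef_sum _ fun j _ => (hρ.submatrix φ).mul_mul_conjTranspose_same (L j)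

/-- The map `(z, s) ↦ (upd z s, get z)` is an involution of `Z × n`. -/
theorem sum_lens {n Z : Type} [Fintype n] [Fintype Z] {get : Z → n} {upd : Z → n → Z}
    (h1 : ∀ z s, get (upd z s) = s) (h2 : ∀ z, upd z (get z) = z)
    (h3 : ∀ z s t, upd (upd z s) t = upd z t) (g : Z → ℂ) :
    ∑ z, ∑ s, g (upd z s) = Fintype.card n * ∑ z, g z := by
  have e : ∑ p : Z × n, g (upd p.1 p.2) = ∑ p : Z × n, g p.1 :=
    Finset.sum_nbij' (fun p => (upd p.1 p.2, get p.1)) (fun p => (upd p.1 p.2, get p.1))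
      (by simp) (by simp) (by simp [h1, h2, h3]) (by simp [h1, h2, h3]) (by simp)
  rw [Fintype.sum_prod_type, Fintype.sum_prod_type] at e
  rw [e]
  simp [Finset.mul_sum]

/-- By `sum_lens` both traces, multiplied by the cardinality of `n`, are sums over diagonal blocks,
and on each block the gate preserves the trace. -/
theorem applyLens_trace [Nonempty n] [Fintype Z] (h1 : ∀ z s, get (upd z s) = s) (h2 : ∀ z, upd z (get z) = z)
    (h3 : ∀ z s t, upd (upd z s) t = upd z t) (ρ : Matrix Z Z ℂ) :
    (applyLens E get upd ρ).trace = ρ.trace := by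
  have hc : (Fintype.card n : ℂ) ≠ 0 := by simp
  refine mul_left_cancel₀ hc ?_
  simp only [trace, diag_apply]
  rw [← sum_lens h1 h2 h3, ← sum_lens h1 h2 h3]
  refine Finset.sum_congr rfl fun z _ => ?_
  have := E.trace_preserving (Matrix.of fun s t => ρ (upd z s) (upd z t))
  simp only [trace, diag_apply, of_apply] at this
  rw [← this]
  refine Finset.sum_congr rfl fun s _ => ?_
  simp only [applyLens, h1, h3]

theorem applyLens_add (ρ ρ' : Matrix Z Z ℂ) :
    applyLens E get upd (ρ + ρ') = applyLens E get upd ρ + applyLens E get upd ρ' := by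
  ext z w
  have : (Matrix.of fun s t => (ρ + ρ') (upd z s) (upd w t)) =
    (Matrix.of fun s t => ρ (upd z s) (upd w t)) + Matrix.of fun s t => ρ' (upd z s) (upd w t) := rfl
  rw [Matrix.add_apply]
  simp only [applyLens]
  rw [this, map_add, Matrix.add_apply]

theorem applyLens_smul (c : ℂ) (ρ : Matrix Z Z ℂ) :
    applyLens E get upd (c • ρ) = c • applyLens E get upd ρ := by
  ext z w
  have : (Matrix.of fun s t => (c • ρ) (upd z s) (upd w t)) =
    c • (Matrix.of fun s t => ρ (upd z s) (upd w t)) := rfl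
  rw [Matrix.smul_apply]
  simp only [applyLens]
  rw [this, map_smul, Matrix.smul_apply]

end

section
variable {𝒢 : GateSet} {q : ℕ}

/-- Allows one- and two-qubit operations to be treated alike. Distinctness of the qubits `i` and `j`
is what makes the pair of coordinates a lens. -/
theorem Op.apply_eq (o : Op 𝒢 q) : ∃ (n : Type) (_ : Fintype n) (_ : DecidableEq n) (_ : Nonempty n)
    (E : Gate n) (get : (Fin q → Bool) → n) (upd : (Fin q → Bool) → n → Fin q → Bool),
    (∀ z s, get (upd z s) = s) ∧ (∀ z, upd z (get z) = z) ∧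
    (∀ z s t, upd (upd z s) t = upd z t) ∧ ∀ ρ, o.apply ρ = applyLens E get upd ρ := by
  cases o with
  | one g i =>
    exact ⟨Bool, inferInstance, inferInstance, inferInstance, 𝒢.one g, fun z => z i,
      fun z s => Function.update z i s, by simp, by simp, by simp, fun ρ => rfl⟩
  | two g i j hij =>
    refine ⟨Bool × Bool, inferInstance, inferInstance, inferInstance, 𝒢.two g, fun z => (z i, z j),
      fun z s => Function.update (Function.update z i s.1) j s.2, ?_, by simp, ?_, fun ρ => rfl⟩
    · intro z s
      simp [Function.update_of_ne hij]
    · intro z s t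
      dsimp only
      rw [Function.update_comm hij, Function.update_idem, Function.update_comm hij,
        Function.update_idem, Function.update_comm hij]

theorem Op.apply_add (o : Op 𝒢 q) (ρ ρ' : QMatrix q) : o.apply (ρ + ρ') = o.apply ρ + o.apply ρ' := by
  obtain ⟨n, _, _, _, E, get, upd, -, -, -, h⟩ := o.apply_eq
  rw [h, h, h, applyLens_add]

theorem Op.apply_smul (o : Op 𝒢 q) (c : ℂ) (ρ : QMatrix q) : o.apply (c • ρ) = c • o.apply ρ := by
  obtain ⟨n, _, _, _, E, get, upd, -, -, -, h⟩ := o.apply_eq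
  rw [h, h, applyLens_smul]

theorem Op.apply_sub (o : Op 𝒢 q) (ρ ρ' : QMatrix q) : o.apply (ρ - ρ') = o.apply ρ - o.apply ρ' := by
  have := o.apply_smul (-1) ρ'
  rw [sub_eq_add_neg, ← neg_one_smul ℂ ρ', o.apply_add, this, neg_one_smul, sub_eq_add_neg]

/-- The contraction property: positivity and trace are preserved on both parts of the difference. -/
theorem TraceBound.apply {ρ : QMatrix q} {c : ℝ} (h : TraceBound ρ c) (o : Op 𝒢 q) :
    TraceBound (o.apply ρ) c := by
  obtain ⟨P, Q, hP, hQ, e, ht⟩ := h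
  refine ⟨o.apply P, o.apply Q, ?_, ?_, by rw [e, o.apply_sub], ?_⟩
  · obtain ⟨n, _, _, _, E, get, upd, h1, h2, h3, h⟩ := o.apply_eq
    rw [h]; exact applyLens_posSemidef E hP
  · obtain ⟨n, _, _, _, E, get, upd, h1, h2, h3, h⟩ := o.apply_eq
    rw [h]; exact applyLens_posSemidef E hQ
  · obtain ⟨n, _, _, _, E, get, upd, h1, h2, h3, h⟩ := o.apply_eq
    rw [h, h, applyLens_trace E h1 h2 h3, applyLens_trace E h1 h2 h3]
    exact ht

/-! ### Product states -/

/-- The tensor product of one-qubit matrices. -/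
def prodState (B : Fin q → Matrix Bool Bool ℂ) : QMatrix q := fun z w => ∏ i, B i (z i) (w i)

/-- Entrywise, a tensor product is the Hadamard product of the pullbacks of its factors, so the
Schur product theorem applies. The empty product is the all-ones matrix, which has rank one. -/
theorem prodState_posSemidef {B : Fin q → Matrix Bool Bool ℂ} (hB : ∀ i, (B i).PosSemidef) :
    (prodState B).PosSemidef := by
  have : ∀ s : Finset (Fin q), (Matrix.of fun z w : Fin q → Bool =>
      ∏ i ∈ s, B i (z i) (w i)).PosSemidef := by
    intro s
    induction s using Finset.induction_on with
    | empty =>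
      have := posSemidef_vecMulVec_self_star (R := ℂ) (fun _ : Fin q → Bool => (1 : ℂ))
      convert this using 1
      ext z w; simp [vecMulVec]
    | insert i s hi ih =>
      have h : (Matrix.of fun z w : Fin q → Bool => ∏ k ∈ insert i s, B k (z k) (w k)) =
          (B i).submatrix (fun z : Fin q → Bool => z i) (fun z => z i) ⊙
            Matrix.of fun z w : Fin q → Bool => ∏ k ∈ s, B k (z k) (w k) := by
        ext z w; simp [Finset.prod_insert hi]
      rw [h]
      exact ((hB i).submatrix fun z : Fin q → Bool => z i).hadamard ih
  exact this Finset.univ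

theorem prodState_trace (B : Fin q → Matrix Bool Bool ℂ) :
    (prodState B).trace = ∏ i, (B i).trace := by
  simp only [trace, diag_apply, prodState]
  rw [Finset.prod_univ_sum, Fintype.piFinset_univ]

theorem prodState_update (B : Fin q → Matrix Bool Bool ℂ) (i : Fin q) (X : Matrix Bool Bool ℂ)
    (z w : Fin q → Bool) : prodState (Function.update B i X) z w =
      X (z i) (w i) * ∏ k ∈ Finset.univ.erase i, B k (z k) (w k) := by
  rw [prodState, ← Finset.mul_prod_erase _ _ (Finset.mem_univ i), Function.update_self]
  congr 1
  refine Finset.prod_congr rfl fun k hk => ?_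
  rw [Function.update_of_ne (Finset.ne_of_mem_erase hk)]

theorem prodState_update₂ (B : Fin q → Matrix Bool Bool ℂ) {i j : Fin q} (hij : i ≠ j)
    (X Y : Matrix Bool Bool ℂ) (z w : Fin q → Bool) :
    prodState (Function.update (Function.update B i X) j Y) z w =
      X (z i) (w i) * Y (z j) (w j) *
        ∏ k ∈ (Finset.univ.erase i).erase j, B k (z k) (w k) := by
  rw [prodState, ← Finset.mul_prod_erase _ _ (Finset.mem_univ i),
    ← Finset.mul_prod_erase _ _ (Finset.mem_erase.2 ⟨hij.symm, Finset.mem_univ j⟩),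
    Function.update_of_ne hij, Function.update_self, Function.update_self, ← mul_assoc]
  congr 1
  refine Finset.prod_congr rfl fun k hk => ?_
  rw [Finset.mem_erase, Finset.mem_erase] at hk
  rw [Function.update_of_ne hk.1, Function.update_of_ne hk.2.1]

theorem applyOne_prodState (E : Gate Bool) (i : Fin q) (B : Fin q → Matrix Bool Bool ℂ) :
    applyOne E i (prodState B) = prodState (Function.update B i (E.map (B i))) := by
  ext z w
  have : (Matrix.of fun s t => prodState B (Function.update z i s) (Function.update w i t)) =
      (∏ k ∈ Finset.univ.erase i, B k (z k) (w k)) • B i := by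
    ext s t
    rw [of_apply, Matrix.smul_apply, smul_eq_mul, prodState,
      ← Finset.mul_prod_erase _ _ (Finset.mem_univ i), mul_comm]
    congr 1
    · refine Finset.prod_congr rfl fun k hk => ?_
      rw [Function.update_of_ne (Finset.ne_of_mem_erase hk),
        Function.update_of_ne (Finset.ne_of_mem_erase hk)]
    · simp
  rw [applyOne, this, map_smul, Matrix.smul_apply, prodState_update, smul_eq_mul, mul_comm]

/-- On the block of the qubits `i`, `j` a product state is `B i ⊗ B j` times the entries of the
other factors, so by linearity it suffices to expand the image of that product. -/
theorem applyTwo_prodState (E : Gate (Bool × Bool)) {i j : Fin q} (hij : i ≠ j)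
    (B : Fin q → Matrix Bool Bool ℂ) {ι : Type} [Fintype ι] (c : ι → ℂ)
    (X Y : ι → Matrix Bool Bool ℂ) (h : E.map (B i ⊗ₖ B j) = ∑ k, c k • (X k ⊗ₖ Y k)) :
    applyTwo E i j (prodState B) =
      ∑ k, c k • prodState (Function.update (Function.update B i (X k)) j (Y k)) := by
  ext z w
  have : (Matrix.of fun s t : Bool × Bool =>
        prodState B (Function.update (Function.update z i s.1) j s.2)
          (Function.update (Function.update w i t.1) j t.2)) =
      (∏ k ∈ (Finset.univ.erase i).erase j, B k (z k) (w k)) • (B i ⊗ₖ B j) := by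
    ext s t
    rw [of_apply, Matrix.smul_apply, smul_eq_mul, prodState,
      ← Finset.mul_prod_erase _ _ (Finset.mem_univ i),
      ← Finset.mul_prod_erase _ _ (Finset.mem_erase.2 ⟨hij.symm, Finset.mem_univ j⟩), ← mul_assoc,
      mul_comm]
    congr 1
    · refine Finset.prod_congr rfl fun k hk => ?_
      rw [Finset.mem_erase, Finset.mem_erase] at hk
      rw [Function.update_of_ne hk.1, Function.update_of_ne hk.1, Function.update_of_ne hk.2.1,
        Function.update_of_ne hk.2.1]
    · simp [Function.update_of_ne hij, kroneckerMap_apply]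
  rw [applyTwo, this, map_smul, Matrix.smul_apply, h, Matrix.sum_apply, Matrix.sum_apply, smul_eq_mul,
    Finset.mul_sum]
  refine Finset.sum_congr rfl fun k _ => ?_
  rw [Matrix.smul_apply, Matrix.smul_apply, smul_eq_mul, smul_eq_mul, prodState_update₂ B hij,
    kroneckerMap_apply]
  ring

/-- Splitting `X` into its positive and negative part splits the product; the other factors are
positive of trace 1 and do not change the traces. -/
theorem TraceBound.prodState_update {B : Fin q → Matrix Bool Bool ℂ} (hB : ∀ i, (B i).PosSemidef)
    (ht : ∀ i, (B i).trace = 1) (i : Fin q) {X : Matrix Bool Bool ℂ} {c : ℝ} (hX : TraceBound X c) :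
    TraceBound (prodState (Function.update B i X)) c := by
  obtain ⟨P, Q, hP, hQ, e, hc⟩ := hX
  have hp : ∀ {P : Matrix Bool Bool ℂ}, P.PosSemidef →
      (prodState (Function.update B i P)).PosSemidef := fun hP => prodState_posSemidef fun k => by
    by_cases h : k = i
    · subst h; simpa using hP
    · rw [Function.update_of_ne h]; exact hB k
  have htr : ∀ P : Matrix Bool Bool ℂ, (prodState (Function.update B i P)).trace = P.trace := by
    intro P
    rw [prodState_trace, ← Finset.mul_prod_erase _ _ (Finset.mem_univ i), Function.update_self,
      Finset.prod_eq_one, mul_one]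
    intro k hk
    rw [Function.update_of_ne (Finset.ne_of_mem_erase hk), ht]
  refine ⟨_, _, hp hP, hp hQ, ?_, by rw [htr, htr]; exact hc⟩
  ext z w
  simp only [Matrix.sub_apply, SepSim.prodState_update, e]
  ring

/-- `(P - Q) ⊗ (P' - Q') = (P ⊗ P' + Q ⊗ Q') - (P ⊗ Q' + Q ⊗ P')`, and the four traces sum to the
product of the two trace sums. -/
theorem TraceBound.prodState_update₂ {B : Fin q → Matrix Bool Bool ℂ}
    (hB : ∀ i, (B i).PosSemidef) (ht : ∀ i, (B i).trace = 1) {i j : Fin q} (hij : i ≠ j)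
    {X Y : Matrix Bool Bool ℂ} {c c' : ℝ} (hX : TraceBound X c) (hY : TraceBound Y c') :
    TraceBound (prodState (Function.update (Function.update B i X) j Y)) (c * c') := by
  obtain ⟨P, Q, hP, hQ, e, hc⟩ := hX
  obtain ⟨P', Q', hP', hQ', e', hc'⟩ := hY
  have hp : ∀ {P P' : Matrix Bool Bool ℂ}, P.PosSemidef → P'.PosSemidef →
      (prodState (Function.update (Function.update B i P) j P')).PosSemidef :=
    fun {P P'} hP hP' => prodState_posSemidef fun k => by
      by_cases h : k = j
      · subst h; simpa using hP'
      · rw [Function.update_of_ne h]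
        by_cases h : k = i
        · subst h; simpa using hP
        · rw [Function.update_of_ne h]; exact hB k
  have htr : ∀ P P' : Matrix Bool Bool ℂ, P.PosSemidef → P'.PosSemidef →
      (prodState (Function.update (Function.update B i P) j P')).trace.re =
        P.trace.re * P'.trace.re := by
    intro P P' hP hP'
    rw [prodState_trace, ← Finset.mul_prod_erase _ _ (Finset.mem_univ i),
      ← Finset.mul_prod_erase _ _ (Finset.mem_erase.2 ⟨hij.symm, Finset.mem_univ j⟩),
      Function.update_of_ne hij, Function.update_self, Function.update_self, Finset.prod_eq_one,
      mul_one, Complex.mul_re]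
    · have := (Complex.le_def.1 hP.trace_nonneg).2
      rw [← this]; simp
    · intro k hk
      rw [Finset.mem_erase, Finset.mem_erase] at hk
      rw [Function.update_of_ne hk.1, Function.update_of_ne hk.2.1, ht]
  have hn : ∀ {P : Matrix Bool Bool ℂ}, P.PosSemidef → 0 ≤ P.trace.re := fun hP =>
    (Complex.le_def.1 hP.trace_nonneg).1
  refine ⟨_, _, (hp hP hP').add (hp hQ hQ'), (hp hP hQ').add (hp hQ hP'), ?_, ?_⟩
  · ext z w
    simp only [Matrix.sub_apply, Matrix.add_apply, SepSim.prodState_update₂ B hij, e, e']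
    ring
  · rw [trace_add, trace_add, Complex.add_re, Complex.add_re, htr _ _ hP hP', htr _ _ hQ hQ',
      htr _ _ hP hQ', htr _ _ hQ hP']
    calc _ = (P.trace.re + Q.trace.re) * (P'.trace.re + Q'.trace.re) := by ring
      _ ≤ c * c' := mul_le_mul hc hc' (add_nonneg (hn hP') (hn hQ'))
          ((add_nonneg (hn hP) (hn hQ)).trans hc)

end

end SepSim
namespace SepSim
open Matrix
open scoped ComplexOrder

/-! ### Pauli matrices -/

/-- The Pauli matrices as complex matrices. -/
noncomputable def pauli (μ : Fin 4) : Matrix Bool Bool ℂ :=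
  Matrix.of fun s t => GaussianInt.toComplex (pauliInt μ s t)

/-- The one-qubit matrix with given Bloch coordinates. -/
noncomputable def qubitMat (v : Fin 4 → ℝ) : Matrix Bool Bool ℂ :=
  ∑ μ, ((v μ / 2 : ℝ) : ℂ) • pauli μ

/-- The Bloch coordinates of a one-qubit matrix. -/
noncomputable def coord (X : Matrix Bool Bool ℂ) (μ : Fin 4) : ℝ := (pauli μ * X).trace.re

/-- The cone of the Bloch coordinates of positive matrices. -/
def Cone (v : Fin 4 → ℝ) : Prop := 0 ≤ v 0 ∧ v 1 ^ 2 + v 2 ^ 2 + v 3 ^ 2 ≤ v 0 ^ 2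

theorem qubitMat_apply (v : Fin 4 → ℝ) :
    qubitMat v false false = ((v 0 + v 3) / 2 : ℝ) ∧ qubitMat v true true = ((v 0 - v 3) / 2 : ℝ) ∧
    qubitMat v false true = ⟨v 1 / 2, -(v 2 / 2)⟩ ∧ qubitMat v true false = ⟨v 1 / 2, v 2 / 2⟩ := by
  simp only [qubitMat, Fin.sum_univ_four, Matrix.add_apply, Matrix.smul_apply, pauli, pauliInt,
    of_apply, smul_eq_mul]
  refine ⟨?_, ?_, ?_, ?_⟩ <;> apply Complex.ext <;>
    simp [GaussianInt.toComplex_def] <;> ring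

theorem coord_eq (X : Matrix Bool Bool ℂ) :
    coord X 0 = (X false false).re + (X true true).re ∧
    coord X 1 = (X true false).re + (X false true).re ∧
    coord X 2 = (X true false).im - (X false true).im ∧
    coord X 3 = (X false false).re - (X true true).re := by
  simp only [coord, trace, diag_apply, Matrix.mul_apply, Fintype.sum_bool, pauli, pauliInt, of_apply]
  refine ⟨?_, ?_, ?_, ?_⟩ <;> simp [GaussianInt.toComplex_def] <;> ring

theorem qubitMat_isHermitian (v : Fin 4 → ℝ) : (qubitMat v).IsHermitian := by
  obtain ⟨h1, h2, h3, h4⟩ := qubitMat_apply v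
  ext s t
  rw [conjTranspose_apply]
  cases s <;> cases t <;> simp only [h1, h2, h3, h4] <;> apply Complex.ext <;> simp

/-- The quadratic form at `x` is half of `v 0 * |x|²` plus the inner product of `(v 1, v 2, v 3)`
with a vector of length `|x|²`. Cauchy–Schwarz finishes the argument. -/
theorem Cone.posSemidef {v : Fin 4 → ℝ} (hv : Cone v) : (qubitMat v).PosSemidef := by
  obtain ⟨h1, h2, h3, h4⟩ := qubitMat_apply v
  refine .of_dotProduct_mulVec_nonneg (qubitMat_isHermitian v) fun x => ?_
  rw [Complex.le_def]
  have him : (star x ⬝ᵥ qubitMat v *ᵥ x).im = 0 := by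
    simp only [dotProduct, mulVec, Fintype.sum_bool, h1, h2, h3, h4, Pi.star_apply]
    simp
    ring
  refine ⟨?_, him.symm⟩
  obtain ⟨h0, hc⟩ := hv
  set a := (x false).re
  set b := (x false).im
  set c := (x true).re
  set d := (x true).im
  have key : |v 1 * (2 * (a * c + b * d)) + v 2 * (2 * (a * d - b * c)) +
      v 3 * (a ^ 2 + b ^ 2 - c ^ 2 - d ^ 2)| ≤ v 0 * (a ^ 2 + b ^ 2 + c ^ 2 + d ^ 2) := by
    refine abs_le_of_sq_le_sq ?_ (by positivity)
    set p := 2 * (a * c + b * d) with hp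
    set q := 2 * (a * d - b * c) with hq
    set r := a ^ 2 + b ^ 2 - c ^ 2 - d ^ 2 with hr
    have e : (a ^ 2 + b ^ 2 + c ^ 2 + d ^ 2) ^ 2 = p ^ 2 + q ^ 2 + r ^ 2 := by
      rw [hp, hq, hr]; ring
    rw [mul_pow, e]
    calc (v 1 * p + v 2 * q + v 3 * r) ^ 2
        ≤ (v 1 ^ 2 + v 2 ^ 2 + v 3 ^ 2) * (p ^ 2 + q ^ 2 + r ^ 2) := by
          nlinarith [sq_nonneg (v 1 * q - v 2 * p), sq_nonneg (v 1 * r - v 3 * p),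
            sq_nonneg (v 2 * r - v 3 * q)]
      _ ≤ _ := mul_le_mul_of_nonneg_right hc (by positivity)
  have h5 := (abs_le.1 key).1
  have : (star x ⬝ᵥ qubitMat v *ᵥ x).re = (v 0 * (a ^ 2 + b ^ 2 + c ^ 2 + d ^ 2) +
      (v 1 * (2 * (a * c + b * d)) + v 2 * (2 * (a * d - b * c)) +
      v 3 * (a ^ 2 + b ^ 2 - c ^ 2 - d ^ 2))) / 2 := by
    simp only [dotProduct, mulVec, Fintype.sum_bool, h1, h2, h3, h4, Pi.star_apply]
    simp
    ring
  rw [this]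
  simp only [Complex.zero_re]
  linarith

theorem qubitMat_coord {X : Matrix Bool Bool ℂ} (hX : X.IsHermitian) : qubitMat (coord X) = X := by
  obtain ⟨h1, h2, h3, h4⟩ := qubitMat_apply (coord X)
  obtain ⟨c0, c1, c2, c3⟩ := coord_eq X
  have hs : ∀ s t, star (X t s) = X s t := fun s t => by
    rw [← conjTranspose_apply, hX.eq]
  have e1 := hs false false
  have e2 := hs true true
  have e3 := hs false true
  rw [Complex.ext_iff] at e1 e2 e3
  simp at e1 e2 e3
  ext s t
  cases s <;> cases t
  · rw [h1, c0, c3]; apply Complex.ext <;> simp; linarith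
  · rw [h3, c1, c2]; apply Complex.ext <;> simp <;> linarith
  · rw [h4, c1, c2]; apply Complex.ext <;> simp <;> linarith
  · rw [h2, c0, c3]; apply Complex.ext <;> simp; linarith

/-- The cone condition says that the diagonal and the determinant are nonnegative: `4 det X = v 0 ²
- v 1 ² - v 2 ² - v 3 ²`. -/
theorem cone_coord {X : Matrix Bool Bool ℂ} (hX : X.PosSemidef) : Cone (coord X) := by
  obtain ⟨c0, c1, c2, c3⟩ := coord_eq X
  have h1 := re_diag_nonneg hX false
  have h2 := re_diag_nonneg hX true
  have hd : 0 ≤ X.det := hX.det_nonneg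
  have hs : ∀ s t, star (X t s) = X s t := fun s t => by
    rw [← conjTranspose_apply, hX.isHermitian.eq]
  have e1 := hs false false
  have e2 := hs true true
  have e3 := hs false true
  rw [Complex.ext_iff] at e1 e2 e3
  simp at e1 e2 e3
  have hdet : X.det = X true true * X false false - X true false * X false true := by
    have := Matrix.det_reindex_self (finTwoEquiv.symm) X
    rw [← this, Matrix.det_fin_two]
    simp [finTwoEquiv]
    ring
  rw [hdet, Complex.le_def] at hd
  have hd1 := hd.1
  simp only [Complex.sub_re, Complex.mul_re, Complex.zero_re] at hd1
  refine ⟨by rw [c0]; linarith, ?_⟩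
  rw [c0, c1, c2, c3]
  rw [← e3.1] at hd1 ⊢
  rw [← e3.2] at hd1 ⊢
  have : (X true true).im = 0 := by linarith
  rw [this] at hd1
  nlinarith

theorem trace_qubitMat (v : Fin 4 → ℝ) : (qubitMat v).trace = v 0 := by
  obtain ⟨h1, h2, -, -⟩ := qubitMat_apply v
  rw [trace, Fintype.sum_bool, diag_apply, diag_apply, h1, h2, ← Complex.ofReal_add]
  congr 1; ring

theorem coord_qubitMat (v : Fin 4 → ℝ) : coord (qubitMat v) = v := by
  obtain ⟨h1, h2, h3, h4⟩ := qubitMat_apply v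
  obtain ⟨c0, c1, c2, c3⟩ := coord_eq (qubitMat v)
  ext μ
  fin_cases μ
  · refine c0.trans ?_
    rw [h1, h2]; simp; ring
  · refine c1.trans ?_
    rw [h3, h4]; simp
  · refine c2.trans ?_
    rw [h3, h4]; simp
  · refine c3.trans ?_
    rw [h1, h2]; simp; ring

/-- The identity is itself positive of trace 2; each other Pauli matrix is the difference of its two
eigenprojections, which are the qubit states at opposite points of the Bloch sphere. -/
theorem traceBound_pauli (μ : Fin 4) : TraceBound (pauli μ) 2 := by
  have key : ∀ v w : Fin 4 → ℝ, Cone v → Cone w → v 0 + w 0 = 2 →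
      pauli μ = qubitMat v - qubitMat w → TraceBound (pauli μ) 2 := fun v w hv hw h e =>
    ⟨_, _, hv.posSemidef, hw.posSemidef, e, by rw [trace_qubitMat, trace_qubitMat]; simp [h]⟩
  have hq : ∀ v w, pauli μ = qubitMat v - qubitMat w ↔
      pauli μ = ∑ ν, (((v ν - w ν) / 2 : ℝ) : ℂ) • pauli ν := fun v w => by
    rw [qubitMat, qubitMat, ← Finset.sum_sub_distrib]
    simp only [← sub_smul, sub_div, Complex.ofReal_sub]
  fin_cases μ
  · refine key ![2, 0, 0, 0] ![0, 0, 0, 0] ?_ ?_ (by norm_num) ((hq _ _).2 ?_)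
    · simp [Cone]
    · simp [Cone]
    · rw [Fin.sum_univ_four]
      show pauli 0 = (((2 - 0) / 2 : ℝ) : ℂ) • pauli 0 +
        (((0 - 0) / 2 : ℝ) : ℂ) • pauli 1 +
        (((0 - 0) / 2 : ℝ) : ℂ) • pauli 2 +
        (((0 - 0) / 2 : ℝ) : ℂ) • pauli 3
      norm_num
  · refine key ![1, 1, 0, 0] ![1, -1, 0, 0] ?_ ?_ (by norm_num) ((hq _ _).2 ?_)
    · simp [Cone]
    · simp [Cone]
    · rw [Fin.sum_univ_four]
      show pauli 1 = (((1 - 1) / 2 : ℝ) : ℂ) • pauli 0 +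
        (((1 - -1) / 2 : ℝ) : ℂ) • pauli 1 +
        (((0 - 0) / 2 : ℝ) : ℂ) • pauli 2 +
        (((0 - 0) / 2 : ℝ) : ℂ) • pauli 3
      norm_num
  · refine key ![1, 0, 1, 0] ![1, 0, -1, 0] ?_ ?_ (by norm_num) ((hq _ _).2 ?_)
    · simp [Cone]
    · simp [Cone]
    · rw [Fin.sum_univ_four]
      show pauli 2 = (((1 - 1) / 2 : ℝ) : ℂ) • pauli 0 +
        (((0 - 0) / 2 : ℝ) : ℂ) • pauli 1 +
        (((1 - -1) / 2 : ℝ) : ℂ) • pauli 2 +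
        (((0 - 0) / 2 : ℝ) : ℂ) • pauli 3
      norm_num
  · refine key ![1, 0, 0, 1] ![1, 0, 0, -1] ?_ ?_ (by norm_num) ((hq _ _).2 ?_)
    · simp [Cone]
    · simp [Cone]
    · rw [Fin.sum_univ_four]
      show pauli 3 = (((1 - 1) / 2 : ℝ) : ℂ) • pauli 0 +
        (((0 - 0) / 2 : ℝ) : ℂ) • pauli 1 +
        (((0 - 0) / 2 : ℝ) : ℂ) • pauli 2 +
        (((1 - -1) / 2 : ℝ) : ℂ) • pauli 3
      norm_num

/-! ### The real tensors of gates -/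

/-- The tensor maps products of states to mixtures of products of states. -/
def SepTensor (R : Fin 4 → Fin 4 → Fin 4 → Fin 4 → ℝ) : Prop :=
  ∀ v w : Fin 4 → ℝ, Cone v → Cone w → v 0 = 1 → w 0 = 1 →
    ∃ (r : ℕ) (x y : Fin r → Fin 4 → ℝ), (∀ j, Cone (x j)) ∧ (∀ j, Cone (y j)) ∧
      ∑ j, x j 0 * y j 0 = 1 ∧
      ∀ μ ν, (∑ α, ∑ β, R μ ν α β * v α * w β) / 4 = ∑ j, x j μ * y j ν

/-- The matrix of a two-qubit gate with respect to the products of Pauli matrices. -/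
noncomputable def Gate.realTwo (E : Gate (Bool × Bool)) (μ ν α β : Fin 4) : ℝ :=
  ((pauli μ ⊗ₖ pauli ν) * E.map (pauli α ⊗ₖ pauli β)).trace.re

/-- The matrix of a one-qubit gate, acting on the first of two qubits, with respect to the products
of Pauli matrices. -/
noncomputable def Gate.realOne (E : Gate Bool) (μ ν α β : Fin 4) : ℝ :=
  (if ν = β then 2 else 0) * (pauli μ * E.map (pauli α)).trace.re

theorem Gate.posSemidef {n : Type} [Fintype n] [DecidableEq n] (E : Gate n) {X : Matrix n n ℂ}
    (hX : X.PosSemidef) : (E.map X).PosSemidef := by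
  obtain ⟨r, K, hK⟩ := E.operator_sum
  rw [hK]
  exact posSemidef_sum _ fun j _ => hX.mul_mul_conjTranspose_same (K j)

theorem Gate.coord_map (E : Gate Bool) (v : Fin 4 → ℝ) (μ : Fin 4) :
    coord (E.map (qubitMat v)) μ = ∑ α, (pauli μ * E.map (pauli α)).trace.re * v α / 2 := by
  rw [coord, qubitMat, map_sum, Finset.mul_sum, trace_sum, Complex.re_sum]
  refine Finset.sum_congr rfl fun α _ => ?_
  rw [map_smul, mul_smul_comm, trace_smul, smul_eq_mul, Complex.re_ofReal_mul]
  ring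

theorem Gate.sum_realOne (E : Gate Bool) (v w : Fin 4 → ℝ) (μ ν : Fin 4) :
    (∑ α, ∑ β, E.realOne μ ν α β * v α * w β) / 4 = coord (E.map (qubitMat v)) μ * w ν := by
  rw [E.coord_map, Finset.sum_div, Finset.sum_mul]
  refine Finset.sum_congr rfl fun α _ => ?_
  simp only [Gate.realOne, ite_mul, zero_mul, Finset.sum_ite_eq, Finset.mem_univ, if_true]
  ring

/-- A gate on one factor keeps a product a product, so a single summand is enough. -/
theorem Gate.sepTensor_realOne (E : Gate Bool) : SepTensor E.realOne := by
  intro v w hv hw hv0 hw0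
  refine ⟨1, fun _ => coord (E.map (qubitMat v)), fun _ => w,
    fun _ => cone_coord (E.posSemidef hv.posSemidef), fun _ => hw, ?_, fun μ ν => ?_⟩
  · have h : coord (E.map (qubitMat v)) 0 = (E.map (qubitMat v)).trace.re := by
      rw [(coord_eq _).1, trace, Fintype.sum_bool, Complex.add_re, diag_apply, diag_apply, add_comm]
    rw [Fin.sum_univ_one]
    dsimp only
    rw [hw0, h, E.trace_preserving, trace_qubitMat, hv0]; simp
  · rw [E.sum_realOne, Fin.sum_univ_one]

theorem kronecker_qubitMat (v w : Fin 4 → ℝ) : qubitMat v ⊗ₖ qubitMat w =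
    ∑ α, ∑ β, ((v α * w β / 4 : ℝ) : ℂ) • (pauli α ⊗ₖ pauli β) := by
  ext i j
  simp only [kroneckerMap_apply, qubitMat, Matrix.sum_apply, Matrix.smul_apply, smul_eq_mul,
    Finset.sum_mul_sum]
  refine Finset.sum_congr rfl fun α _ => Finset.sum_congr rfl fun β _ => ?_
  push_cast
  ring

theorem Gate.sum_realTwo (E : Gate (Bool × Bool)) (v w : Fin 4 → ℝ) (μ ν : Fin 4) :
    (∑ α, ∑ β, E.realTwo μ ν α β * v α * w β) / 4 =
      ((pauli μ ⊗ₖ pauli ν) * E.map (qubitMat v ⊗ₖ qubitMat w)).trace.re := by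
  rw [kronecker_qubitMat]
  simp only [map_sum, map_smul, Finset.mul_sum, trace_sum, Complex.re_sum, Finset.sum_div]
  refine Finset.sum_congr rfl fun α _ => Finset.sum_congr rfl fun β _ => ?_
  rw [mul_smul_comm, trace_smul, smul_eq_mul, Complex.re_ofReal_mul, Gate.realTwo]
  ring

theorem trace_pauli_mul_qubitMat (μ : Fin 4) (v : Fin 4 → ℝ) :
    (pauli μ * qubitMat v).trace = v μ := by
  apply Complex.ext
  · exact congrFun (coord_qubitMat v) μ
  · have hp : (pauli μ).IsHermitian := by
      ext s t
      rw [conjTranspose_apply]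
      fin_cases μ <;> cases s <;> cases t <;> simp [pauli, pauliInt, GaussianInt.toComplex_def]
    have h : star (pauli μ * qubitMat v).trace = (pauli μ * qubitMat v).trace := by
      rw [← trace_conjTranspose, conjTranspose_mul, hp.eq, (qubitMat_isHermitian v).eq,
        trace_mul_comm]
    have := congrArg Complex.im h
    simp at this ⊢
    linarith

theorem trace_pauli_kronecker {μ ν : Fin 4} (x y : Fin 4 → ℝ) :
    ((pauli μ ⊗ₖ pauli ν) * (qubitMat x ⊗ₖ qubitMat y)).trace = ((x μ * y ν : ℝ) : ℂ) := by
  rw [← mul_kronecker_mul, trace_kronecker, trace_pauli_mul_qubitMat, trace_pauli_mul_qubitMat,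
    Complex.ofReal_mul]

/-- The point where separability enters: `A j ⊗ B j` conjugates a product into a product, and each
factor stays positive. -/
theorem Gate.map_qubitMat {E : Gate (Bool × Bool)} (hE : E.IsSeparable) {v w : Fin 4 → ℝ}
    (hv : Cone v) (hw : Cone w) : ∃ (r : ℕ) (x y : Fin r → Fin 4 → ℝ), (∀ j, Cone (x j)) ∧
      (∀ j, Cone (y j)) ∧ E.map (qubitMat v ⊗ₖ qubitMat w) = ∑ j, qubitMat (x j) ⊗ₖ qubitMat (y j) := by
  obtain ⟨r, A, B, h⟩ := hE
  have hx : ∀ j, (A j * qubitMat v * (A j).conjTranspose).PosSemidef := fun j =>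
    hv.posSemidef.mul_mul_conjTranspose_same _
  have hy : ∀ j, (B j * qubitMat w * (B j).conjTranspose).PosSemidef := fun j =>
    hw.posSemidef.mul_mul_conjTranspose_same _
  refine ⟨r, fun j => coord (A j * qubitMat v * (A j).conjTranspose),
    fun j => coord (B j * qubitMat w * (B j).conjTranspose), fun j => cone_coord (hx j),
    fun j => cone_coord (hy j), ?_⟩
  rw [h]
  refine Finset.sum_congr rfl fun j _ => ?_
  rw [qubitMat_coord (hx j).isHermitian, qubitMat_coord (hy j).isHermitian, ← mul_kronecker_mul,
    ← mul_kronecker_mul]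

theorem Gate.sepTensor_realTwo {E : Gate (Bool × Bool)} (hE : E.IsSeparable) :
    SepTensor E.realTwo := by
  intro v w hv hw hv0 hw0
  obtain ⟨r, x, y, hx, hy, h⟩ := Gate.map_qubitMat hE hv hw
  refine ⟨r, x, y, hx, hy, ?_, fun μ ν => ?_⟩
  · have := E.trace_preserving (qubitMat v ⊗ₖ qubitMat w)
    rw [h, trace_sum, trace_kronecker, trace_qubitMat, trace_qubitMat, hv0, hw0] at this
    simp only [trace_kronecker, trace_qubitMat] at this
    rw [Complex.ofReal_one, mul_one] at this
    exact_mod_cast this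
  · rw [E.sum_realTwo, h, Finset.mul_sum, trace_sum, Complex.re_sum]
    simp only [trace_pauli_kronecker, Complex.ofReal_re]

/-- The Pauli expansion of the image is read off from its decomposition into products, each of which
is expanded by `kronecker_qubitMat`. -/
theorem Gate.map_eq_sum {E : Gate (Bool × Bool)} (hE : E.IsSeparable) {v w : Fin 4 → ℝ}
    (hv : Cone v) (hw : Cone w) : E.map (qubitMat v ⊗ₖ qubitMat w) = ∑ p : Fin 4 × Fin 4,
      (((∑ α, ∑ β, E.realTwo p.1 p.2 α β * v α * w β) / 4 / 4 : ℝ) : ℂ) •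
        (pauli p.1 ⊗ₖ pauli p.2) := by
  obtain ⟨r, x, y, -, -, h⟩ := Gate.map_qubitMat hE hv hw
  have : ∀ p : Fin 4 × Fin 4, (∑ α, ∑ β, E.realTwo p.1 p.2 α β * v α * w β) / 4 =
      ∑ j, x j p.1 * y j p.2 := fun p => by
    rw [E.sum_realTwo, h, Finset.mul_sum, trace_sum, Complex.re_sum]
    simp only [trace_pauli_kronecker, Complex.ofReal_re]
  simp only [this, Fintype.sum_prod_type]
  rw [h]
  simp only [kronecker_qubitMat, Finset.sum_div, Complex.ofReal_sum, Finset.sum_smul]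
  rw [Finset.sum_comm]
  refine Finset.sum_congr rfl fun α _ => ?_
  rw [Finset.sum_comm]

/-! ### Integral approximations to the tensors -/

theorem pauliInt_sq_le (μ : Fin 4) (s t : Bool) :
    (pauliInt μ s t).re ^ 2 + (pauliInt μ s t).im ^ 2 ≤ 1 := by
  revert μ s t; decide

theorem gaussianInt_mul_sq_le {a b : GaussianInt} (ha : a.re ^ 2 + a.im ^ 2 ≤ 1)
    (hb : b.re ^ 2 + b.im ^ 2 ≤ 1) : (a * b).re ^ 2 + (a * b).im ^ 2 ≤ 1 := by
  have : (a * b).re ^ 2 + (a * b).im ^ 2 = (a.re ^ 2 + a.im ^ 2) * (b.re ^ 2 + b.im ^ 2) := by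
    simp only [Zsqrtd.re_mul, Zsqrtd.im_mul]; ring
  rw [this]
  exact mul_le_one₀ ha (by positivity) hb

/-- The coefficients are products of Pauli entries and hence have modulus at most 1, so the real and
the imaginary part contribute an error of at most 1 each. -/
theorem abs_entry_le {c : GaussianInt} (hc : c.re ^ 2 + c.im ^ 2 ≤ 1) {a b : ℤ} {e : ℂ} {N : ℝ}
    (ha : |a - N * e.re| ≤ 1) (hb : |b - N * e.im| ≤ 1) :
    |((c.re * a - c.im * b : ℤ) : ℝ) - N * (GaussianInt.toComplex c * e).re| ≤ 2 := by
  have h1 : |c.re| ≤ 1 := by rw [← sq_le_one_iff_abs_le_one]; nlinarith [sq_nonneg c.im]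
  have h2 : |c.im| ≤ 1 := by rw [← sq_le_one_iff_abs_le_one]; nlinarith [sq_nonneg c.re]
  have h1' : |(c.re : ℝ)| ≤ 1 := by exact_mod_cast h1
  have h2' : |(c.im : ℝ)| ≤ 1 := by exact_mod_cast h2
  have : ((c.re * a - c.im * b : ℤ) : ℝ) - N * (GaussianInt.toComplex c * e).re =
      c.re * (a - N * e.re) - c.im * (b - N * e.im) := by
    rw [Complex.mul_re, ← GaussianInt.intCast_re, ← GaussianInt.intCast_im]
    push_cast
    ring
  rw [this]
  refine (abs_sub _ _).trans ?_
  rw [abs_mul, abs_mul]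
  have := mul_le_one₀ h1' (abs_nonneg _) ha
  have := mul_le_one₀ h2' (abs_nonneg _) hb
  linarith

theorem abs_sum_bool_le {f g : Bool → ℝ} {c : ℝ} (h : ∀ b, |f b - g b| ≤ c) :
    |∑ b, f b - ∑ b, g b| ≤ 2 * c := by
  rw [Fintype.sum_bool, Fintype.sum_bool]
  have h1 := abs_le.1 (h true)
  have h2 := abs_le.1 (h false)
  rw [abs_le]
  constructor <;> linarith

theorem matrix_eq_sum_single_apply {n : Type} [Fintype n] [DecidableEq n] (E : Gate n)
    (X : Matrix n n ℂ) (k l : n) :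
    E.map X k l = ∑ i, ∑ j, X i j * E.map (Matrix.single i j 1) k l := by
  conv_lhs => rw [matrix_eq_sum_single X]
  simp only [map_sum, Matrix.sum_apply]
  refine Finset.sum_congr rfl fun i _ => Finset.sum_congr rfl fun j _ => ?_
  have : Matrix.single i j (X i j) = X i j • Matrix.single i j (1 : ℂ) := by
    rw [smul_single, smul_eq_mul, mul_one]
  rw [this, map_smul, Matrix.smul_apply, smul_eq_mul]

theorem tensorOne_approx (E : Gate Bool) {τ : RawOne} {N : ℝ}
    (h : ∀ i j k l, |(τ i j k l).1 - N * (E.map (Matrix.single i j 1) k l).re| ≤ 1 ∧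
      |(τ i j k l).2 - N * (E.map (Matrix.single i j 1) k l).im| ≤ 1) (μ ν α β : Fin 4) :
    |tensorOne τ μ ν α β - N * E.realOne μ ν α β| ≤ 512 := by
  have e : (pauli μ * E.map (pauli α)).trace.re = ∑ i, ∑ j, ∑ k, ∑ l,
      (GaussianInt.toComplex (pauliInt μ l k * pauliInt α i j) *
        E.map (Matrix.single i j 1) k l).re := by
    simp only [trace, diag_apply, Matrix.mul_apply, matrix_eq_sum_single_apply E (pauli α),
      Finset.mul_sum, Complex.re_sum]
    rw [Finset.sum_comm]
    have : ∀ f : Bool → Bool → Bool → Bool → ℝ,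
        ∑ k, ∑ l, ∑ i, ∑ j, f l k i j = ∑ i, ∑ j, ∑ k, ∑ l, f l k i j := fun f => by
      simp only [Fintype.sum_bool]; ring
    rw [this]
    simp only [pauli, of_apply, map_mul, mul_assoc]
  have key : |((∑ i, ∑ j, ∑ k, ∑ l, ((pauliInt μ l k * pauliInt α i j).re * (τ i j k l).1 -
      (pauliInt μ l k * pauliInt α i j).im * (τ i j k l).2) : ℤ) : ℝ) -
      N * (pauli μ * E.map (pauli α)).trace.re| ≤ 32 := by
    rw [e]
    simp only [Int.cast_sum, Finset.mul_sum]
    refine (abs_sum_bool_le fun i => abs_sum_bool_le fun j => abs_sum_bool_le fun k =>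
      abs_sum_bool_le fun l => abs_entry_le (gaussianInt_mul_sq_le (pauliInt_sq_le _ _ _)
        (pauliInt_sq_le _ _ _)) (h i j k l).1 (h i j k l).2).trans (by norm_num)
  simp only [tensorOne, Gate.realOne]
  split_ifs
  · rw [show N * (2 * (pauli μ * E.map (pauli α)).trace.re) =
      2 * (N * (pauli μ * E.map (pauli α)).trace.re) by ring, Int.cast_mul, Int.cast_ofNat,
      ← mul_sub, abs_mul, abs_two]
    linarith
  · simp

/-- The constant is `2 ^ 8 * 2`: eight sums over bits, and the error 2 of each term. The one-qubit
bound is stated with the same constant so that one analysis covers both cases. -/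
theorem tensorTwo_approx (E : Gate (Bool × Bool)) {τ : RawTwo} {N : ℝ}
    (h : ∀ i₁ i₂ j₁ j₂ k₁ k₂ l₁ l₂,
      |(τ i₁ i₂ j₁ j₂ k₁ k₂ l₁ l₂).1 -
        N * (E.map (Matrix.single (i₁, i₂) (j₁, j₂) 1) (k₁, k₂) (l₁, l₂)).re| ≤ 1 ∧
      |(τ i₁ i₂ j₁ j₂ k₁ k₂ l₁ l₂).2 -
        N * (E.map (Matrix.single (i₁, i₂) (j₁, j₂) 1) (k₁, k₂) (l₁, l₂)).im| ≤ 1)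
    (μ ν α β : Fin 4) : |tensorTwo τ μ ν α β - N * E.realTwo μ ν α β| ≤ 512 := by
  have e : E.realTwo μ ν α β = ∑ i₁, ∑ i₂, ∑ j₁, ∑ j₂, ∑ k₁, ∑ k₂, ∑ l₁, ∑ l₂,
      (GaussianInt.toComplex (pauliInt μ l₁ k₁ * pauliInt ν l₂ k₂ * pauliInt α i₁ j₁ *
        pauliInt β i₂ j₂) *
        E.map (Matrix.single (i₁, i₂) (j₁, j₂) 1) (k₁, k₂) (l₁, l₂)).re := by
    simp only [Gate.realTwo, trace, diag_apply, Matrix.mul_apply,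
      matrix_eq_sum_single_apply E (pauli α ⊗ₖ pauli β), Finset.mul_sum, Complex.re_sum]
    have : ∀ f : Bool × Bool → Bool × Bool → Bool × Bool → Bool × Bool → ℝ,
        ∑ l, ∑ k, ∑ i, ∑ j, f l k i j = ∑ i, ∑ j, ∑ k, ∑ l, f l k i j := fun f => by
      rw [Finset.sum_comm]
      calc ∑ k, ∑ l, ∑ i, ∑ j, f l k i j = ∑ k, ∑ i, ∑ j, ∑ l, f l k i j := by
            refine Finset.sum_congr rfl fun k _ => ?_
            rw [Finset.sum_comm]
            exact Finset.sum_congr rfl fun i _ => Finset.sum_comm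
        _ = _ := by
            rw [Finset.sum_comm]
            exact Finset.sum_congr rfl fun i _ => Finset.sum_comm
    rw [this]
    simp only [Fintype.sum_prod_type, pauli, of_apply, map_mul, kroneckerMap_apply, mul_assoc]
  rw [e]
  simp only [tensorTwo, Int.cast_sum, Finset.mul_sum]
  refine (abs_sum_bool_le fun i₁ => abs_sum_bool_le fun i₂ => abs_sum_bool_le fun j₁ =>
    abs_sum_bool_le fun j₂ => abs_sum_bool_le fun k₁ => abs_sum_bool_le fun k₂ =>
    abs_sum_bool_le fun l₁ => abs_sum_bool_le fun l₂ => abs_entry_le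
      (gaussianInt_mul_sq_le (gaussianInt_mul_sq_le (gaussianInt_mul_sq_le (pauliInt_sq_le _ _ _)
        (pauliInt_sq_le _ _ _)) (pauliInt_sq_le _ _ _)) (pauliInt_sq_le _ _ _))
      (h i₁ i₂ j₁ j₂ k₁ k₂ l₁ l₂).1 (h i₁ i₂ j₁ j₂ k₁ k₂ l₁ l₂).2).trans (by norm_num)

end SepSim
-- Why the greedy mixture converges at rate `1/√M`.
namespace SepSim

/-! ### Analysis of the greedy algorithm -/

section
variable {ι : Type} [Fintype ι]

/-- In `|X + d|² = |X|² + 2⟨X, d⟩ + |d|²` the last term is at most `card * D²`. The cross term is at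
most `2θ ∑ |X i|`, where the crude bound `|X i| ≤ n D ≤ M D` suffices because `θ` will be small
compared with `D`. -/
theorem potential_step {X d : ι → ℝ} {n : ℕ} {M D θ : ℝ} (hD : 0 ≤ D) (hθ : 0 ≤ θ)
    (hnM : (n : ℝ) ≤ M)
    (hX : ∑ i, X i ^ 2 ≤ n * (Fintype.card ι * (2 * θ * M * D + D ^ 2)))
    (hX' : ∀ i, |X i| ≤ n * D) (hd : ∀ i, |d i| ≤ D) (h : ∑ i, X i * d i ≤ θ * ∑ i, |X i|) :
    ∑ i, (X i + d i) ^ 2 ≤ ((n + 1 : ℕ) : ℝ) * (Fintype.card ι * (2 * θ * M * D + D ^ 2)) ∧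
      ∀ i, |X i + d i| ≤ ((n + 1 : ℕ) : ℝ) * D := by
  refine ⟨?_, fun i => (abs_add_le _ _).trans ?_⟩
  · have h1 : ∑ i, |X i| ≤ Fintype.card ι * (M * D) := by
      have := Finset.sum_le_card_nsmul Finset.univ (fun i => |X i|) (M * D)
        fun i _ => (hX' i).trans (mul_le_mul_of_nonneg_right hnM hD)
      simpa using this
    have h2 : ∑ i, d i ^ 2 ≤ Fintype.card ι * D ^ 2 := by
      have := Finset.sum_le_card_nsmul Finset.univ (fun i => d i ^ 2) (D ^ 2)
        fun i _ => by rw [← sq_abs]; exact pow_le_pow_left₀ (abs_nonneg _) (hd i) 2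
      simpa using this
    have h3 : ∑ i, (X i + d i) ^ 2 = ∑ i, X i ^ 2 + 2 * ∑ i, X i * d i + ∑ i, d i ^ 2 := by
      rw [Finset.mul_sum, ← Finset.sum_add_distrib, ← Finset.sum_add_distrib]
      exact Finset.sum_congr rfl fun i _ => by ring
    have h4 := mul_le_mul_of_nonneg_left h1 hθ
    rw [h3]
    push_cast
    nlinarith
  · have := hX' i
    have := hd i
    push_cast
    linarith

end

/-- Rounding is towards zero, so that a rounded Bloch vector does not leave the ball. -/
theorem exists_int_near (r : ℝ) : ∃ z : ℤ, |(z : ℝ)| ≤ |r| ∧ |r - z| ≤ 1 := by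
  rcases le_total 0 r with h | h
  · refine ⟨⌊r⌋, ?_, ?_⟩
    · have h1 : (0 : ℝ) ≤ ⌊r⌋ := by exact_mod_cast Int.floor_nonneg.2 h
      rw [abs_of_nonneg h, abs_of_nonneg h1]
      exact Int.floor_le r
    · have h1 := Int.floor_le r
      have h2 := Int.lt_floor_add_one r
      rw [abs_le]; constructor <;> linarith
  · refine ⟨⌈r⌉, ?_, ?_⟩
    · have h1 : (⌈r⌉ : ℝ) ≤ 0 := by exact_mod_cast Int.ceil_nonpos.2 h
      rw [abs_of_nonpos h, abs_of_nonpos h1]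
      linarith [Int.le_ceil r]
    · have h1 := Int.le_ceil r
      have h2 := Int.ceil_lt_add_one r
      rw [abs_le]; constructor <;> linarith

theorem mem_net {M : ℕ} {v : Vec} :
    v ∈ net M ↔ v 0 = M ∧ v 1 ^ 2 + v 2 ^ 2 + v 3 ^ 2 ≤ (M : ℤ) ^ 2 := by
  have hI : ∀ {x : ℤ}, x ^ 2 ≤ (M : ℤ) ^ 2 →
      x ∈ (List.range (2 * M + 1)).map fun (n : ℕ) => (n : ℤ) - M := by
    intro x hx
    have := abs_le.1 (abs_le_of_sq_le_sq hx (by positivity))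
    rw [List.mem_map]
    exact ⟨(x + M).toNat, by rw [List.mem_range]; omega, by omega⟩
  simp only [net, List.mem_flatMap]
  constructor
  · rintro ⟨x, -, y, -, z, -, h⟩
    split_ifs at h with hc
    · rw [List.mem_singleton] at h
      subst h
      refine ⟨rfl, ?_⟩
      simp only [Matrix.cons_val]
      nlinarith
    · simp at h
  · rintro ⟨h0, h⟩
    refine ⟨v 1, hI (by nlinarith [sq_nonneg (v 2), sq_nonneg (v 3)]), v 2,
      hI (by nlinarith [sq_nonneg (v 1), sq_nonneg (v 3)]), v 3,
      hI (by nlinarith [sq_nonneg (v 1), sq_nonneg (v 2)]), ?_⟩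
    rw [if_pos (by nlinarith), List.mem_singleton]
    ext i
    fin_cases i <;> simp [h0]

theorem abs_le_of_mem_net {M : ℕ} {v : Vec} (h : v ∈ net M) (i : Fin 4) : |(v i : ℝ)| ≤ M := by
  obtain ⟨h0, h⟩ := mem_net.1 h
  have : |v i| ≤ (M : ℤ) := by
    refine abs_le_of_sq_le_sq ?_ (by positivity)
    fin_cases i
    · show v 0 ^ 2 ≤ _; rw [h0]
    · show v 1 ^ 2 ≤ _; nlinarith [sq_nonneg (v 2), sq_nonneg (v 3)]
    · show v 2 ^ 2 ≤ _; nlinarith [sq_nonneg (v 1), sq_nonneg (v 3)]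
    · show v 3 ^ 2 ≤ _; nlinarith [sq_nonneg (v 1), sq_nonneg (v 2)]
  exact_mod_cast this

theorem pole_mem_net (M : ℕ) (b : Bool) : pole M b ∈ net M := by
  rw [mem_net]
  cases b <;> simp [pole]

/-- The Bloch vector of an element of the net. -/
noncomputable def bloch (M : ℕ) (v : Vec) (μ : Fin 4) : ℝ := v μ / M

theorem cone_bloch {M : ℕ} (hM : 0 < M) {v : Vec} (h : v ∈ net M) :
    Cone (bloch M v) ∧ bloch M v 0 = 1 := by
  obtain ⟨h0, h⟩ := mem_net.1 h
  have hM' : (0 : ℝ) < M := by exact_mod_cast hM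
  have h1 : bloch M v 0 = 1 := by
    rw [bloch, h0, Int.cast_natCast]; exact div_self hM'.ne'
  refine ⟨⟨by rw [h1]; norm_num, ?_⟩, h1⟩
  rw [h1]
  have : ((v 1 : ℝ) ^ 2 + v 2 ^ 2 + v 3 ^ 2) ≤ (M : ℝ) ^ 2 := by exact_mod_cast h
  simp only [bloch, div_pow]
  rw [← add_div, ← add_div, one_pow, div_le_one (by positivity)]
  exact this

theorem Cone.abs_le {v : Fin 4 → ℝ} (h : Cone v) (i : Fin 4) : |v i| ≤ v 0 := by
  obtain ⟨h0, h⟩ := h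
  refine abs_le_of_sq_le_sq ?_ h0
  fin_cases i
  · exact le_rfl
  · show v 1 ^ 2 ≤ _; nlinarith [sq_nonneg (v 2), sq_nonneg (v 3)]
  · show v 2 ^ 2 ≤ _; nlinarith [sq_nonneg (v 1), sq_nonneg (v 3)]
  · show v 3 ^ 2 ≤ _; nlinarith [sq_nonneg (v 1), sq_nonneg (v 2)]

theorem Cone.exists_net {v : Fin 4 → ℝ} (h : Cone v) (h0 : v 0 = 1) (M : ℕ) :
    ∃ a ∈ net M, ∀ μ, |M * v μ - a μ| ≤ 1 := by
  choose z hz hz' using fun μ => exists_int_near (M * v μ)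
  have h1 : ∀ μ, ((z μ : ℤ) : ℝ) ^ 2 ≤ (M * v μ) ^ 2 := fun μ => sq_le_sq.2 (hz μ)
  refine ⟨![(M : ℤ), z 1, z 2, z 3], mem_net.2 ⟨rfl, ?_⟩, fun μ => ?_⟩
  · have h2 : ((z 1 : ℤ) : ℝ) ^ 2 + (z 2 : ℝ) ^ 2 + (z 3 : ℝ) ^ 2 ≤ (M : ℝ) ^ 2 := by
      have h3 := h.2
      rw [h0, one_pow] at h3
      have h4 := mul_le_mul_of_nonneg_left h3 (sq_nonneg (M : ℝ))
      have := h1 1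
      have := h1 2
      have := h1 3
      nlinarith
    show z 1 ^ 2 + z 2 ^ 2 + z 3 ^ 2 ≤ _
    exact_mod_cast h2
  · fin_cases μ
    · simp [h0]
    · exact hz' 1
    · exact hz' 2
    · exact hz' 3

/-- The tensor product of two vectors. -/
def outer (s : Vec × Vec) (i : Fin 4 × Fin 4) : ℝ := s.1 i.1 * s.2 i.2

theorem argmin_le {β : Type} (f : β → ℤ) (d : β) (l : List β) :
    ∀ b ∈ d :: l, f (argmin f d l) ≤ f b := by
  induction l generalizing d with
  | nil => simp [argmin]
  | cons c l ih =>
    intro b hb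
    have h : argmin f d (c :: l) = argmin f (if f c < f d then c else d) l := rfl
    rw [h]
    have h1 := ih (if f c < f d then c else d) _ List.mem_cons_self
    rcases List.mem_cons.1 hb with rfl | hb
    · split_ifs at h1 ⊢ <;> omega
    rcases List.mem_cons.1 hb with rfl | hb
    · split_ifs at h1 ⊢ <;> omega
    · exact ih _ b (List.mem_cons_of_mem _ hb)

theorem mem_netPairs {M : ℕ} {s : Vec × Vec} : s ∈ netPairs M ↔ s.1 ∈ net M ∧ s.2 ∈ net M := by
  simp only [netPairs, List.mem_flatMap, List.mem_map]
  constructor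
  · rintro ⟨a, ha, b, hb, rfl⟩; exact ⟨ha, hb⟩
  · rintro ⟨ha, hb⟩; exact ⟨s.1, ha, s.2, hb, rfl⟩

section
variable {M : ℕ} {G : Tensor} {R : Fin 4 → Fin 4 → Fin 4 → Fin 4 → ℝ} {v w : Vec}

/-- The target of the greedy algorithm. -/
noncomputable def target (M : ℕ) (G : Tensor) (v w : Vec) (i : Fin 4 × Fin 4) : ℝ :=
  (∑ α, ∑ β, (G i.1 i.2 α β : ℝ) * v α * w β) / (4 * M)

/-- The deviation of the sum of a list of pairs from a multiple of the target. -/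
noncomputable def deviation (M : ℕ) (G : Tensor) (v w : Vec) (l : List (Vec × Vec))
    (i : Fin 4 × Fin 4) : ℝ := (l.map fun s => outer s i - target M G v w i).sum

theorem list_sum_smul_sum {β ι : Type} [Fintype ι] (l : List β) (f : β → ι → ℝ) (g : ι → ℝ) :
    (l.map fun b => ∑ i, f b i * g i).sum = ∑ i, (l.map fun b => f b i).sum * g i := by
  induction l with
  | nil => simp
  | cons b l ih =>
    simp only [List.map_cons, List.sum_cons, ih, add_mul, Finset.sum_add_distrib]

/-- The factor `4 M` clears the denominator of `target`. The minimization is thus carried out in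
exact integer arithmetic, although it concerns a real inner product. -/
theorem score_eq (hM : 0 < M) (l : List (Vec × Vec)) (s : Vec × Vec) :
    (score M G v w l s : ℝ) = 4 * M * ∑ i, deviation M G v w l i * outer s i := by
  have hM' : (0 : ℝ) < M := by exact_mod_cast hM
  simp only [deviation]
  rw [← list_sum_smul_sum, ← List.sum_map_mul_left, score]
  have : ((l.map fun r => 4 * (M : ℤ) * (dot r.1 s.1 * dot r.2 s.2) -
      bil G v w s.1 s.2).sum : ℝ) = (l.map fun r => ((4 * (M : ℤ) * (dot r.1 s.1 * dot r.2 s.2) -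
      bil G v w s.1 s.2 : ℤ) : ℝ)).sum := by
    induction l with
    | nil => simp
    | cons b l ih => simp only [List.map_cons, List.sum_cons, Int.cast_add, ih]
  rw [this]
  congr 1
  refine List.map_congr_left fun r _ => ?_
  have h1 : ((bil G v w s.1 s.2 : ℤ) : ℝ) = 4 * M * ∑ i, target M G v w i * outer s i := by
    rw [Finset.mul_sum, Fintype.sum_prod_type]
    simp only [bil, target, outer, Int.cast_sum, Int.cast_mul]
    refine Finset.sum_congr rfl fun μ _ => Finset.sum_congr rfl fun ν _ => ?_
    have : ∀ T S : ℝ, 4 * M * (T / (4 * M) * S) = T * S := fun T S => by field_simp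
    rw [this, Finset.sum_mul]
    refine Finset.sum_congr rfl fun α _ => ?_
    rw [Finset.sum_mul]
    exact Finset.sum_congr rfl fun β _ => by ring
  have h2 : ((dot r.1 s.1 * dot r.2 s.2 : ℤ) : ℝ) = ∑ i, outer r i * outer s i := by
    rw [Fintype.sum_prod_type]
    simp only [dot, outer, Int.cast_mul, Int.cast_sum, Finset.sum_mul_sum]
    exact Finset.sum_congr rfl fun μ _ => Finset.sum_congr rfl fun ν _ => by ring
  simp only [sub_mul, Finset.sum_sub_distrib]
  rw [mul_sub, ← h1, ← h2]
  push_cast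
  ring

/-- With `G ≈ M R` and net vectors `M` times Bloch vectors, the target is about `M²` times the true
image. Its error is bounded by 16 terms of size `512 M²`, divided by `4 M`. -/
theorem target_near (hM : 0 < M)
    (hG : ∀ μ ν α β, |(G μ ν α β : ℝ) - M * R μ ν α β| ≤ 512) (hv : v ∈ net M) (hw : w ∈ net M)
    (i : Fin 4 × Fin 4) : |target M G v w i - (M : ℝ) ^ 2 *
      ((∑ α, ∑ β, R i.1 i.2 α β * bloch M v α * bloch M w β) / 4)| ≤ 2048 * (M : ℝ) := by
  have hM' : (0 : ℝ) < M := by exact_mod_cast hM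
  have e : target M G v w i - M ^ 2 *
      ((∑ α, ∑ β, R i.1 i.2 α β * bloch M v α * bloch M w β) / 4) =
      (∑ α, ∑ β, ((G i.1 i.2 α β : ℝ) - M * R i.1 i.2 α β) * v α * w β) / (4 * M) := by
    simp only [target, bloch, Finset.sum_div, Finset.mul_sum, ← Finset.sum_sub_distrib]
    refine Finset.sum_congr rfl fun α _ => Finset.sum_congr rfl fun β _ => ?_
    field_simp
  rw [e, abs_div, abs_of_pos (by positivity : (0 : ℝ) < 4 * M), div_le_iff₀ (by positivity)]
  have h1 : ∀ α β, |((G i.1 i.2 α β : ℝ) - M * R i.1 i.2 α β) * v α * w β| ≤ 512 * M * M := by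
    intro α β
    rw [abs_mul, abs_mul]
    exact mul_le_mul (mul_le_mul (hG _ _ _ _) (abs_le_of_mem_net hv α) (abs_nonneg _) (by norm_num))
      (abs_le_of_mem_net hw β) (abs_nonneg _) (by positivity)
  refine (Finset.abs_sum_le_sum_abs _ _).trans ((Finset.sum_le_sum fun α _ =>
    (Finset.abs_sum_le_sum_abs _ _).trans (Finset.sum_le_sum fun β _ => h1 α β)).trans ?_)
  simp
  nlinarith

theorem abs_outer_le {s : Vec × Vec} (h : s ∈ netPairs M) (i : Fin 4 × Fin 4) :
    |outer s i| ≤ M ^ 2 := by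
  obtain ⟨h1, h2⟩ := mem_netPairs.1 h
  rw [outer, abs_mul, sq]
  exact mul_le_mul (abs_le_of_mem_net h1 _) (abs_le_of_mem_net h2 _) (abs_nonneg _) (by positivity)

/-- Every linear functional has on the net a value which is not much larger than its value at the
image of a product state. -/
theorem SepTensor.le_of_net (hR : SepTensor R) {x y : Fin 4 → ℝ} (hx : Cone x) (hy : Cone y)
    (hx0 : x 0 = 1) (hy0 : y 0 = 1) (X : Fin 4 × Fin 4 → ℝ) {m : ℝ}
    (hm : ∀ s ∈ netPairs M, m ≤ ∑ i, X i * outer s i) :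
    m ≤ ∑ i, X i * (M ^ 2 * ((∑ α, ∑ β, R i.1 i.2 α β * x α * y β) / 4)) +
      2 * M * ∑ i, |X i| := by
  obtain ⟨r, a, b, ha, hb, h1, h⟩ := hR x y hx hy hx0 hy0
  -- One product in the decomposition, with weight `a j 0 * b j 0`. The weights sum to 1, so adding
  -- these inequalities gives the claim.
  have key : ∀ j, (a j 0 * b j 0) * m ≤ ∑ i : Fin 4 × Fin 4, X i * (M ^ 2 * (a j i.1 * b j i.2)) +
      (a j 0 * b j 0) * (2 * M * ∑ i, |X i|) := by
    intro j
    -- Normalization divides by the component `0`. If that vanishes, the cone condition makes the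
    -- whole vector vanish, and the inequality is trivial.
    have hzero : ∀ {c : Fin 4 → ℝ}, Cone c → c 0 = 0 → ∀ i, c i = 0 := fun hc h i =>
      abs_nonpos_iff.1 ((hc.abs_le i).trans h.le)
    rcases (ha j).1.eq_or_lt with h0 | h0
    · simp [← h0, hzero (ha j) h0.symm]
    rcases (hb j).1.eq_or_lt with h0' | h0'
    · simp [← h0', hzero (hb j) h0'.symm]
    have hn : ∀ {c : Fin 4 → ℝ}, Cone c → 0 < c 0 → ∃ u ∈ net M, ∀ μ, |M * (c μ / c 0) - u μ| ≤ 1 := by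
      intro c hc h0
      refine Cone.exists_net (v := fun μ => c μ / c 0) ⟨by positivity, ?_⟩ (div_self h0.ne') M
      simp only [div_pow]
      rw [← add_div, ← add_div]
      exact div_le_div_of_nonneg_right hc.2 (by positivity)
    obtain ⟨u, hu, hu'⟩ := hn (ha j) h0
    obtain ⟨t, ht, ht'⟩ := hn (hb j) h0'
    have h2 := hm (u, t) (mem_netPairs.2 ⟨hu, ht⟩)
    have h3 : ∀ i : Fin 4 × Fin 4,
        |outer (u, t) i - M ^ 2 * (a j i.1 / a j 0 * (b j i.2 / b j 0))| ≤ 2 * M := by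
      intro i
      -- The two factors are rounded one after the other: each rounding error is at most 1 and is
      -- multiplied by a number of size at most `M`, which explains the bound `2 M`.
      have e : outer (u, t) i - M ^ 2 * (a j i.1 / a j 0 * (b j i.2 / b j 0)) =
          -((M * (a j i.1 / a j 0) - u i.1) * (M * (b j i.2 / b j 0))) -
            u i.1 * (M * (b j i.2 / b j 0) - t i.2) := by
        simp only [outer]; ring
      have h4 : |M * (b j i.2 / b j 0)| ≤ M := by
        rw [abs_mul, abs_div, abs_of_pos h0', abs_of_nonneg (by positivity : (0 : ℝ) ≤ M)]
        exact mul_le_of_le_one_right (by positivity) ((div_le_one h0').2 ((hb j).abs_le _))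
      rw [e]
      refine (abs_sub _ _).trans ?_
      rw [abs_neg, abs_mul (_ - _) _, abs_mul (u i.1 : ℝ)]
      have h5 := mul_le_mul (hu' i.1) h4 (abs_nonneg _) zero_le_one
      have h6 := mul_le_mul (abs_le_of_mem_net hu i.1) (ht' i.2) (abs_nonneg _) (by positivity)
      linarith
    have h4 : ∑ i, X i * outer (u, t) i ≤
        ∑ i : Fin 4 × Fin 4, X i * (M ^ 2 * (a j i.1 / a j 0 * (b j i.2 / b j 0))) +
          2 * M * ∑ i, |X i| := by
      rw [Finset.mul_sum, ← Finset.sum_add_distrib]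
      refine Finset.sum_le_sum fun i _ => ?_
      have h5 : X i * (outer (u, t) i - M ^ 2 * (a j i.1 / a j 0 * (b j i.2 / b j 0))) ≤
          |X i| * (2 * M) := (le_abs_self _).trans (by
        rw [abs_mul]; exact mul_le_mul_of_nonneg_left (h3 i) (abs_nonneg _))
      linarith
    have h5 := mul_le_mul_of_nonneg_left (h2.trans h4) (mul_pos h0 h0').le
    refine h5.trans (le_of_eq ?_)
    rw [mul_add, Finset.mul_sum]
    congr 1
    refine Finset.sum_congr rfl fun i _ => ?_
    field_simp
  have h2 := Finset.sum_le_sum fun j (_ : j ∈ Finset.univ) => key j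
  rw [← Finset.sum_mul, h1, one_mul, Finset.sum_add_distrib, ← Finset.sum_mul, h1, one_mul,
    Finset.sum_comm] at h2
  refine h2.trans (le_of_eq ?_)
  congr 1
  refine Finset.sum_congr rfl fun i _ => ?_
  rw [h, Finset.mul_sum, Finset.mul_sum]

theorem SepTensor.abs_le_one (hR : SepTensor R) {x y : Fin 4 → ℝ} (hx : Cone x) (hy : Cone y)
    (hx0 : x 0 = 1) (hy0 : y 0 = 1) (μ ν : Fin 4) :
    |(∑ α, ∑ β, R μ ν α β * x α * y β) / 4| ≤ 1 := by
  obtain ⟨r, a, b, ha, hb, h1, h⟩ := hR x y hx hy hx0 hy0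
  rw [h, ← h1]
  refine (Finset.abs_sum_le_sum_abs _ _).trans (Finset.sum_le_sum fun j _ => ?_)
  rw [abs_mul]
  exact mul_le_mul ((ha j).abs_le _) ((hb j).abs_le _) (abs_nonneg _) (ha j).1

theorem greedyStep_mem (l : List (Vec × Vec)) : greedyStep M G v w l ∈ netPairs M := by
  rcases List.mem_cons.1 (argmin_mem (score M G v w l) (pole M false, pole M false) (netPairs M))
    with h | h
  · rw [greedyStep, h]
    exact mem_netPairs.2 ⟨pole_mem_net _ _, pole_mem_net _ _⟩
  · exact h

/-- `potential_step` with `θ = 2050 M` and `D = 2050 M²`. Here `2050 = 2048 + 2` combines the error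
of the target with that of rounding to the net; a step has size at most `M² + M² + 2048 M ≤ 2050
M²`. -/
theorem greedy_potential (hM : 0 < M) (hR : SepTensor R)
    (hG : ∀ μ ν α β, |(G μ ν α β : ℝ) - M * R μ ν α β| ≤ 512) (hv : v ∈ net M) (hw : w ∈ net M)
    (n : ℕ) (hn : n ≤ M) :
    let l := (fun l => greedyStep M G v w l :: l)^[n] []
    l.length = n ∧ (∀ s ∈ l, s ∈ netPairs M) ∧
    ∑ i, deviation M G v w l i ^ 2 ≤ n * ((Fintype.card (Fin 4 × Fin 4) : ℕ) *
      (2 * (2050 * M) * M * (2050 * M ^ 2) + (2050 * M ^ 2) ^ 2)) ∧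
    ∀ i, |deviation M G v w l i| ≤ n * (2050 * M ^ 2) := by
  have hM' : (1 : ℝ) ≤ M := by exact_mod_cast hM
  obtain ⟨hcv, hv0⟩ := cone_bloch hM hv
  obtain ⟨hcw, hw0⟩ := cone_bloch hM hw
  induction n with
  | zero => simp [deviation]
  | succ n ih =>
    obtain ⟨h1, h2, h3, h4⟩ := ih (by omega)
    rw [Function.iterate_succ_apply']
    set l := (fun l => greedyStep M G v w l :: l)^[n] [] with hl
    set s := greedyStep M G v w l with hs
    have hsm : s ∈ netPairs M := greedyStep_mem l
    have e : ∀ i, deviation M G v w (s :: l) i =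
        deviation M G v w l i + (outer s i - target M G v w i) := fun i => by
      simp only [deviation, List.map_cons, List.sum_cons]; ring
    have hmin : ∀ t ∈ netPairs M, ∑ i, deviation M G v w l i * outer s i ≤
        ∑ i, deviation M G v w l i * outer t i := by
      intro t ht
      have := argmin_le (score M G v w l) (pole M false, pole M false) (netPairs M) t
        (List.mem_cons_of_mem _ ht)
      have h5 : (score M G v w l s : ℝ) ≤ score M G v w l t := by exact_mod_cast this
      rw [score_eq hM, score_eq hM] at h5
      exact le_of_mul_le_mul_left h5 (by positivity)
    have hnear := target_near hM hG hv hw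
    have hle := hR.le_of_net hcv hcw hv0 hw0 (deviation M G v w l) hmin
    have hstep : ∑ i, deviation M G v w l i * (outer s i - target M G v w i) ≤
        2050 * M * ∑ i, |deviation M G v w l i| := by
      have h6 : ∑ i, deviation M G v w l i * (M ^ 2 *
          ((∑ α, ∑ β, R i.1 i.2 α β * bloch M v α * bloch M w β) / 4)) ≤
          ∑ i, deviation M G v w l i * target M G v w i +
            2048 * M * ∑ i, |deviation M G v w l i| := by
        rw [Finset.mul_sum, ← Finset.sum_add_distrib]
        refine Finset.sum_le_sum fun i _ => ?_
        have h7 : -(deviation M G v w l i * (target M G v w i - M ^ 2 *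
            ((∑ α, ∑ β, R i.1 i.2 α β * bloch M v α * bloch M w β) / 4))) ≤
            |deviation M G v w l i| * (2048 * M) := (neg_le_abs _).trans (by
          rw [abs_mul]; exact mul_le_mul_of_nonneg_left (hnear i) (abs_nonneg _))
        linarith
      simp only [mul_sub, Finset.sum_sub_distrib]
      linarith
    have hd : ∀ i, |outer s i - target M G v w i| ≤ 2050 * M ^ 2 := by
      intro i
      have h6 := abs_le.1 (abs_outer_le hsm i)
      have h7 := abs_le.1 (hnear i)
      have h8 := abs_le.1 (hR.abs_le_one hcv hcw hv0 hw0 i.1 i.2)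
      have h9 : (M : ℝ) ≤ M ^ 2 := by nlinarith
      have h10 := mul_le_mul_of_nonneg_left h8.1 (sq_nonneg (M : ℝ))
      have h11 := mul_le_mul_of_nonneg_left h8.2 (sq_nonneg (M : ℝ))
      rw [abs_le]
      constructor <;> linarith
    obtain ⟨k1, k2⟩ := potential_step (M := M) (by positivity) (by positivity)
      (by exact_mod_cast (by omega : n ≤ M)) h3 h4 hd hstep
    refine ⟨by simp [h1], ?_, ?_, ?_⟩
    · intro t ht
      rcases List.mem_cons.1 ht with rfl | ht
      · exact hsm
      · exact h2 t ht
    · simp only [e]; exact k1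
    · intro i; rw [e]; exact k2 i

/-- After `M` steps the squared deviation is `O(M ^ 5)`. Dividing the deviation by `M³`, that is, by
`M` steps and by the scale `M²`, leaves `O(1/√M)`; the approximation of the target contributes only
`2048 / M`. -/
theorem greedy_spec (hM : 0 < M) (hR : SepTensor R)
    (hG : ∀ μ ν α β, |(G μ ν α β : ℝ) - M * R μ ν α β| ≤ 512) (hv : v ∈ net M) (hw : w ∈ net M) :
    (greedy M G v w).length = M ∧ (∀ s ∈ greedy M G v w, s.1 ∈ net M ∧ s.2 ∈ net M) ∧
    ∀ μ ν, |(∑ α, ∑ β, R μ ν α β * bloch M v α * bloch M w β) / 4 -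
      ((greedy M G v w).map fun s => bloch M s.1 μ * bloch M s.2 ν).sum / M| ≤ 20000 / √M := by
  obtain ⟨h1, h2, h3, -⟩ := greedy_potential hM hR hG hv hw M le_rfl
  refine ⟨h1, fun s hs => mem_netPairs.1 (h2 s hs), fun μ ν => ?_⟩
  change (greedy M G v w).length = M at h1
  change ∑ i, deviation M G v w (greedy M G v w) i ^ 2 ≤ _ at h3
  have hM' : (1 : ℝ) ≤ M := by exact_mod_cast hM
  have hM0 : (0 : ℝ) < M := by linarith
  have hsq : √(M : ℝ) ^ 2 = M := Real.sq_sqrt hM0.le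
  have hs0 : 0 < √(M : ℝ) := Real.sqrt_pos.2 hM0
  have hs1 : √(M : ℝ) ≤ M := by
    rw [Real.sqrt_le_left hM0.le]; nlinarith
  set l := greedy M G v w with hl
  -- `14350 = 7 * 2050`: the potential bound is `48 * 2050² * M ^ 5` and `48 ≤ 7²`.
  have h4 : |deviation M G v w l (μ, ν)| ≤ 14350 * M ^ 2 * √M := by
    refine abs_le_of_sq_le_sq ?_ (by positivity)
    have h5 := Finset.single_le_sum (f := fun i => deviation M G v w l i ^ 2)
      (fun i _ => sq_nonneg _) (Finset.mem_univ (μ, ν))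
    refine h5.trans (h3.trans ?_)
    rw [mul_pow (14350 * (M : ℝ) ^ 2), hsq]
    have : (0 : ℝ) ≤ (M : ℝ) ^ 5 := by positivity
    simp
    nlinarith
  have h5 : deviation M G v w l (μ, ν) =
      M ^ 2 * (l.map fun s => bloch M s.1 μ * bloch M s.2 ν).sum - M * target M G v w (μ, ν) := by
    have : ∀ l : List (Vec × Vec), deviation M G v w l (μ, ν) =
        M ^ 2 * (l.map fun s => bloch M s.1 μ * bloch M s.2 ν).sum -
          l.length * target M G v w (μ, ν) := by
      intro l
      induction l with
      | nil => simp [deviation]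
      | cons s l ih =>
        have e : deviation M G v w (s :: l) (μ, ν) = (outer s (μ, ν) - target M G v w (μ, ν)) +
          deviation M G v w l (μ, ν) := rfl
        rw [e, ih, List.map_cons, List.sum_cons, List.length_cons]
        simp only [outer, bloch]
        push_cast
        field_simp
        ring
    rw [this, h1]
  have h6 := target_near hM hG hv hw (μ, ν)
  set T := (∑ α, ∑ β, R μ ν α β * bloch M v α * bloch M w β) / 4
  set S := (l.map fun s => bloch M s.1 μ * bloch M s.2 ν).sum
  have h7 : T - S / M = -(target M G v w (μ, ν) - M ^ 2 * T) / M ^ 2 -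
      deviation M G v w l (μ, ν) / (M ^ 2 * M) := by
    rw [h5]; field_simp; ring
  rw [h7]
  have h8 : |-(target M G v w (μ, ν) - M ^ 2 * T) / M ^ 2| ≤ 2048 / √M := by
    rw [abs_div, abs_neg, abs_of_pos (by positivity : (0 : ℝ) < M ^ 2)]
    calc _ ≤ 2048 * M / (M : ℝ) ^ 2 := div_le_div_of_nonneg_right h6 (by positivity)
      _ = 2048 / M := by field_simp
      _ ≤ _ := div_le_div_of_nonneg_left (by norm_num) hs0 hs1
  have h9 : |deviation M G v w l (μ, ν) / (M ^ 2 * M)| ≤ 14350 / √M := by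
    rw [abs_div, abs_of_pos (by positivity : (0 : ℝ) < M ^ 2 * M)]
    calc _ ≤ 14350 * M ^ 2 * √M / ((M : ℝ) ^ 2 * M) := div_le_div_of_nonneg_right h4 (by positivity)
      _ = 14350 * √M / M := by field_simp
      _ = 14350 * √M / √M ^ 2 := by rw [hsq]
      _ = 14350 / √M := by field_simp
  refine (abs_sub _ _).trans ((add_le_add h8 h9).trans ?_)
  rw [← add_div]
  exact div_le_div_of_nonneg_right (by norm_num) hs0.le

end

end SepSim
-- From coin tosses to the distribution of the simulation.
namespace SepSim
open Matrix
open scoped ComplexOrder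

/-! ### Averages over coin tosses -/

/-- The average of a function over all sequences of `n` coin tosses. -/
noncomputable def avg : ℕ → (List Bool → ℝ) → ℝ
  | 0, F => F []
  | n + 1, F => (avg n (fun c => F (false :: c)) + avg n (fun c => F (true :: c))) / 2

theorem avg_const (n : ℕ) (r : ℝ) : avg n (fun _ => r) = r := by
  induction n with
  | zero => rfl
  | succ n ih => rw [avg, ih]; ring

theorem length_half {β : Type} (l : List β) :
    (half true l).length = (l.length + 1) / 2 ∧ (half false l).length = l.length / 2 := by
  induction l with
  | nil => simp [half]
  | cons b l ih =>
    obtain ⟨h1, h2⟩ := ih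
    constructor <;> simp only [half, List.length_cons, h1, h2] <;> omega

theorem sum_half {β : Type} (l : List β) (f : β → ℝ) :
    ((half true l).map f).sum + ((half false l).map f).sum = (l.map f).sum := by
  induction l with
  | nil => simp [half]
  | cons b l ih =>
    simp only [half, List.map_cons, List.sum_cons, ← ih]; ring

/-- The two halves of a list of length `2 ^ (m + 1)` have equal length, so one fair toss followed by
a uniform choice from a half is a uniform choice from the list. Exactly `m` tosses are read; the
other `n` are handed on. -/
theorem avg_selectStep {β : Type} (d : β) (F : β × List Bool → ℝ) (n : ℕ) (m : ℕ) :
    ∀ (k : ℕ) (l : List β), m ≤ k → l.length = 2 ^ m →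
      avg (m + n) (fun c => F ((selectStep^[k] (l, c)).1.headD d, (selectStep^[k] (l, c)).2)) =
        (l.map fun b => avg n fun c => F (b, c)).sum / 2 ^ m := by
  induction m with
  | zero =>
    intro k l _ hl
    obtain ⟨b, rfl⟩ := List.length_eq_one_iff.1 hl
    have : ∀ c, selectStep^[k] ([b], c) = ([b], c) := fun c =>
      Function.iterate_fixed (by simp [selectStep]) k
    simp [this]
  | succ m ih =>
    intro k l hk hl
    obtain ⟨k, rfl⟩ : ∃ k', k = k' + 1 := ⟨k - 1, by omega⟩
    have h1 : 0 < 2 ^ m := by positivity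
    rw [pow_succ] at hl
    have ht : l.tail.isEmpty = false := by
      match l, hl with
      | [], hl => simp at hl
      | [b], hl => simp at hl; omega
      | _ :: _ :: _, _ => rfl
    have hs : ∀ b c, selectStep (l, b :: c) = (half b l, c) := fun b c => by
      simp [selectStep, ht]
    rw [show m + 1 + n = (m + n) + 1 by omega, avg]
    simp only [Function.iterate_succ_apply, hs]
    obtain ⟨e1, e2⟩ := length_half l
    rw [ih k (half false l) (by omega) (by omega), ih k (half true l) (by omega) (by omega),
      ← sum_half l, pow_succ]
    field_simp
    ring

theorem avg_select {β : Type} (d : β) (F : β × List Bool → ℝ) (n m : ℕ) (l : List β)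
    (hl : l.length = 2 ^ m) : avg (m + n) (fun c => F (select d l c)) =
      (l.map fun b => avg n fun c => F (b, c)).sum / 2 ^ m :=
  avg_selectStep d F n m l.length l (by rw [hl]; exact Nat.lt_two_pow_self.le) hl

/-! ### The distribution of the simulated states -/

/-- The average of a function of the simulated states. -/
noncomputable def chain {V : Type} [AddCommGroup V] [Module ℝ V] (M : ℕ)
    (tabs : List Tensor × List Tensor) (F : List Vec → V) : List RawOp → List Vec → V
  | [], a => F a
  | o :: ops, a =>
    (M : ℝ)⁻¹ • ((choices M tabs a o).map fun s => chain M tabs F ops (o.place a s)).sum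

theorem length_choices (M : ℕ) (tabs : List Tensor × List Tensor) (a : List Vec) (o : RawOp) :
    (choices M tabs a o).length = M := by
  have : ∀ (G : Tensor) (v w : Vec) (k : ℕ),
      ((fun l => greedyStep M G v w l :: l)^[k] []).length = k := by
    intro G v w k
    induction k with
    | zero => rfl
    | succ k ih => rw [Function.iterate_succ_apply', List.length_cons, ih]
  exact this _ _ _ M

/-- Each operation uses exactly `m` tosses because its list of choices has length `M = 2 ^ m`. This
lets the averages over consecutive segments of tosses be nested. -/
theorem avg_foldl_stepOp (M m : ℕ) (hM : M = 2 ^ m) (tabs : List Tensor × List Tensor) (n : ℕ)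
    (F : List Vec × List Bool → ℝ) (ops : List RawOp) :
    ∀ a : List Vec, avg (ops.length * m + n) (fun c => F (ops.foldl (stepOp M tabs) (a, c))) =
      chain M tabs (fun a => avg n fun c => F (a, c)) ops a := by
  induction ops with
  | nil => intro a; simp [chain]
  | cons o ops ih =>
    intro a
    have h := avg_select (pole M false, pole M false)
      (fun r => F (ops.foldl (stepOp M tabs) (o.place a r.1, r.2))) (ops.length * m + n) m
      (choices M tabs a o) (by rw [length_choices, hM])
    rw [List.length_cons, show (ops.length + 1) * m + n = m + (ops.length * m + n) by ring]
    simp only [List.foldl_cons, stepOp]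
    rw [h, chain]
    simp only [ih]
    rw [smul_eq_mul, hM, div_eq_inv_mul]
    push_cast
    rfl

/-- The probability of a measurement outcome of a qubit. -/
noncomputable def bitProb (M : ℕ) (v : Vec) (b : Bool) : ℝ := (qubitMat (bloch M v) b b).re

/-- The average of a function of the measurement outcomes. -/
noncomputable def meas (M : ℕ) : (List Bool → ℝ) → List Vec → ℝ
  | H, [] => H []
  | H, v :: a => ∑ b, bitProb M v b * meas M (fun z => H (b :: z)) a

theorem avg_foldl_stepBit (M m : ℕ) (hM : M = 2 ^ m) (n : ℕ) (a : List Vec)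
    (ha : ∀ v ∈ a, v ∈ net M) :
    ∀ (H : List Bool → ℝ) (out : List Bool),
      avg (a.length * (m + 1) + n) (fun c => H (a.foldl stepBit (out, c)).1) =
        meas M (fun z => H (out ++ z)) a := by
  induction a with
  | nil => intro H out; simp [meas, avg_const]
  | cons v a ih =>
    intro H out
    have hv := ha v (by simp)
    have h3 := abs_le.1 (abs_le_of_mem_net hv 3)
    have h0 := (mem_net.1 hv).1
    have hM0 : (0 : ℝ) < M := by rw [hM]; positivity
    have e3 : -(M : ℤ) ≤ v 3 ∧ v 3 ≤ M := ⟨by exact_mod_cast h3.1, by exact_mod_cast h3.2⟩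
    -- A measured bit takes `m + 1` tosses: `bitChoices v` has length `2 M = 2 ^ (m + 1)`.
    have h := avg_select false (fun r => H (a.foldl stepBit (out ++ [r.1], r.2)).1)
      (a.length * (m + 1) + n) (m + 1) (bitChoices v) (by
        rw [bitChoices, List.length_append, List.length_replicate, List.length_replicate, h0,
          pow_succ, ← hM]
        omega)
    rw [List.length_cons, show (a.length + 1) * (m + 1) + n = m + 1 + (a.length * (m + 1) + n) by ring]
    simp only [List.foldl_cons, stepBit]
    rw [h]
    simp only [ih (fun v hv => ha v (by simp [hv])), bitChoices, List.map_append, List.map_replicate,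
      List.sum_append, List.sum_replicate, nsmul_eq_mul, meas, Fintype.sum_bool, bitProb,
      List.append_assoc, List.singleton_append]
    obtain ⟨q1, q2, -, -⟩ := qubitMat_apply (bloch M v)
    rw [q1, q2, Complex.ofReal_re, Complex.ofReal_re, pow_succ]
    have c1 : (((v 0 + v 3).toNat : ℕ) : ℝ) = M + v 3 := by
      have : (((v 0 + v 3).toNat : ℕ) : ℤ) = M + v 3 := by rw [h0]; omega
      exact_mod_cast this
    have c2 : (((v 0 - v 3).toNat : ℕ) : ℝ) = M - v 3 := by
      have : (((v 0 - v 3).toNat : ℕ) : ℤ) = M - v 3 := by rw [h0]; omega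
      exact_mod_cast this
    have c3 : (2 : ℝ) ^ m = M := by rw [hM]; push_cast; rfl
    rw [c1, c2, c3]
    simp only [bloch, h0, Int.cast_natCast]
    field_simp
    ring

theorem meas_ofFn (M : ℕ) {q : ℕ} (a : Fin q → Vec) (H : List Bool → ℝ) :
    meas M H (List.ofFn a) =
      ∑ z : Fin q → Bool, (∏ i, bitProb M (a i) (z i)) * H (List.ofFn z) := by
  induction q generalizing H with
  | zero => simp [meas]
  | succ q ih =>
    rw [List.ofFn_succ, meas, ← (Fin.consEquiv fun _ => Bool).sum_comp, Fintype.sum_prod_type]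
    refine Finset.sum_congr rfl fun b _ => ?_
    rw [ih, Finset.mul_sum]
    refine Finset.sum_congr rfl fun z _ => ?_
    rw [Fin.prod_univ_succ, List.ofFn_succ]
    simp [Fin.consEquiv, mul_assoc]

/-! ### The simulated states approximate the state of the quantum computer -/

/-- The product state given by a list of Bloch vectors. -/
noncomputable def listState (M q : ℕ) (a : List Vec) : QMatrix q :=
  prodState fun i => qubitMat (bloch M (a.getD i 0))

/-- The list consists of `q` elements of the net. -/
def Valid (M q : ℕ) (a : List Vec) : Prop := a.length = q ∧ ∀ v ∈ a, v ∈ net M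

theorem Valid.getD_mem {M q : ℕ} {a : List Vec} (h : Valid M q a) (i : Fin q) :
    a.getD i 0 ∈ net M := by
  have hi : (i : ℕ) < a.length := h.1 ▸ i.2
  rw [List.getD_eq_getElem _ _ hi]
  exact h.2 _ (List.getElem_mem hi)

theorem Valid.set {M q : ℕ} {a : List Vec} (h : Valid M q a) (i : ℕ) {v : Vec} (hv : v ∈ net M) :
    Valid M q (a.set i v) :=
  ⟨by rw [List.length_set, h.1], fun w hw => by
    rcases List.mem_or_eq_of_mem_set hw with hw | rfl
    · exact h.2 w hw
    · exact hv⟩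

theorem mem_choices {M : ℕ} {tabs : List Tensor × List Tensor} {a : List Vec} {o : RawOp}
    {s : Vec × Vec} (h : s ∈ choices M tabs a o) : s.1 ∈ net M ∧ s.2 ∈ net M := by
  rcases List.mem_cons.1 (mem_greedy h) with rfl | h
  · exact ⟨pole_mem_net _ _, pole_mem_net _ _⟩
  · exact mem_netPairs.1 h

theorem Valid.place {M q : ℕ} {a : List Vec} (h : Valid M q a) (o : RawOp) {s : Vec × Vec}
    (hs : s.1 ∈ net M ∧ s.2 ∈ net M) : Valid M q (o.place a s) := by
  unfold RawOp.place
  cases o.kind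
  · exact h.set _ hs.1
  · exact (h.set _ hs.1).set _ hs.2

theorem listState_set {M q : ℕ} {a : List Vec} (h : a.length = q) (i : Fin q) (v : Vec) :
    (fun k : Fin q => qubitMat (bloch M ((a.set i v).getD k 0))) =
      Function.update (fun k : Fin q => qubitMat (bloch M (a.getD k 0))) i (qubitMat (bloch M v)) := by
  ext1 k
  by_cases hk : k = i
  · subst hk
    have hi : (k : ℕ) < (a.set k v).length := by rw [List.length_set, h]; exact k.2
    rw [Function.update_self, List.getD_eq_getElem _ _ hi, List.getElem_set_self]
  · rw [Function.update_of_ne hk]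
    congr 2
    simp only [List.getD_eq_getElem?_getD]
    rw [List.getElem?_set_ne]
    exact fun h => hk (Fin.ext h.symm)

theorem prodState_qubitMat {q : ℕ} (B : Fin q → Matrix Bool Bool ℂ) (i : Fin q) (x : Fin 4 → ℝ) :
    prodState (Function.update B i (qubitMat x)) =
      ∑ μ, (x μ / 2) • prodState (Function.update B i (pauli μ)) := by
  ext z w
  simp only [Matrix.sum_apply, Matrix.smul_apply, prodState_update, qubitMat, Finset.sum_mul,
    Complex.real_smul, smul_eq_mul, mul_assoc]

theorem prodState_qubitMat₂ {q : ℕ} (B : Fin q → Matrix Bool Bool ℂ) {i j : Fin q} (hij : i ≠ j)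
    (x y : Fin 4 → ℝ) :
    prodState (Function.update (Function.update B i (qubitMat x)) j (qubitMat y)) =
      ∑ p : Fin 4 × Fin 4, (x p.1 * y p.2 / 4) •
        prodState (Function.update (Function.update B i (pauli p.1)) j (pauli p.2)) := by
  ext z w
  simp only [Matrix.sum_apply, Matrix.smul_apply, prodState_update₂ B hij, Complex.real_smul]
  have := congrFun (congrFun (kronecker_qubitMat x y) (z i, z j)) (w i, w j)
  simp only [kroneckerMap_apply, Matrix.sum_apply, Matrix.smul_apply, smul_eq_mul] at this
  rw [this, Fintype.sum_prod_type, Finset.sum_mul]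
  refine Finset.sum_congr rfl fun α _ => ?_
  rw [Finset.sum_mul]
  exact Finset.sum_congr rfl fun β _ => by ring

theorem list_sum_sum_smul {β ι V : Type} [Fintype ι] [AddCommGroup V] [Module ℝ V] (l : List β)
    (f : β → ι → ℝ) (A : ι → V) :
    (l.map fun b => ∑ i, f b i • A i).sum = ∑ i, (l.map fun b => f b i).sum • A i := by
  induction l with
  | nil => simp
  | cons b l ih =>
    simp only [List.map_cons, List.sum_cons, ih, add_smul, Finset.sum_add_distrib]

/-- The operation without reference to the gate set. -/
def Op.raw {𝒢 : GateSet} {q : ℕ} : Op 𝒢 q → RawOp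
  | .one g i => ⟨false, g, i, 0⟩
  | .two g i j _ => ⟨true, g, i, j⟩

/-- The tables approximate the gates. -/
def GoodTables (𝒢 : GateSet) (M : ℕ) (tabs : List Tensor × List Tensor) : Prop :=
  (∀ g : Fin 𝒢.numOne, ∀ μ ν α β,
    |(tabs.1.getD g 0 μ ν α β : ℝ) - M * (𝒢.one g).realOne μ ν α β| ≤ 512) ∧
  ∀ g : Fin 𝒢.numTwo, ∀ μ ν α β,
    |(tabs.2.getD g 0 μ ν α β : ℝ) - M * (𝒢.two g).realTwo μ ν α β| ≤ 512

section
variable {𝒢 : GateSet} {q M : ℕ} {tabs : List Tensor × List Tensor}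

/-- The exact image and the mixture are both expanded in products with Pauli matrices in place of
the changed factors. Their coefficients differ by the error of `greedy_spec`, up to the
normalization, and each such product has a bounded trace norm. -/
theorem traceBound_op (hM : 0 < M) (ht : GoodTables 𝒢 M tabs)
    (hsep : ∀ g, (𝒢.two g).IsSeparable) {a : List Vec} (ha : Valid M q a) (o : Op 𝒢 q) :
    TraceBound (o.apply (listState M q a) - (M : ℝ)⁻¹ • ((choices M tabs a o.raw).map fun s =>
      listState M q (o.raw.place a s)).sum) (320000 / √M) := by
  set B : Fin q → Matrix Bool Bool ℂ := fun k => qubitMat (bloch M (a.getD k 0)) with hB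
  have hc : ∀ i : Fin q, Cone (bloch M (a.getD i 0)) := fun i => (cone_bloch hM (ha.getD_mem i)).1
  have hB1 : ∀ i, (B i).PosSemidef := fun i => (hc i).posSemidef
  have hB2 : ∀ i, (B i).trace = 1 := fun i => by
    rw [hB, trace_qubitMat, (cone_bloch hM (ha.getD_mem i)).2, Complex.ofReal_one]
  cases o with
  | one g i =>
    obtain ⟨-, -, h⟩ := greedy_spec hM (𝒢.one g).sepTensor_realOne (ht.1 g) (ha.getD_mem i)
      (pole_mem_net M false)
    set x := coord ((𝒢.one g).map (B i)) with hx
    have h1 : (Op.one g i : Op 𝒢 q).apply (listState M q a) =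
        ∑ μ, (x μ / 2) • prodState (Function.update B i (pauli μ)) := by
      rw [← prodState_qubitMat, hx, qubitMat_coord ((𝒢.one g).posSemidef (hB1 i)).isHermitian]
      exact applyOne_prodState _ _ _
    have h2 : ∀ s : Vec × Vec, listState M q ((Op.one g i : Op 𝒢 q).raw.place a s) =
        ∑ μ, (bloch M s.1 μ / 2) • prodState (Function.update B i (pauli μ)) := fun s => by
      rw [← prodState_qubitMat, hB, ← listState_set ha.1 i s.1]; rfl
    simp only [h1, h2]
    rw [list_sum_sum_smul, Finset.smul_sum, ← Finset.sum_sub_distrib]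
    simp only [smul_smul, ← sub_smul]
    -- Four terms of at most `20000 / √M` each, well below the bound needed for two-qubit gates.
    refine (TraceBound.sum _ (c := fun _ => 20000 / √M / 2 * 2) fun μ _ =>
      (((traceBound_pauli μ).prodState_update hB1 hB2 i).smul _).mono
        (mul_le_mul_of_nonneg_right ?_ zero_le_two)).mono ?_
    -- Taking `ν = 0` traces out the dummy qubit, all of whose states have component `0` equal to 1.
    · have h3 := h μ 0
      rw [(𝒢.one g).sum_realOne, (cone_bloch hM (pole_mem_net M false)).2, mul_one] at h3
      have h4 : (greedy M (tabs.1.getD g 0) (a.getD i 0) (pole M false)).map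
          (fun s => bloch M s.1 μ * bloch M s.2 0) =
          (greedy M (tabs.1.getD g 0) (a.getD i 0) (pole M false)).map fun s => bloch M s.1 μ :=
        List.map_congr_left fun s hs => by
          have hs' : s ∈ choices M tabs a (Op.one g i : Op 𝒢 q).raw := hs
          rw [(cone_bloch hM (mem_choices hs').2).2, mul_one]
      rw [h4] at h3
      have h5 : ∀ l : List (Vec × Vec), (l.map fun s => bloch M s.1 μ / 2).sum =
          (l.map fun s => bloch M s.1 μ).sum / 2 := fun l => by
        simp only [div_eq_mul_inv]; rw [List.sum_map_mul_right]
      have h6 : x μ / 2 - (M : ℝ)⁻¹ * ((choices M tabs a (Op.one g i : Op 𝒢 q).raw).map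
          fun s => bloch M s.1 μ / 2).sum = (x μ - ((greedy M (tabs.1.getD g 0) (a.getD i 0)
            (pole M false)).map fun s => bloch M s.1 μ).sum / M) / 2 := by
        rw [h5]
        show x μ / 2 - (M : ℝ)⁻¹ * (((greedy M (tabs.1.getD g 0) (a.getD i 0)
            (pole M false)).map fun s => bloch M s.1 μ).sum / 2) = _
        ring
      rw [h6, abs_div, abs_two]
      exact div_le_div_of_nonneg_right h3 zero_le_two
    · simp only [Finset.sum_const, Finset.card_univ, Fintype.card_fin]
      have : 0 ≤ 20000 / √(M : ℝ) := by positivity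
      have e : 320000 / √(M : ℝ) = 16 * (20000 / √(M : ℝ)) := by ring
      rw [e, nsmul_eq_mul]; push_cast; linarith
  | two g i j hij =>
    obtain ⟨-, -, h⟩ := greedy_spec hM (Gate.sepTensor_realTwo (hsep g)) (ht.2 g) (ha.getD_mem i)
      (ha.getD_mem j)
    set A : Fin 4 × Fin 4 → QMatrix q := fun p =>
      prodState (Function.update (Function.update B i (pauli p.1)) j (pauli p.2)) with hA
    have h1 : (Op.two g i j hij : Op 𝒢 q).apply (listState M q a) = ∑ p : Fin 4 × Fin 4,
        ((∑ α, ∑ β, (𝒢.two g).realTwo p.1 p.2 α β * bloch M (a.getD i 0) α *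
          bloch M (a.getD j 0) β) / 4 / 4) • A p :=
      (applyTwo_prodState (𝒢.two g) hij B _ _ _
        (Gate.map_eq_sum (hsep g) (hc i) (hc j))).trans
        (Finset.sum_congr rfl fun p _ => Complex.coe_smul _ _)
    have h2 : ∀ s : Vec × Vec, listState M q ((Op.two g i j hij : Op 𝒢 q).raw.place a s) =
        ∑ p : Fin 4 × Fin 4, (bloch M s.1 p.1 * bloch M s.2 p.2 / 4) • A p := fun s => by
      rw [hA, ← prodState_qubitMat₂ B hij, hB, ← listState_set ha.1 i s.1,
        ← listState_set (by rw [List.length_set, ha.1]) j s.2]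
      rfl
    simp only [h1, h2]
    rw [list_sum_sum_smul, Finset.smul_sum, ← Finset.sum_sub_distrib]
    simp only [smul_smul, ← sub_smul]
    -- Sixteen products of Pauli matrices, each of trace bound `2 * 2`, with coefficients off by
    -- `20000 / √M / 4`.
    refine (TraceBound.sum _ (c := fun _ => 20000 / √M / 4 * (2 * 2)) fun p _ =>
      (((traceBound_pauli p.1).prodState_update₂ hB1 hB2 hij (traceBound_pauli p.2)).smul _).mono
        (mul_le_mul_of_nonneg_right ?_ (by norm_num))).mono ?_
    · have h3 := h p.1 p.2
      have h5 : ∀ l : List (Vec × Vec), (l.map fun s => bloch M s.1 p.1 * bloch M s.2 p.2 / 4).sum =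
          (l.map fun s => bloch M s.1 p.1 * bloch M s.2 p.2).sum / 4 := fun l => by
        simp only [div_eq_mul_inv]; rw [List.sum_map_mul_right]
      have h6 : ∀ T S : ℝ, T / 4 - (M : ℝ)⁻¹ * (S / 4) = (T - S / M) / 4 := fun T S => by ring
      rw [h5, h6, abs_div, abs_of_pos (by norm_num : (0 : ℝ) < 4)]
      exact div_le_div_of_nonneg_right h3 (by norm_num)
    · simp only [Finset.sum_const, Finset.card_univ, Fintype.card_prod, Fintype.card_fin]
      have e : 320000 / √(M : ℝ) = 16 * (20000 / √(M : ℝ)) := by ring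
      rw [e, nsmul_eq_mul]; push_cast; linarith

/-- The effect of a sequence of operations, as a linear map. -/
noncomputable def opsLin : List (Op 𝒢 q) → (QMatrix q →ₗ[ℝ] QMatrix q)
  | [] => LinearMap.id
  | o :: ops => opsLin ops ∘ₗ
    { toFun := o.apply
      map_add' := o.apply_add
      map_smul' := fun r ρ => by
        rw [← Complex.coe_smul, o.apply_smul, Complex.coe_smul, RingHom.id_apply] }

theorem opsLin_apply (ops : List (Op 𝒢 q)) (ρ : QMatrix q) :
    opsLin ops ρ = ops.foldl (fun ρ o => o.apply ρ) ρ := by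
  induction ops generalizing ρ with
  | nil => rfl
  | cons o ops ih => exact ih _

theorem TraceBound.opsLin {ρ : QMatrix q} {c : ℝ} (h : TraceBound ρ c) (ops : List (Op 𝒢 q)) :
    TraceBound (opsLin ops ρ) c := by
  induction ops generalizing ρ with
  | nil => exact h
  | cons o ops ih => exact ih (h.apply o)

theorem TraceBound.list_sum {β n : Type} [Fintype n] {c : ℝ} (l : List β) {f : β → Matrix n n ℂ}
    (h : ∀ b ∈ l, TraceBound (f b) c) : TraceBound (l.map f).sum (l.length * c) := by
  induction l with
  | nil => simpa using TraceBound.zero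
  | cons b l ih =>
    rw [List.map_cons, List.sum_cons]
    refine ((h b (by simp)).add (ih fun b hb => h b (by simp [hb]))).mono ?_
    rw [List.length_cons]; push_cast; linarith

/-- A hybrid argument. The error of the leading operation passes through the remaining ones without
growing, and the errors of the later simulated steps, averaged over the choices, are bounded by
induction. -/
theorem traceBound_chain (hM : 0 < M) (ht : GoodTables 𝒢 M tabs)
    (hsep : ∀ g, (𝒢.two g).IsSeparable) (ops : List (Op 𝒢 q)) :
    ∀ a : List Vec, Valid M q a →
      TraceBound (opsLin ops (listState M q a) -
        chain M tabs (listState M q) (ops.map Op.raw) a) (ops.length * (320000 / √M)) := by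
  induction ops with
  | nil =>
    intro a _
    simpa [opsLin, chain] using (TraceBound.zero (n := Fin q → Bool))
  | cons o ops ih =>
    intro a ha
    have hM' : (M : ℝ) ≠ 0 := by exact_mod_cast hM.ne'
    set l := choices M tabs a o.raw with hl
    have h1 := (traceBound_op hM ht hsep ha o).opsLin ops
    have h2 := (TraceBound.list_sum l (f := fun s => opsLin ops (listState M q (o.raw.place a s)) -
      chain M tabs (listState M q) (ops.map Op.raw) (o.raw.place a s))
      fun s hs => ih _ (ha.place _ (mem_choices hs))).smul (M : ℝ)⁻¹
    have e : ∀ l : List (Vec × Vec), (l.map fun s => opsLin ops (listState M q (o.raw.place a s)) -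
        chain M tabs (listState M q) (ops.map Op.raw) (o.raw.place a s)).sum =
        opsLin ops (l.map fun s => listState M q (o.raw.place a s)).sum -
          (l.map fun s => chain M tabs (listState M q) (ops.map Op.raw) (o.raw.place a s)).sum := by
      intro l
      induction l with
      | nil => simp
      | cons s l ih => simp only [List.map_cons, List.sum_cons, ih, map_add]; abel
    refine ((h1.add h2).mono ?_ : TraceBound _ (((o :: ops).length : ℝ) * (320000 / √M))).congr ?_
    · rw [hl, length_choices, abs_of_nonneg (by positivity), List.length_cons, ← mul_assoc,
        inv_mul_cancel₀ hM']
      push_cast; linarith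
    · rw [e, map_sub, map_smul, smul_sub]
      simp only [List.map_cons, chain, opsLin, LinearMap.comp_apply, LinearMap.coe_mk,
        AddHom.coe_mk, ← hl]
      abel

theorem chain_congr {V : Type} [AddCommGroup V] [Module ℝ V] {F F' : List Vec → V}
    (h : ∀ a, Valid M q a → F a = F' a) (ops : List RawOp) :
    ∀ a, Valid M q a → chain M tabs F ops a = chain M tabs F' ops a := by
  induction ops with
  | nil => exact h
  | cons o ops ih =>
    intro a ha
    rw [chain, chain]
    congr 2
    exact List.map_congr_left fun s hs => ih _ (ha.place _ (mem_choices hs))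

/-- Averaging measurement statistics over simulated states is the same as taking the statistics of
the averaged state; this permits the error to be estimated for matrices. -/
theorem chain_map {V W : Type} [AddCommGroup V] [Module ℝ V] [AddCommGroup W] [Module ℝ W]
    (L : V →ₗ[ℝ] W) (F : List Vec → V) (ops : List RawOp) (a : List Vec) :
    chain M tabs (fun a => L (F a)) ops a = L (chain M tabs F ops a) := by
  induction ops generalizing a with
  | nil => rfl
  | cons o ops ih =>
    rw [chain, chain, map_smul, map_list_sum, List.map_map]
    congr 2
    exact List.map_congr_left fun s _ => ih _

theorem meas_eq (a : List Vec) (ha : Valid M q a) (H : List Bool → ℝ) :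
    meas M H a = ∑ z : Fin q → Bool, (listState M q a z z).re * H (List.ofFn z) := by
  have h : a = List.ofFn fun i : Fin q => a.getD i 0 := by
    refine List.ext_getElem (by simp [ha.1]) fun i h1 h2 => ?_
    simp [List.getElem?_eq_getElem h1]
  conv_lhs => rw [h]
  rw [meas_ofFn]
  refine Finset.sum_congr rfl fun z _ => ?_
  congr 1
  have hr : ∀ (v : Vec) (b : Bool), qubitMat (bloch M v) b b = ((bitProb M v b : ℝ) : ℂ) := by
    intro v b
    obtain ⟨h1, h2, -, -⟩ := qubitMat_apply (bloch M v)
    cases b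
    · rw [bitProb, h1, Complex.ofReal_re]
    · rw [bitProb, h2, Complex.ofReal_re]
  simp only [listState, prodState, hr]
  rw [← Complex.ofReal_prod, Complex.ofReal_re]

theorem listState_pole (hM : 0 < M) (x : Fin q → Bool) :
    listState M q ((List.ofFn x).map (pole M)) = Matrix.single x x 1 := by
  have hM' : (M : ℝ) ≠ 0 := by exact_mod_cast hM.ne'
  have h : ∀ b s t : Bool, qubitMat (bloch M (pole M b)) s t = if s = b ∧ t = b then 1 else 0 := by
    intro b s t
    obtain ⟨h1, h2, h3, h4⟩ := qubitMat_apply (bloch M (pole M b))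
    have p0 : bloch M (pole M b) 0 = 1 := by simp [bloch, pole, hM']
    have p1 : bloch M (pole M b) 1 = 0 := by simp [bloch, pole]
    have p2 : bloch M (pole M b) 2 = 0 := by simp [bloch, pole]
    have p3 : bloch M (pole M b) 3 = if b then -1 else 1 := by
      cases b <;> simp [bloch, pole, hM']
    rw [p0, p3] at h1 h2
    rw [p1, p2] at h3 h4
    cases s <;> cases t <;> simp only [h1, h2, h3, h4] <;> cases b <;>
      simp [Complex.ext_iff]
  ext z w
  have hg : ∀ i : Fin q, ((List.ofFn x).map (pole M)).getD i 0 = pole M (x i) := fun i => by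
    simp
  simp only [listState, prodState, hg, h]
  rw [Finset.prod_ite_zero]
  simp only [Finset.mem_univ, forall_true_left, Finset.prod_const_one, single_apply]
  refine if_congr ?_ rfl rfl
  simp only [funext_iff, forall_and]
  exact and_congr (forall_congr' fun i => eq_comm) (forall_congr' fun i => eq_comm)

theorem valid_pole (x : Fin q → Bool) : Valid M q ((List.ofFn x).map (pole M)) :=
  ⟨by simp, fun v hv => by
    obtain ⟨b, -, rfl⟩ := List.mem_map.1 hv
    exact pole_mem_net M b⟩

/-- The distribution of the bits that the algorithm samples. -/
theorem avg_sampleBits {m : ℕ} (hMm : M = 2 ^ m) (ops : List RawOp) (x : Fin q → Bool) {n : ℕ}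
    (hn : ops.length * m + q * (m + 1) ≤ n) (H : List Bool → ℝ) :
    avg n (fun c => H (sampleBits M tabs ops (List.ofFn x) c)) =
      ∑ z : Fin q → Bool, (chain M tabs (listState M q) ops ((List.ofFn x).map (pole M)) z z).re *
        H (List.ofFn z) := by
  obtain ⟨r, rfl⟩ := Nat.exists_eq_add_of_le hn
  rw [add_assoc]
  have h1 := avg_foldl_stepOp M m hMm tabs (q * (m + 1) + r)
    (fun st => H (st.1.foldl stepBit ([], st.2)).1) ops ((List.ofFn x).map (pole M))
  refine h1.trans ?_
  have h2 : ∀ a, Valid M q a → avg (q * (m + 1) + r) (fun c => H (a.foldl stepBit ([], c)).1) =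
      ∑ z : Fin q → Bool, (listState M q a z z).re * H (List.ofFn z) := by
    intro a ha
    have h3 := avg_foldl_stepBit M m hMm r a ha.2 H []
    rw [ha.1] at h3
    rw [h3]
    exact meas_eq a ha H
  rw [chain_congr (q := q) h2 ops _ (valid_pole x)]
  let L : QMatrix q →ₗ[ℝ] ℝ :=
    { toFun := fun ρ => ∑ z : Fin q → Bool, (ρ z z).re * H (List.ofFn z)
      map_add' := fun ρ ρ' => by
        simp only [Matrix.add_apply, Complex.add_re, add_mul, Finset.sum_add_distrib]
      map_smul' := fun r ρ => by
        simp only [Matrix.smul_apply, Complex.smul_re, smul_eq_mul, RingHom.id_apply,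
          Finset.mul_sum, mul_assoc] }
  exact chain_map L (listState M q) ops _

end

end SepSim
namespace SepSim

/-! ### The output distribution of the simulation -/

/-- Connects the recursive average with the counting in `SamplesWithin`: a function of the initial
`n` tosses has the same mean over all sequences of length `T`. -/
theorem avg_eq_sum (n : ℕ) : ∀ (T : ℕ), n ≤ T → ∀ F : List Bool → ℝ, avg n F =
    (∑ r : Fin T → Bool, F ((List.range n).map fun i => if h : i < T then r ⟨i, h⟩ else false)) /
      2 ^ T := by
  induction n with
  | zero =>
    intro T _ F
    have : (2 : ℝ) ^ T ≠ 0 := by positivity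
    simp [avg, this]
  | succ n ih =>
    intro T hT F
    obtain ⟨T, rfl⟩ : ∃ T', T = T' + 1 := ⟨T - 1, by omega⟩
    rw [avg, ih T (by omega), ih T (by omega), ← (Fin.consEquiv fun _ => Bool).sum_comp,
      Fintype.sum_prod_type, Fintype.sum_bool, List.range_succ_eq_map]
    have h : ∀ (b : Bool) (r : Fin T → Bool),
        (0 :: (List.range n).map Nat.succ).map (fun i => if h : i < T + 1 then
          (Fin.consEquiv fun _ : Fin (T + 1) => Bool) (b, r) ⟨i, h⟩ else false) =
        b :: (List.range n).map fun i => if h : i < T then r ⟨i, h⟩ else false := by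
      intro b r
      rw [List.map_cons, List.map_map]
      congr 1
      refine List.map_congr_left fun i _ => ?_
      by_cases hi : i < T
      · simp only [Function.comp_apply, Nat.succ_eq_add_one, Nat.add_lt_add_iff_right, hi, dif_pos]
        exact Fin.cons_succ (α := fun _ => Bool) b r ⟨i, hi⟩
      · simp [hi]
    simp only [h]
    rw [pow_succ]
    field_simp
    ring

/-- The bits of the measured qubits. -/
def Circuit.outcome {𝒢 : GateSet} (c : Circuit 𝒢) (bits : List Bool) : c.Outcome :=
  fun i => bits.getD i.1 false

/-- One bit for each qubit that tells whether it is measured. -/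
def Circuit.flags {𝒢 : GateSet} (c : Circuit 𝒢) : List Bool :=
  List.ofFn fun i => decide (i ∈ c.measured)

theorem encodeOutcome_outcome {𝒢 : GateSet} (c : Circuit 𝒢) (bits : List Bool) :
    c.encodeOutcome (c.outcome bits) = Enc.enc (restrictBits c.flags bits) := by
  have h : restrictBits c.flags bits = (List.finRange c.qubits).filterMap fun i =>
      if h : i ∈ c.measured then some (c.outcome bits ⟨i, h⟩) else none := by
    rw [restrictBits, Circuit.flags, List.length_ofFn, ← List.map_coe_finRange_eq_range, List.flatMap_map,
      List.filterMap_eq_flatMap_toList]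
    congr 1
    ext1 i
    by_cases hi : i ∈ c.measured <;> simp [hi, Circuit.outcome]
  rw [h]
  rfl

theorem Op.encode_eq {𝒢 : GateSet} {q : ℕ} (o : Op 𝒢 q) : o.encode = Enc.enc o.raw := by
  cases o <;> rfl

/-- The algorithm thus works on operations without reference to a gate set, which is why its running
time is uniform in `𝒢`. -/
theorem Circuit.encode_eq {𝒢 : GateSet} (c : Circuit 𝒢) :
    c.encode = Enc.enc (c.ops.map Op.raw, c.flags) := by
  have : c.ops.map Op.encode = (c.ops.map Op.raw).map Enc.enc := by
    rw [List.map_map]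
    exact List.map_congr_left fun o _ => o.encode_eq
  rw [Circuit.encode, this]
  rfl

/-- The fraction of the sequences of `T` coin tosses that lead to the outcome `y`. -/
noncomputable def tossProb {Y : Type} [DecidableEq Y] (T n : ℕ) (F : List Bool → Y) (y : Y) : ℝ :=
  ((Finset.univ.filter fun r : Fin T → Bool =>
    F ((List.range n).map fun i => if h : i < T then r ⟨i, h⟩ else false) = y).card : ℝ) / 2 ^ T

theorem tossProb_eq_avg {Y : Type} [DecidableEq Y] {T n : ℕ} (h : n ≤ T) (F : List Bool → Y)
    (y : Y) : tossProb T n F y = avg n fun c => if F c = y then 1 else 0 := by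
  rw [avg_eq_sum n T h, tossProb, Finset.sum_boole]

theorem l1Dist_sampleBits_le {𝒢 : GateSet} {M m : ℕ} {tabs : List Tensor × List Tensor}
    (hMm : M = 2 ^ m) (ht : GoodTables 𝒢 M tabs) (hsep : ∀ g, (𝒢.two g).IsSeparable)
    (c : Circuit 𝒢) (x : Fin c.qubits → Bool) {n T : ℕ}
    (hn : c.size * m + c.qubits * (m + 1) ≤ n) (hT : n ≤ T) :
    l1Dist (c.outputProb x) (tossProb T n fun l =>
      c.outcome (sampleBits M tabs (c.ops.map Op.raw) (List.ofFn x) l)) ≤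
        c.size * (160000 / √M) := by
  have hM : 0 < M := by rw [hMm]; positivity
  have h := (traceBound_chain hM ht hsep c.ops _ (valid_pole x)).sum_abs_le
    (fun (z : Fin c.qubits → Bool) => (fun i => z i.1 : c.Outcome))
  rw [listState_pole hM, opsLin_apply] at h
  have e : ∀ y : c.Outcome, c.outputProb x y - tossProb T n (fun l =>
      c.outcome (sampleBits M tabs (c.ops.map Op.raw) (List.ofFn x) l)) y =
      ∑ z : Fin c.qubits → Bool, if (fun i => z i.1 : c.Outcome) = y then
        ((c.ops.foldl (fun ρ o => o.apply ρ) (Matrix.single x x 1) -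
          chain M tabs (listState M c.qubits) (c.ops.map Op.raw) ((List.ofFn x).map (pole M)))
            z z).re else 0 := by
    intro y
    rw [tossProb_eq_avg hT]
    have hn' : (c.ops.map Op.raw).length * m + c.qubits * (m + 1) ≤ n := by
      rwa [List.length_map]
    rw [avg_sampleBits (tabs := tabs) hMm (c.ops.map Op.raw) x hn'
      fun l => if c.outcome l = y then 1 else 0, Circuit.outputProb, ← Finset.sum_sub_distrib]
    refine Finset.sum_congr rfl fun z _ => ?_
    have : c.outcome (List.ofFn z) = fun i => z i.1 := by
      ext1 i
      simp [Circuit.outcome]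
    rw [this]
    split_ifs
    · rw [mul_one, Matrix.sub_apply, Complex.sub_re]; rfl
    · simp
  rw [l1Dist]
  simp only [e]
  -- The trace norm bounds the full sum of absolute differences; `l1Dist` is half of it.
  have : (c.ops.length : ℝ) * (320000 / √M) = 2 * (c.size * (160000 / √M)) := by
    rw [Circuit.size]; ring
  linarith

theorem l1Dist_sampleBits_lt {𝒢 : GateSet} {M m e : ℕ} {tabs : List Tensor × List Tensor}
    (hMm : M = 2 ^ m) (ht : GoodTables 𝒢 M tabs) (hsep : ∀ g, (𝒢.two g).IsSeparable)
    (c : Circuit 𝒢) (x : Fin c.qubits → Bool) {n T : ℕ}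
    (hn : c.size * m + c.qubits * (m + 1) ≤ n) (hT : n ≤ T) (he : 0 < e)
    (hM : (160000 * ((c.size + 1) * e)) ^ 2 ≤ M) :
    l1Dist (c.outputProb x) (tossProb T n fun l =>
      c.outcome (sampleBits M tabs (c.ops.map Op.raw) (List.ofFn x) l)) < 1 / e := by
  refine (l1Dist_sampleBits_le hMm ht hsep c x hn hT).trans_lt ?_
  have he' : (0 : ℝ) < e := by exact_mod_cast he
  have h1 : 160000 * (((c.size : ℝ) + 1) * e) ≤ √M := by
    rw [← Real.sqrt_sq (by positivity : 0 ≤ 160000 * (((c.size : ℝ) + 1) * e))]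
    exact Real.sqrt_le_sqrt (by exact_mod_cast hM)
  have h2 : (0 : ℝ) < √M := lt_of_lt_of_le (by positivity) h1
  rw [← mul_div_assoc, div_lt_div_iff₀ h2 he']
  nlinarith

end SepSim
-- Gate tables and the sampling program.
namespace SepSim
open Enc

/-! ### Tables of approximations -/

/-- The positive numbers. -/
abbrev Pos : Type := {N : ℕ // 0 < N}

/-- The function is computable in time `O(N ^ d)`, and its values have size `O(N)`. -/
def Tab {α : Type} [Enc α] (d : ℕ) (f : Pos → α) : Prop :=
  ∃ (P : Prog) (T : Pos → ℕ) (K : ℕ), CompIn P f T ∧ (∀ N, T N ≤ K * N.1 ^ d) ∧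
    ∀ N, sz (f N) ≤ K * N.1

section
variable {α β : Type} [Enc α] [Enc β] {d : ℕ}

theorem Tab.pair {f : Pos → α} {g : Pos → β} (hf : Tab d f) (hg : Tab d g) :
    Tab d fun N => (f N, g N) := by
  obtain ⟨P, T, K, h, hT, hs⟩ := hf
  obtain ⟨Q, U, L, h', hU, hs'⟩ := hg
  refine ⟨_, _, K + L + 10, h.pair h', fun N => ?_, fun N => ?_⟩
  · have h1 := hT N
    have h2 := hU N
    have h3 : 1 ≤ N.1 ^ d := Nat.one_le_pow _ _ N.2
    nlinarith
  · have h1 := hs N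
    have h2 := hs' N
    have h3 := N.2
    rw [sz_pair]
    nlinarith

theorem Tab.congr_enc {f : Pos → α} (hf : Tab d f) {g : Pos → β} (h : ∀ N, enc (g N) = enc (f N)) :
    Tab d g := by
  obtain ⟨P, T, K, h', hT, hs⟩ := hf
  refine ⟨P, T, K, fun N s ω hN => ?_, hT, fun N => ?_⟩
  · rw [h]; exact h' N s ω hN
  · unfold sz; rw [h]; exact hs N

theorem Tab.bool {f : Pos → Bool → α} (hf : ∀ b, Tab d fun N => f N b) : Tab d f :=
  ((hf false).pair (hf true)).congr_enc fun _ => rfl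

theorem Tab.nil : Tab d fun _ => ([] : List α) :=
  ⟨.assign 0 .nil, fun _ => 2, 2, fun _ s ω _ => ⟨_, _, .assign _ _ _ _, by simp [Expr.eval]; rfl,
    le_rfl⟩, fun N => le_mul_of_one_le_right zero_le_two (Nat.one_le_pow _ _ N.2),
    fun N => by rw [sz_nil]; have := N.2; omega⟩

theorem Tab.ofFn {n : ℕ} {f : Fin n → Pos → α} (hf : ∀ i, Tab d (f i)) :
    Tab d fun N => List.ofFn fun i => f i N := by
  induction n with
  | zero => simpa using Tab.nil
  | succ n ih =>
    refine ((hf 0).pair (ih fun i => hf i.succ)).congr_enc fun N => ?_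
    rw [List.ofFn_succ]
    rfl

end

/-- The output is within 1 of `N r`, so its unary size is `O(N)` whatever `d` is. -/
theorem ApproximableInTime.exists_tab {d : ℕ} {r : ℝ} (h : ApproximableInTime d r) :
    ∃ f : Pos → ℤ, (∀ N, |(f N : ℝ) - N.1 * r| ≤ 1) ∧ Tab d f := by
  obtain ⟨P, K, h⟩ := h
  choose f hf hP using fun N : Pos => h N.1 N.2
  have hf' : ∀ N, |(f N : ℝ) - N.1 * r| ≤ 1 := fun N => by
    have h0 : (0 : ℝ) < N.1 := by exact_mod_cast N.2
    have h1 : (f N : ℝ) - N.1 * r = -(N.1 * (r - f N / N.1)) := by field_simp; ring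
    rw [h1, abs_neg, abs_mul, abs_of_pos h0]
    calc (N.1 : ℝ) * |r - f N / N.1| ≤ N.1 * (1 / N.1) := mul_le_mul_of_nonneg_left (hf N) h0.le
      _ = 1 := by field_simp
  refine ⟨f, hf', P.clean, fun N => 2 * (K * N.1 ^ d) + 2 * (P.bound + 1),
    2 * K + 2 * (P.bound + 1) + 2 * (⌈|r|⌉₊ + 1) + 5, fun N s ω hs => (hP N).clean s ω hs,
    fun N => ?_, fun N => ?_⟩
  · have h3 : 1 ≤ N.1 ^ d := Nat.one_le_pow _ _ N.2
    nlinarith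
  · have h1 : |f N| ≤ (N.1 * (⌈|r|⌉₊ + 1) : ℕ) := by
      have h0 : (1 : ℝ) ≤ N.1 := by exact_mod_cast N.2
      have h2 := abs_sub_abs_le_abs_sub (f N : ℝ) (N.1 * r)
      rw [abs_mul, abs_of_nonneg (by linarith : (0 : ℝ) ≤ N.1)] at h2
      have h3 := hf' N
      have h4 := Nat.le_ceil |r|
      have h5 : |(f N : ℝ)| ≤ N.1 * (⌈|r|⌉₊ + 1) := by nlinarith
      exact_mod_cast h5
    have h2 := sz_int_le (f N)
    have h3 := N.2
    rw [Int.abs_eq_natAbs] at h1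
    have h4 : (f N).natAbs ≤ N.1 * (⌈|r|⌉₊ + 1) := by exact_mod_cast h1
    have h6 : sz (f N) ≤ 2 * (N.1 * (⌈|r|⌉₊ + 1)) + 5 := by omega
    nlinarith

/-- Approximations to all entries of the matrix of a one-qubit gate. -/
theorem Gate.ApproximableInTime.exists_tab {d : ℕ} {n : Type} [Fintype n] [DecidableEq n]
    {E : Gate n} (h : E.ApproximableInTime d) :
    ∃ f : n → n → n → n → Pos → ℤ × ℤ, (∀ i j k l, Tab d (f i j k l)) ∧ ∀ i j k l (N : Pos),
      |((f i j k l N).1 : ℝ) - N.1 * (E.map (Matrix.single i j 1) k l).re| ≤ 1 ∧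
        |((f i j k l N).2 : ℝ) - N.1 * (E.map (Matrix.single i j 1) k l).im| ≤ 1 := by
  choose f hf tf using fun i j k l => (h i j k l).1.exists_tab
  choose g hg tg using fun i j k l => (h i j k l).2.exists_tab
  exact ⟨fun i j k l N => (f i j k l N, g i j k l N), fun i j k l => (tf i j k l).pair (tg i j k l),
    fun i j k l N => ⟨hf i j k l N, hg i j k l N⟩⟩

/-- The tensors of the gates, in terms of the entries of their matrices. -/
def tables (τ : List RawOne × List RawTwo) : List Tensor × List Tensor :=
  (τ.1.map tensorOne, τ.2.map tensorTwo)

theorem PT.tables {α : Type} [Enc α] {τ : α → List RawOne × List RawTwo} (h : PT τ) :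
    PT fun a => tables (τ a) :=
  ((PT.fst.comp h).map (f := fun _ (t : RawOne) => SepSim.tensorOne t) PT.snd.tensorOne).pair
    ((PT.snd.comp h).map (f := fun _ (t : RawTwo) => SepSim.tensorTwo t) PT.snd.tensorTwo)

theorem GateSet.ApproximableInTime.exists_tables {d : ℕ} {𝒢 : GateSet}
    (h : 𝒢.ApproximableInTime d) : ∃ τ : Pos → List RawOne × List RawTwo, Tab d τ ∧
      ∀ N, GoodTables 𝒢 N.1 (tables (τ N)) := by
  choose f tf hf using fun g => (h.1 g).exists_tab
  choose f' tf' hf' using fun g => (h.2 g).exists_tab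
  refine ⟨fun N => (List.ofFn fun g i j k l => f g i j k l N, List.ofFn fun g i₁ i₂ j₁ j₂ k₁ k₂ l₁ l₂ =>
    f' g (i₁, i₂) (j₁, j₂) (k₁, k₂) (l₁, l₂) N), ?_, fun N => ⟨fun g μ ν α β => ?_, fun g μ ν α β => ?_⟩⟩
  · refine (Tab.ofFn (f := fun g N i j k l => f g i j k l N) fun g => ?_).pair
      (Tab.ofFn (f := fun g N i₁ i₂ j₁ j₂ k₁ k₂ l₁ l₂ =>
        f' g (i₁, i₂) (j₁, j₂) (k₁, k₂) (l₁, l₂) N) fun g => ?_)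
    · exact Tab.bool fun i => Tab.bool fun j => Tab.bool fun k => Tab.bool fun l => tf g i j k l
    · exact Tab.bool fun i₁ => Tab.bool fun i₂ => Tab.bool fun j₁ => Tab.bool fun j₂ =>
        Tab.bool fun k₁ => Tab.bool fun k₂ => Tab.bool fun l₁ => Tab.bool fun l₂ =>
          tf' g (i₁, i₂) (j₁, j₂) (k₁, k₂) (l₁, l₂)
  · have : (tables (List.ofFn fun g i j k l => f g i j k l N, List.ofFn fun g i₁ i₂ j₁ j₂ k₁ k₂ l₁ l₂ =>
        f' g (i₁, i₂) (j₁, j₂) (k₁, k₂) (l₁, l₂) N)).1.getD g 0 =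
        tensorOne fun i j k l => f g i j k l N := by simp [tables]
    rw [this]
    exact tensorOne_approx _ (fun i j k l => hf g i j k l N) μ ν α β
  · have : (tables (List.ofFn fun g i j k l => f g i j k l N, List.ofFn fun g i₁ i₂ j₁ j₂ k₁ k₂ l₁ l₂ =>
        f' g (i₁, i₂) (j₁, j₂) (k₁, k₂) (l₁, l₂) N)).2.getD g 0 =
        tensorTwo fun i₁ i₂ j₁ j₂ k₁ k₂ l₁ l₂ =>
          f' g (i₁, i₂) (j₁, j₂) (k₁, k₂) (l₁, l₂) N := by simp [tables]
    rw [this]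
    exact tensorTwo_approx _ (fun i₁ i₂ j₁ j₂ k₁ k₂ l₁ l₂ =>
      hf' g (i₁, i₂) (j₁, j₂) (k₁, k₂) (l₁, l₂) N) μ ν α β

/-! ### Coin tosses -/

/-- Toss as many coins as the head of the input says, and replace the head by the list of
outcomes, the last one first. -/
def tossAll : Prog :=
  .seq (.assign 1 (.hd (.var 0))) <| .seq (.assign 2 .nil) <|
    .seq (.loop (.var 1) (.seq (.toss 3) (.seq (.assign 2 (.cons (.var 3) (.var 2)))
      (.assign 1 (.tl (.var 1)))))) (.assign 0 (.cons (.var 2) (.tl (.var 0))))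

theorem exec_tossLoop (n : ℕ) : ∀ (s : Store) (ω : ℕ → Bool) (l : List Bool),
    s 1 = enc n → s 2 = enc l →
      ∃ s', Exec (.loop (.var 1) (.seq (.toss 3) (.seq (.assign 2 (.cons (.var 3) (.var 2)))
        (.assign 1 (.tl (.var 1)))))) s ω s' (fun i => ω (n + i)) (10 * n + 2) ∧ s' 0 = s 0 ∧
        s' 2 = enc (((List.range n).map ω).reverse ++ l) := by
  induction n with
  | zero =>
    intro s ω l h1 h2
    refine ⟨s, ?_, rfl, by simpa using h2⟩
    simp only [zero_add]
    exact .loop_false (by simp only [Expr.eval, h1]; rfl)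
  | succ n ih =>
    intro s ω l h1 h2
    set s₁ := Function.update s 3 (Val.ofBool (ω 0)) with hs₁
    set s₂ := Function.update s₁ 2 ((Expr.cons (.var 3) (.var 2)).eval s₁) with hs₂
    set s₃ := Function.update s₂ 1 ((Expr.tl (.var 1)).eval s₂) with hs₃
    obtain ⟨s', e, h0, h⟩ := ih s₃ (fun i => ω (i + 1)) (ω 0 :: l)
      (by simp [hs₃, hs₂, hs₁, Expr.eval, h1]; rfl)
      (by simp [hs₃, hs₂, hs₁, Expr.eval, h2]; rfl)
    refine ⟨s', ?_, by rw [h0]; simp [hs₃, hs₂, hs₁], ?_⟩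
    · have h4 := Exec.loop_true (e := .var 1) (s := s) (ω := ω)
        (by simp only [Expr.eval, h1]; exact Val.noConfusion)
        (.seq (.toss 3 s ω) (.seq (.assign 2 (.cons (.var 3) (.var 2)) _ _)
          (.assign 1 (.tl (.var 1)) _ _))) e
      have h5 : (fun i => ω (n + 1 + i)) = fun i => ω (n + i + 1) := by
        ext1 i; congr 1; omega
      rw [h5]
      convert h4 using 1
      simp only [Expr.cost]; ring
    · rw [h, List.range_succ_eq_map]
      simp [Function.comp_def]

theorem exec_tossAll {α : Type} [Enc α] (n : ℕ) (a : α) (s : Store) (ω : ℕ → Bool)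
    (hs : s 0 = enc (n, a)) : ∃ s' ω' t, Exec tossAll s ω s' ω' t ∧
      s' 0 = enc (((List.range n).map ω).reverse, a) ∧ t ≤ 10 * n + 12 := by
  obtain ⟨s', e, h0, h⟩ := exec_tossLoop n (Function.update (Function.update s 1
    ((Expr.hd (.var 0)).eval s)) 2 .nil) ω [] (by simp [Expr.eval, hs]; rfl)
    (by rw [Function.update_self]; rfl)
  refine ⟨_, _, _, .seq (.assign 1 (.hd (.var 0)) s ω) (.seq (.assign 2 .nil _ _) (.seq e
    (.assign 0 (.cons (.var 2) (.tl (.var 0))) _ _))), ?_, by simp only [Expr.cost]; omega⟩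
  simp [Expr.eval, h0, h, hs]
  rfl

end SepSim
namespace SepSim
open Enc

/-! ### The sampling program -/

/-- `f` is `O(m ^ k)`. -/
def Dom {α : Type} (m : α → ℕ) (k : ℕ) (f : α → ℕ) : Prop := ∃ K, ∀ a, f a ≤ K * m a ^ k

section
variable {α : Type} {m f g : α → ℕ} {k l : ℕ}

theorem Dom.of_le (h : Dom m k f) (hg : ∀ a, g a ≤ f a) : Dom m k g :=
  h.imp fun _ hK a => (hg a).trans (hK a)

theorem Dom.self : Dom m 1 m := ⟨1, fun a => by simp⟩

theorem Dom.const (hm : ∀ a, 1 ≤ m a) (c : ℕ) : Dom m k fun _ => c :=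
  ⟨c, fun a => Nat.le_mul_of_pos_right _ (Nat.pow_pos (hm a))⟩

theorem Dom.weaken (hm : ∀ a, 1 ≤ m a) (h : Dom m k f) (hk : k ≤ l) : Dom m l f :=
  h.imp fun _ hK a => (hK a).trans (Nat.mul_le_mul_left _ (Nat.pow_le_pow_right (hm a) hk))

theorem Dom.add (hf : Dom m k f) (hg : Dom m k g) : Dom m k fun a => f a + g a := by
  obtain ⟨K, hK⟩ := hf
  obtain ⟨L, hL⟩ := hg
  exact ⟨K + L, fun a => by rw [add_mul]; exact Nat.add_le_add (hK a) (hL a)⟩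

theorem Dom.const_mul (c : ℕ) (hf : Dom m k f) : Dom m k fun a => c * f a := by
  obtain ⟨K, hK⟩ := hf
  exact ⟨c * K, fun a => by rw [mul_assoc]; exact Nat.mul_le_mul_left _ (hK a)⟩

theorem Dom.pow (hf : Dom m k f) (l : ℕ) : Dom m (k * l) fun a => f a ^ l := by
  obtain ⟨K, hK⟩ := hf
  exact ⟨K ^ l, fun a => (Nat.pow_le_pow_left (hK a) l).trans_eq (by rw [mul_pow, pow_mul])⟩

theorem Dom.poly (hm : ∀ a, 1 ≤ m a) (hf : Dom m k f) (h : ∀ a, g a ≤ (f a + 2) ^ l) :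
    Dom m (k * l) g := ((hf.add (Dom.const hm 2)).pow l).of_le h

end

/-- The descriptions of a circuit and its input, and the inverse of the tolerance. -/
abbrev Input : Type := (List RawOp × List Bool) × List Bool × ℕ × Unit

/-- The number of Bloch vectors in a list that represents an output of a gate. -/
def Input.precision (C : ℕ) (a : Input) : ℕ :=
  powAbove ((C * ((a.1.1.length + 1) * a.2.2.1)) * (C * ((a.1.1.length + 1) * a.2.2.1)))

theorem Input.precision_pos (C : ℕ) (a : Input) : 0 < a.precision C := powAbove_pos _

/-- The number of coins that are tossed. -/
def Input.coins (C : ℕ) (a : Input) : ℕ := (a.1.1.length + a.2.1.length) * (2 * a.precision C)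

/-- The sample, given the approximations to the gates and the outcomes of the coin tosses. -/
def Input.sample (C : ℕ) (a : Input) (τ : List RawOne × List RawTwo) (c : List Bool) : List Bool :=
  restrictBits a.1.2 (sampleBits (a.precision C) (tables τ) a.1.1 a.2.1 c)

theorem PT.precision (C : ℕ) : PT fun a : Input => a.precision C := by
  have h : PT fun a : Input => C * ((a.1.1.length + 1) * a.2.2.1) :=
    (PT.const C).mul (((PT.fst.comp PT.fst).length.add (PT.const 1)).mul
      (PT.fst.comp (PT.snd.comp PT.snd)))
  exact (h.mul h).powAbove

theorem PT.coins (C : ℕ) : PT fun a : Input => a.coins C :=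
  ((PT.fst.comp PT.fst).length.add (PT.fst.comp PT.snd).length).mul
    ((PT.const 2).mul (PT.precision C))

theorem PT.sample (C : ℕ) : PT fun b : List Bool × Input × List RawOne × List RawTwo =>
    b.2.1.sample C b.2.2 b.1.reverse := by
  have h : PT fun b : List Bool × Input × List RawOne × List RawTwo => b.2.1 :=
    PT.fst.comp PT.snd
  exact PT.restrictBits (PT.snd.comp (PT.fst.comp h)) (PT.sampleBits ((PT.precision C).comp h)
    (PT.snd.comp PT.snd).tables (PT.fst.comp (PT.fst.comp h)) (PT.fst.comp (PT.snd.comp h))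
    PT.fst.reverse)

/-- The order of quantifiers matters: `k` is fixed before the tables, whose running time and size
enter only through the constant in `Dom`. Deterministic preparation yields the number of coins, the
input and the tables; then all coins are tossed at once and a deterministic function is evaluated.
-/
theorem exists_sampleProg (C d : ℕ) : ∃ k, ∀ τ : Pos → List RawOne × List RawTwo, Tab d τ →
    ∃ (P : Prog) (T : Input → ℕ), Dom sz k T ∧ (∀ a, a.coins C ≤ T a) ∧
      ∀ (a : Input) (s : Store) (ω : ℕ → Bool), s 0 = enc a → ∃ s' ω' t, Exec P s ω s' ω' t ∧
        s' 0 = enc (a.sample C (τ ⟨_, a.precision_pos C⟩) ((List.range (a.coins C)).map ω)) ∧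
        t ≤ T a := by
  obtain ⟨Q, U, hQ, ⟨k₁, hU⟩, ⟨k₂, hn⟩⟩ := PT.coins C
  obtain ⟨R, V, hR, ⟨k₃, hV⟩, ⟨k₄, hM⟩⟩ := (PT.precision C).congr_enc
    (g := fun a : Input => (⟨_, a.precision_pos C⟩ : Pos)) fun _ => rfl
  obtain ⟨S, W, hS, ⟨k₅, hW⟩, -⟩ := PT.sample C
  have hm : ∀ a : Input, 1 ≤ sz a := fun a => sz_pos a
  -- An exponent that dominates the size of the data for the final stage: the input, the toss
  -- outcomes and the tables.
  set k₀ := 1 + k₂ + k₄ with hk₀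
  refine ⟨k₁ + k₂ + k₃ + k₄ * d + k₀ * k₅, fun τ ⟨X, Y, K, hX, hY, hτ⟩ => ?_⟩
  have hprep := hQ.pair (CompIn.pair (P := .assign 0 (.var 0)) (f := fun a : Input => a)
    (T := fun _ => 2) (fun a s ω hs => ⟨_, _, .assign _ _ _ _, by simp [Expr.eval, hs], le_rfl⟩)
    (hX.comp hR))
  set k := k₁ + k₂ + k₃ + k₄ * d + k₀ * k₅ with hk
  have dU : Dom sz k U := (Dom.poly hm Dom.self hU).weaken hm (by omega)
  have dn' : Dom sz k₂ fun a : Input => a.coins C :=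
    ((Dom.poly hm Dom.self hn).of_le fun a => by
      show a.coins C ≤ sz (a.coins C)
      rw [sz_nat]; omega).weaken hm (by omega)
  have dn : Dom sz k fun a : Input => a.coins C := dn'.weaken hm (by omega)
  have dV : Dom sz k V := (Dom.poly hm Dom.self hV).weaken hm (by omega)
  have dM : Dom sz k₄ fun a : Input => a.precision C :=
    ((Dom.poly hm Dom.self hM).of_le fun a => by
      have : sz (⟨_, a.precision_pos C⟩ : Pos) = 2 * a.precision C + 1 := sz_nat _
      rw [this]; omega).weaken hm (by omega)
  have dY : Dom sz k fun a : Input => Y ⟨_, a.precision_pos C⟩ :=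
    (((dM.pow d).const_mul K).of_le fun a => hY _).weaken hm (by omega)
  have dτ : Dom sz k₄ fun a : Input => sz (τ ⟨_, a.precision_pos C⟩) :=
    (dM.const_mul K).of_le fun a => hτ _
  have dB : Dom sz k₀ fun a : Input => (4 * a.coins C + 1) +
      (sz a + sz (τ ⟨_, a.precision_pos C⟩) + 1) + 1 :=
    ((((dn'.weaken hm (by omega)).const_mul 4).add (Dom.const hm 1)).add
      (((Dom.self.weaken hm (by omega)).add (dτ.weaken hm (by omega))).add (Dom.const hm 1))).add
      (Dom.const hm 1)
  have hB : ∀ (a : Input) (ω : ℕ → Bool), sz (((List.range (a.coins C)).map ω).reverse, a,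
      τ ⟨_, a.precision_pos C⟩) ≤
      (4 * a.coins C + 1) + (sz a + sz (τ ⟨_, a.precision_pos C⟩) + 1) + 1 := fun a ω => by
    have h1 : ∀ b : Bool, sz b ≤ 3 := by decide
    have h2 := sz_le_of_forall (l := ((List.range (a.coins C)).map ω).reverse) fun b _ => h1 b
    rw [List.length_reverse, List.length_map, List.length_range] at h2
    rw [sz_pair, sz_pair]
    omega
  have dW : Dom sz k fun a : Input => ((4 * a.coins C + 1) +
      (sz a + sz (τ ⟨_, a.precision_pos C⟩) + 1) + 1 + 2) ^ k₅ :=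
    (dB.poly hm fun a => le_rfl).weaken hm (by omega)
  refine ⟨.seq (Q.pair (.pair (.assign 0 (.var 0)) (.seq R X))) (.seq tossAll S),
    fun a => U a + (2 + (V a + Y ⟨_, a.precision_pos C⟩) + 10) + 10 + (10 * a.coins C + 12 +
    ((4 * a.coins C + 1) + (sz a + sz (τ ⟨_, a.precision_pos C⟩) + 1) + 1 + 2) ^ k₅),
    ((dU.add (((Dom.const hm 2).add (dV.add dY)).add (Dom.const hm 10))).add (Dom.const hm 10)).add
      (((dn.const_mul 10).add (Dom.const hm 12)).add dW), fun a => by dsimp only; omega, fun a s ω hs => ?_⟩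
  obtain ⟨s₁, t₁, e₁, h₁, ht₁⟩ := hprep a s ω hs
  obtain ⟨s₂, ω₂, t₂, e₂, h₂, ht₂⟩ := exec_tossAll _ _ s₁ ω h₁
  obtain ⟨s₃, t₃, e₃, h₃, ht₃⟩ := hS (_, _) s₂ ω₂ h₂
  refine ⟨s₃, ω₂, _, .seq e₁ (.seq e₂ e₃), ?_, ?_⟩
  · rw [h₃]
    dsimp only
    rw [List.reverse_reverse]
  · have := (hW (((List.range (a.coins C)).map ω).reverse, a, τ ⟨_, a.precision_pos C⟩)).trans
      (Nat.pow_le_pow_left (Nat.add_le_add_right (hB a ω) 2) k₅)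
    dsimp only at ht₁ ⊢
    omega

/-! ### The size of the description of a circuit -/

section
variable {𝒢 : GateSet}

theorem Op.card_qubits_le {q : ℕ} (o : Op 𝒢 q) : o.qubits.card ≤ 2 := by
  cases o with
  | one g i => simp [Op.qubits]
  | two g i j hij => exact Finset.card_le_two

/-- Every qubit is idle or among the at most two qubits of some gate. -/
theorem Circuit.qubits_le (c : Circuit 𝒢) : c.qubits ≤ 2 * c.size + c.idle := by
  have h : ∀ ops : List (Op 𝒢 c.qubits),
      (Finset.univ.filter fun i : Fin c.qubits => ∃ o ∈ ops, i ∈ o.qubits).card ≤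
        2 * ops.length := by
    intro ops
    induction ops with
    | nil => simp
    | cons o ops ih =>
      have e : (Finset.univ.filter fun i : Fin c.qubits => ∃ o' ∈ o :: ops, i ∈ o'.qubits) =
          o.qubits ∪ Finset.univ.filter fun i : Fin c.qubits => ∃ o ∈ ops, i ∈ o.qubits := by
        ext i; simp
      rw [e, List.length_cons]
      have h1 := Finset.card_union_le o.qubits
        (Finset.univ.filter fun i : Fin c.qubits => ∃ o ∈ ops, i ∈ o.qubits)
      have h2 := o.card_qubits_le
      omega
  have h1 := Finset.card_filter_add_card_filter_not (s := (Finset.univ : Finset (Fin c.qubits)))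
    (fun i : Fin c.qubits => ∃ o ∈ c.ops, i ∈ o.qubits)
  have h2 := h c.ops
  simp only [Finset.card_univ, Fintype.card_fin, not_exists, not_and] at h1
  rw [Circuit.size, Circuit.idle]
  omega

/-- The input that describes the circuit. -/
def Circuit.input (c : Circuit 𝒢) (x : Fin c.qubits → Bool) (e : ℕ) : Input :=
  ((c.ops.map Op.raw, c.flags), List.ofFn x, e, ())

/-- The trailing `Unit` in `Input` supplies the `nil` that ends the three-element list. -/
theorem Circuit.enc_input (c : Circuit 𝒢) (x : Fin c.qubits → Bool) (e : ℕ) :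
    enc (c.input x e) = .ofList [c.encode, .ofBits (List.ofFn x), .ofNat e] := by
  rw [c.encode_eq]; rfl

theorem Op.sz_raw_le {q : ℕ} (o : Op 𝒢 q) :
    sz o.raw ≤ 2 * (𝒢.numOne + 𝒢.numTwo) + 4 * q + 15 := by
  have h1 : ∀ b : Bool, sz b ≤ 3 := by decide
  cases o with
  | one g i =>
    have : sz (Op.one g i : Op 𝒢 q).raw = sz false + (sz (g : ℕ) + (sz (i : ℕ) + 1 + 1) + 1) + 1 := rfl
    have h := h1 false
    rw [this, sz_nat, sz_nat]; omega
  | two g i j hij =>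
    have : sz (Op.two g i j hij : Op 𝒢 q).raw =
        sz true + (sz (g : ℕ) + (sz (i : ℕ) + (sz (j : ℕ) + 1 + 1) + 1) + 1) + 1 := rfl
    have h := h1 true
    rw [this, sz_nat, sz_nat, sz_nat]; omega

/-- The size is quadratic because each gate names its qubits in unary. The gate set enters only
through the numbers of the gates, hence only in the constant. -/
theorem Circuit.sz_input_le (c : Circuit 𝒢) (x : Fin c.qubits → Bool) (e : ℕ) :
    sz (c.input x e) ≤ (2 * (𝒢.numOne + 𝒢.numTwo) + 60) *
      ((c.size + c.idle + 1) * (e + 1)) ^ 2 := by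
  have h1 : ∀ b : Bool, sz b ≤ 3 := by decide
  have h2 := sz_le_of_forall (l := c.flags) fun b _ => h1 b
  have h3 := sz_le_of_forall (l := List.ofFn x) fun b _ => h1 b
  have h4 := sz_le_of_forall (l := c.ops.map Op.raw)
    (B := 2 * (𝒢.numOne + 𝒢.numTwo) + 4 * c.qubits + 15) fun b hb => by
      obtain ⟨o, -, rfl⟩ := List.mem_map.1 hb
      exact o.sz_raw_le
  have h5 : sz (c.input x e) = sz (c.ops.map Op.raw) + sz c.flags + 1 +
      (sz (List.ofFn x) + (sz e + 1 + 1) + 1) + 1 := rfl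
  have h6 := c.qubits_le
  rw [Circuit.flags, List.length_ofFn] at h2
  rw [List.length_ofFn] at h3
  rw [List.length_map] at h4
  rw [h5, sz_nat, Circuit.flags]
  change sz (c.ops.map Op.raw) ≤ c.size * _ + 1 at h4
  set G := 2 * (𝒢.numOne + 𝒢.numTwo)
  set L := (c.size + c.idle + 1) * (e + 1) with hL
  have h7 : c.size + c.idle + 1 ≤ L := Nat.le_mul_of_pos_right _ (by omega)
  have h8 : e + 1 ≤ L := Nat.le_mul_of_pos_left _ (by omega)
  have h9 : c.size * (G + 4 * c.qubits + 15 + 1) ≤ L * (G + 8 * L + 16) :=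
    Nat.mul_le_mul (by omega) (by omega)
  have h10 : L ≤ L ^ 2 := Nat.le_self_pow (by norm_num) L
  have h11 : G * L ≤ G * L ^ 2 := Nat.mul_le_mul_left _ h10
  have h12 : L * (G + 8 * L + 16) = G * L + 8 * L ^ 2 + 16 * L := by ring
  rw [add_mul]
  omega

end

/-! ### The theorem -/

/-- The simulation needs `m` tosses per gate and `m + 1` per qubit. Tossing `2 * 2 ^ m` for each
wastes coins but avoids computing a logarithm. -/
theorem Input.coins_ge {𝒢 : GateSet} (C : ℕ) (c : Circuit 𝒢) (x : Fin c.qubits → Bool) (e : ℕ) {m : ℕ}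
    (hm : (c.input x e).precision C = 2 ^ m) :
    c.size * m + c.qubits * (m + 1) ≤ (c.input x e).coins C := by
  have h1 : (c.input x e).coins C = (c.size + c.qubits) * (2 * 2 ^ m) := by
    rw [← hm, Input.coins, Circuit.input, List.length_map, List.length_ofFn]; rfl
  have h2 := Nat.lt_two_pow_self (n := m)
  have h3 : c.size * m ≤ c.size * (2 * 2 ^ m) := Nat.mul_le_mul_left _ (by omega)
  have h4 : c.qubits * (m + 1) ≤ c.qubits * (2 * 2 ^ m) := Nat.mul_le_mul_left _ (by omega)
  rw [h1, add_mul]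
  omega

/-- A program that, started with any contents of the other variables, approximately samples from
the output distributions of circuits over the gate set. -/
theorem exists_sampler (d : ℕ) : ∃ k, ∀ 𝒢 : GateSet, 𝒢.ApproximableInTime d →
    (∀ g, (𝒢.two g).IsSeparable) → ∃ (P : Prog) (K : ℕ),
      ∀ (c : Circuit 𝒢) (x : Fin c.qubits → Bool) (e : ℕ), 0 < e →
        ∃ (n : ℕ) (F : List Bool → c.Outcome),
          n ≤ K * ((c.size + c.idle + 1) * (e + 1)) ^ k ∧
          (∀ (s : Store) (ω : ℕ → Bool),
            s 0 = .ofList [c.encode, .ofBits (List.ofFn x), .ofNat e] →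
            ∃ s' ω' t, Exec P s ω s' ω' t ∧ s' 0 = c.encodeOutcome (F ((List.range n).map ω)) ∧
              t ≤ K * ((c.size + c.idle + 1) * (e + 1)) ^ k) ∧
          ∀ T, n ≤ T → l1Dist (c.outputProb x) (tossProb T n F) < 1 / e := by
  -- The coefficient of `size / √M` in `l1Dist_sampleBits_le`.
  obtain ⟨C, hC⟩ : ∃ C : ℕ, C = 160000 := ⟨_, rfl⟩
  obtain ⟨k, h⟩ := exists_sampleProg C d
  -- The input size is at most quadratic in the parameter `(size + idle + 1) * (e + 1)`.
  refine ⟨2 * k, fun 𝒢 h𝒢 hsep => ?_⟩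
  obtain ⟨τ, hτ, hgood⟩ := h𝒢.exists_tables
  obtain ⟨P, T, ⟨K, hK⟩, hn, hP⟩ := h τ hτ
  refine ⟨P, K * (2 * (𝒢.numOne + 𝒢.numTwo) + 60) ^ k, fun c x e he => ?_⟩
  set a := c.input x e with ha
  obtain ⟨m, hm⟩ := (powAbove_spec ((C * ((a.1.1.length + 1) * a.2.2.1)) *
    (C * ((a.1.1.length + 1) * a.2.2.1)))).1
  have hT : T a ≤ K * (2 * (𝒢.numOne + 𝒢.numTwo) + 60) ^ k *
      ((c.size + c.idle + 1) * (e + 1)) ^ (2 * k) := by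
    rw [mul_assoc, pow_mul, ← mul_pow]
    exact (hK a).trans (Nat.mul_le_mul_left _ (Nat.pow_le_pow_left (c.sz_input_le x e) k))
  refine ⟨a.coins C, fun l => c.outcome (sampleBits (a.precision C)
    (tables (τ ⟨_, a.precision_pos C⟩)) (c.ops.map Op.raw) (List.ofFn x) l), (hn a).trans hT,
    fun s ω hs => ?_, fun U hU => ?_⟩
  · obtain ⟨s', ω', t, h1, h2, h3⟩ := hP a s ω (by rw [hs, ha, c.enc_input])
    refine ⟨s', ω', t, h1, ?_, h3.trans hT⟩
    rw [h2, encodeOutcome_outcome]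
    rfl
  · refine l1Dist_sampleBits_lt (m := m) hm (hgood ⟨_, a.precision_pos C⟩) hsep c x
      (Input.coins_ge C c x e hm) hU he ?_
    have h1 := (powAbove_spec ((C * ((a.1.1.length + 1) * a.2.2.1)) *
      (C * ((a.1.1.length + 1) * a.2.2.1)))).2
    have h2 : a.1.1.length = c.size := by rw [ha, Circuit.input, List.length_map]; rfl
    have h3 : a.2.2.1 = e := rfl
    refine le_trans (le_of_eq ?_) h1
    rw [← hC, sq, h2, h3]

end SepSim
-- Uniform families and real tolerances.
namespace SepSim
open Enc

/-- Replace the head of the input by the output of `G`, and run `P`. -/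
def Prog.withGenerator (G P : Prog) : Prog :=
  .seq (.assign (G.bound + 1) (.tl (.var 0))) <| .seq (.assign 0 (.hd (.var 0))) <|
    .seq G.clean <| .seq (.assign 0 (.cons (.var 0) (.var (G.bound + 1)))) P

theorem bound_clear (n : ℕ) : (clear n).bound = n + 1 := by
  induction n with
  | zero => rfl
  | succ n ih => simp [clear, Prog.bound, Expr.bound, ih]

/-- The rest of the input waits in variable `G.bound + 1`, just above those that `G.clean` may
change. The generator is run in its coin-free form, whence the factor 2 on its time. -/
theorem exec_withGenerator {G P : Prog} {a b r o : Val} {T U : ℕ} (hG : G.ComputesWithin a b T)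
    {s : Store} {ω : ℕ → Bool} (hs : s 0 = .cons a r)
    (hP : ∀ s : Store, s 0 = .cons b r → ∃ s' ω' t, Exec P s ω s' ω' t ∧ s' 0 = o ∧ t ≤ U) :
    ∃ s' ω' t, Exec (Prog.withGenerator G P) s ω s' ω' t ∧ s' 0 = o ∧
      t ≤ U + 2 * T + 2 * G.bound + 12 := by
  set s₁ := Function.update s (G.bound + 1) ((Expr.tl (.var 0)).eval s) with hs₁
  have h0 : s₁ 0 = .cons a r := by rw [hs₁, Function.update_of_ne (by omega), hs]
  obtain ⟨s₂, t₂, e₂, h₂, ht₂⟩ := hG.clean (Function.update s₁ 0 ((Expr.hd (.var 0)).eval s₁)) ω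
    (by simp [Expr.eval, h0, Val.hd])
  have hB : G.clean.bound ≤ G.bound + 1 := by
    simp [Prog.clean, Prog.bound, bound_clear, Prog.bound_derand]
  obtain ⟨s₃, ω₃, t₃, e₃, h₃, ht₃⟩ := hP (Function.update s₂ 0
    ((Expr.cons (.var 0) (.var (G.bound + 1))).eval s₂)) (by
      rw [Function.update_self]
      simp only [Expr.eval]
      rw [h₂, e₂.frame _ hB, Function.update_of_ne (by omega), hs₁, Function.update_self]
      simp [Expr.eval, hs, Val.tl])
  refine ⟨s₃, ω₃, _, .seq (.assign _ _ _ _) (.seq (.assign _ _ _ _) (.seq e₂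
    (.seq (.assign _ _ _ _) e₃))), h₃, ?_⟩
  simp only [Expr.cost]
  omega

theorem simulates_of_exec {𝒢 : GateSet} {P : Prog} {desc : Val} {c : Circuit 𝒢}
    {x : Fin c.qubits → Bool} {ε B : ℝ} {T n : ℕ} {F : List Bool → c.Outcome} (hT : (T : ℝ) ≤ B)
    (hP : ∀ ω : ℕ → Bool, P.HaltsWithin (.ofList [desc, .ofBits (List.ofFn x), .ofNat ⌈1 / ε⌉₊]) ω
      (c.encodeOutcome (F ((List.range n).map ω))) T)
    (hF : l1Dist (c.outputProb x) (tossProb T n F) < ε) : Simulates P desc c x ε B :=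
  ⟨T, tossProb T n F, hT, ⟨fun r => F ((List.range n).map fun i =>
    if h : i < T then r ⟨i, h⟩ else false), fun _ => hP _, fun _ => rfl⟩, hF⟩

/-- The running time of the sampler, in terms of the tolerance. -/
theorem sampler_time_le {a k K : ℕ} {ε : ℝ} (hε : 0 < ε) (hε1 : ε ≤ 1) :
    ((K * ((a + 1) * (⌈1 / ε⌉₊ + 1)) ^ k : ℕ) : ℝ) ≤ K * 3 ^ k * (((a : ℝ) + 1) / ε) ^ k := by
  have h1 : (⌈1 / ε⌉₊ : ℝ) + 1 ≤ 3 / ε := by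
    have h2 := (Nat.ceil_lt_add_one (by positivity : 0 ≤ 1 / ε)).le
    have h3 : 1 ≤ 1 / ε := by rwa [le_div_iff₀ hε, one_mul]
    have h4 : 3 / ε = 1 / ε + 1 / ε + 1 / ε := by ring
    linarith
  push_cast
  rw [mul_assoc, ← mul_pow]
  refine mul_le_mul_of_nonneg_left (pow_le_pow_left₀ (by positivity) ?_ k) (by positivity)
  calc ((a : ℝ) + 1) * (⌈1 / ε⌉₊ + 1) ≤ ((a : ℝ) + 1) * (3 / ε) :=
        mul_le_mul_of_nonneg_left h1 (by positivity)
    _ = 3 * (((a : ℝ) + 1) / ε) := by ring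

/-- The program knows only `e = ⌈1 / ε⌉`; a distance below `1 / e` is below `ε`. -/
theorem one_div_ceil_le {ε : ℝ} (hε : 0 < ε) : 0 < ⌈1 / ε⌉₊ ∧ 1 / (⌈1 / ε⌉₊ : ℝ) ≤ ε := by
  have h : 0 < ⌈1 / ε⌉₊ := Nat.ceil_pos.2 (by positivity)
  refine ⟨h, ?_⟩
  rw [div_le_comm₀ (by exact_mod_cast h) hε]
  exact Nat.le_ceil _

end SepSim

theorem mainTheorem1 :
    ∀ d : ℕ, ∃ k : ℕ, ∀ 𝒢 : SepSim.GateSet,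
      𝒢.ApproximableInTime d → (∀ g, (𝒢.two g).IsSeparable) →
      (∃ (P : SepSim.Prog) (K : ℝ),
        ∀ (c : SepSim.Circuit 𝒢) (x : Fin c.qubits → Bool) (ε : ℝ), 0 < ε → ε ≤ 1 →
          SepSim.Simulates P c.encode c x ε (K * ((c.size + c.idle + 1) / ε) ^ k)) ∧
      (∀ F : SepSim.UniformFamily 𝒢, ∃ (P : SepSim.Prog) (K : ℝ),
        ∀ (n : ℕ) (x : Fin (F.circuit n).qubits → Bool) (ε : ℝ), 0 < ε → ε ≤ 1 →
          SepSim.Simulates P (SepSim.Val.ofNat n) (F.circuit n) x ε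
            (K * (F.t n + (((F.circuit n).size + (F.circuit n).idle + 1) / ε) ^ k))) := by
  intro d
  obtain ⟨k, h⟩ := SepSim.exists_sampler d
  refine ⟨k, fun 𝒢 h𝒢 hsep => ?_⟩
  obtain ⟨P, K, hP⟩ := h 𝒢 h𝒢 hsep
  refine ⟨⟨P, K * 3 ^ k, fun c x ε hε hε1 => ?_⟩, fun F =>
    ⟨SepSim.Prog.withGenerator F.generator P, K * 3 ^ k + 2 * F.generator.bound + 14,
      fun n x ε hε hε1 => ?_⟩⟩
  · obtain ⟨he, he'⟩ := SepSim.one_div_ceil_le hε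
    obtain ⟨m, out, hm, hrun, hdist⟩ := hP c x _ he
    have hT := SepSim.sampler_time_le (a := c.size + c.idle) (k := k) (K := K) hε hε1
    rw [Nat.cast_add] at hT
    exact SepSim.simulates_of_exec hT (fun ω => hrun _ ω (Function.update_self _ _ _))
      ((hdist _ hm).trans_le he')
  · obtain ⟨he, he'⟩ := SepSim.one_div_ceil_le hε
    obtain ⟨m, out, hm, hrun, hdist⟩ := hP (F.circuit n) x _ he
    have hT := SepSim.sampler_time_le (a := (F.circuit n).size + (F.circuit n).idle) (k := k) (K := K) hε hε1
    rw [Nat.cast_add] at hT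
    set U := K * (((F.circuit n).size + (F.circuit n).idle + 1) * (⌈1 / ε⌉₊ + 1)) ^ k
    clear_value U
    have hT' : ((U + 2 * F.t n + 2 * F.generator.bound + 12 : ℕ) : ℝ) ≤
        (K * 3 ^ k + 2 * F.generator.bound + 14) *
          (F.t n + ((((F.circuit n).size : ℝ) + (F.circuit n).idle + 1) / ε) ^ k) := by
      -- Since this power is at least 1, the additive overhead of calling the generator is absorbed
      -- into the constant.
      have h1 : 1 ≤ ((((F.circuit n).size : ℝ) + (F.circuit n).idle + 1) / ε) ^ k := by
        refine one_le_pow₀ ?_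
        rw [le_div_iff₀ hε, one_mul]
        have : (0 : ℝ) ≤ ((F.circuit n).size : ℝ) + (F.circuit n).idle := by positivity
        linarith
      set X := ((((F.circuit n).size : ℝ) + (F.circuit n).idle + 1) / ε) ^ k
      have h2 : (0 : ℝ) ≤ F.t n := Nat.cast_nonneg _
      have h3 : (0 : ℝ) ≤ F.generator.bound := Nat.cast_nonneg _
      have h4 : (0 : ℝ) ≤ K * 3 ^ k := by positivity
      push_cast
      nlinarith [mul_nonneg h4 h2, mul_nonneg h3 h2, mul_le_mul_of_nonneg_left h1 h3]
    exact SepSim.simulates_of_exec hT' (fun ω => SepSim.exec_withGenerator (F.generates n)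
      (Function.update_self _ _ _) fun s hs => hrun s ω hs) ((hdist _ (by omega)).trans_le he')
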